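/- Let $1<p<3$, and for $1<m<3$ put $m^*=\frac{3m}{3-m}$. Assume $$\max\Big\{1,\frac{3p}{5p-3}\Big\}<q<3,\qquad \max\Big\{1,\frac{(q^*-1)p}{q^*}\Big\}<s<\frac{(q^*-1)p^*}{q^*}.$$ Let $W^{1,p}(\mathbb R^3)$ be the usual Sobolev space of real-valued functions with norm $\|u\|=\big(\int_{\mathbb R^3}|\nabla u|^p+|u|^p\,dx\big)^{1/p}$, and let $D^{1,q}(\mathbb R^3)\subset L^{q^*}(\mathbb R^3)$ be the completion of $C_0^\infty(\mathbb R^3)$ with respect to $\|\phi\|_{D^{1,q}}=\big(\int_{\mathbb R^3}|\nabla\phi|^q\,dx\big)^{1/q}$. For every $u\in W^{1,p}(\mathbb R^3)$ there is a unique weak solution $\phi_u\in D^{1,q}(\mathbb R^3)$ of $-\Delta_q\phi=|u|^s$, i.e. $$\int_{\mathbb R^3}|\nabla\phi_u|^{q-2}\nabla\phi_u\cdot\nabla v\,dx=\int_{\mathbb R^3}|u|^s v\,dx\qquad\text{for all } v\in D^{1,q}(\mathbb R^3),$$ and it has the following properties (all integrals below being well defined). (i) $\displaystyle\int_{\mathbb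 R^3}\Big(\frac1q|\nabla\phi_u|^q-|u|^s\phi_u\Big)dx=\min_{\phi\in D^{1,q}(\mathbb R^3)}\int_{\mathbb R^3}\Big(\frac1q|\nabla\phi|^q-|u|^s\phi\Big)dx$, and $\phi_u\ge 0$ almost everywhere. (ii) For $t>0$, $\phi_{tu}=t^{\frac{s}{q-1}}\phi_u$; for $t>0$ and $k\in\mathbb R$, the function $u_t(x)=t^k u(tx)$ belongs to $W^{1,p}(\mathbb R^3)$ and $\phi_{u_t}(x)=t^{\frac{ks-q}{q-1}}\phi_u(tx)$ for almost every $x$. Moreover, for every $y\in\mathbb R^3$, $\phi_{u(\cdot+y)}=\phi_u(\cdot+y)$ almost everywhere. (iii) There is a constant $C>0$ that does not depend on $u$ such that $\|\phi_u\|_{D^{1,q}}\le C\|u\|^{\frac{s}{q-1}}$ for all $u\in W^{1,p}(\mathbb R^3)$. (iv) If $u_n\rightharpoonup u$ weakly in $W^{1,p}(\mathbb R^3)$, then $\phi_{u_n}\rightharpoonup\phi_u$ weakly in $D^{1,q}(\mathbb R^3)$ and $$\int_{\mathbb R^3}\phi_{u_n}|u_n|^{s-2}u_n\varphi\,dx\to\int_{\mathbb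 R^3}\phi_u|u|^{s-2}u\varphi\,dx\qquad\text{for all }\varphi\in W^{1,p}(\mathbb R^3).$$ (v) If $u_n\to u$ in $W^{1,p}(\mathbb R^3)$, then $\phi_{u_n}\to\phi_u$ in $D^{1,q}(\mathbb R^3)$. -/

import Mathlib

open MeasureTheory Filter Topology
open scoped ENNReal NNReal ContDiff

noncomputable section

namespace QSP

/-- Three-dimensional Euclidean space (the volume is Lebesgue measure). -/
abbrev E3 : Type := EuclideanSpace ℝ (Fin 3)

instance factOneLeOfReal {p : ℝ} [h : Fact (1 < p)] : Fact (1 ≤ ENNReal.ofReal p) :=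
  ⟨by simpa using ENNReal.ofReal_le_ofReal h.out.le⟩

/-- The Sobolev exponent `q* = 3q/(3-q)` in dimension three (used for `1 < q < 3`). -/
def sobolevExp (q : ℝ) : ℝ := 3 * q / (3 - q)

instance factSobolevExp {q : ℝ} [h1 : Fact (1 < q)] [h3 : Fact (q < 3)] :
    Fact (1 < sobolevExp q) := ⟨by
  have a := h1.out
  have b := h3.out
  unfold sobolevExp
  rw [lt_div_iff₀ (by linarith)]
  linarith⟩

/-- Test functions: the real-valued functions of class `C_0^∞` on `ℝ³`. -/
def IsTest (ψ : E3 → ℝ) : Prop := ContDiff ℝ ∞ ψ ∧ HasCompactSupport ψ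

theorem IsTest.continuous_gradient {ψ : E3 → ℝ} (h : IsTest ψ) : Continuous (gradient ψ) :=
  (InnerProductSpace.toDual ℝ E3).symm.continuous.comp (h.1.continuous_fderiv (by simp))

theorem IsTest.hasCompactSupport_gradient {ψ : E3 → ℝ} (h : IsTest ψ) :
    HasCompactSupport (gradient ψ) :=
  (h.2.fderiv (𝕜 := ℝ)).comp_left (g := (InnerProductSpace.toDual ℝ E3).symm) (map_zero _)

theorem IsTest.gradient_add {ψ χ : E3 → ℝ} (h : IsTest ψ) (h' : IsTest χ) :
    gradient (ψ + χ) = gradient ψ + gradient χ := by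
  funext x
  have a : DifferentiableAt ℝ ψ x := h.1.differentiable (by simp) x
  have b : DifferentiableAt ℝ χ x := h'.1.differentiable (by simp) x
  simp only [gradient, Pi.add_apply]
  rw [fderiv_add a b, map_add]

theorem IsTest.gradient_smul {ψ : E3 → ℝ} (h : IsTest ψ) (c : ℝ) :
    gradient (c • ψ) = c • gradient ψ := by
  funext x
  have a : DifferentiableAt ℝ ψ x := h.1.differentiable (by simp) x
  simp only [gradient, Pi.smul_apply]
  rw [fderiv_const_smul a]
  simp

/-- `g` is the weak (distributional) gradient of `u`:
`∫ u ∇ψ = - ∫ ψ g` for every test function `ψ` (an identity of vectors in `ℝ³`). -/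
def HasWeakGrad (u : E3 → ℝ) (g : E3 → E3) : Prop :=
  ∀ ψ : E3 → ℝ, IsTest ψ → ∫ x, u x • gradient ψ x = - ∫ x, ψ x • g x

/-! ### The Sobolev space `W^{1,p}(ℝ³)` -/

/-- The pairs `(u, g)` with `u ∈ L^p(ℝ³)`, `g ∈ L^p(ℝ³; ℝ³)` and `g` the weak gradient of `u`,
inside the `ℓ^p`-product of the two Lebesgue spaces, so that the inherited norm is
`(∫ |u|^p + |∇u|^p)^(1/p)`. -/
def W1Submodule (p : ℝ) [Fact (1 < p)] :
    Submodule ℝ (WithLp (ENNReal.ofReal p)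
      (Lp ℝ (ENNReal.ofReal p) (volume : Measure E3) ×
        Lp E3 (ENNReal.ofReal p) (volume : Measure E3))) where
  carrier := {U | HasWeakGrad U.fst U.snd}
  zero_mem' := by
    intro ψ _
    simp
  add_mem' := by
    intro U V hU hV ψ hψ
    have hp : 1 ≤ ENNReal.ofReal p := Fact.out
    have i1 (f : Lp ℝ (ENNReal.ofReal p) (volume : Measure E3)) :
        Integrable (fun x => f x • gradient ψ x) :=
      ((Lp.memLp f).locallyIntegrable hp).integrable_smul_right_of_hasCompactSupport
        hψ.continuous_gradient hψ.hasCompactSupport_gradient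
    have i2 (f : Lp E3 (ENNReal.ofReal p) (volume : Measure E3)) :
        Integrable (fun x => ψ x • f x) :=
      ((Lp.memLp f).locallyIntegrable hp).integrable_smul_left_of_hasCompactSupport
        hψ.1.continuous hψ.2
    have h1 : ∫ x, (U + V).fst x • gradient ψ x
        = ∫ x, (U.fst x • gradient ψ x + V.fst x • gradient ψ x) := by
      apply integral_congr_ae
      filter_upwards [Lp.coeFn_add U.fst V.fst] with x hx
      rw [WithLp.add_fst, hx, Pi.add_apply, add_smul]
    have h2 : ∫ x, ψ x • (U + V).snd x
        = ∫ x, (ψ x • U.snd x + ψ x • V.snd x) := by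
      apply integral_congr_ae
      filter_upwards [Lp.coeFn_add U.snd V.snd] with x hx
      rw [WithLp.add_snd, hx, Pi.add_apply, smul_add]
    rw [h1, h2, integral_add (i1 _) (i1 _), integral_add (i2 _) (i2 _), hU ψ hψ, hV ψ hψ, neg_add]
  smul_mem' := by
    intro c U hU ψ hψ
    have h1 : ∫ x, (c • U).fst x • gradient ψ x = ∫ x, c • (U.fst x • gradient ψ x) := by
      apply integral_congr_ae
      filter_upwards [Lp.coeFn_smul c U.fst] with x hx
      rw [WithLp.smul_fst, hx, Pi.smul_apply, smul_assoc]
    have h2 : ∫ x, ψ x • (c • U).snd x = ∫ x, c • (ψ x • U.snd x) := by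
      apply integral_congr_ae
      filter_upwards [Lp.coeFn_smul c U.snd] with x hx
      rw [WithLp.smul_snd, hx, Pi.smul_apply, smul_comm]
    rw [h1, h2, integral_smul, integral_smul, hU ψ hψ, smul_neg]

/-- The Sobolev space `W^{1,p}(ℝ³)` with the norm `(∫ |∇u|^p + |u|^p)^(1/p)`. -/
abbrev W1 (p : ℝ) [Fact (1 < p)] : Type := W1Submodule p

/-- The function `u` underlying an element of `W^{1,p}(ℝ³)` (defined almost everywhere). -/
def W1.fn {p : ℝ} [Fact (1 < p)] (u : W1 p) : E3 → ℝ := u.1.fst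

/-- The weak gradient of an element of `W^{1,p}(ℝ³)` (defined almost everywhere). -/
def W1.grad {p : ℝ} [Fact (1 < p)] (u : W1 p) : E3 → E3 := u.1.snd

/-! ### The homogeneous Sobolev space `D^{1,q}(ℝ³)` -/

/-- The pairs `(ψ, ∇ψ)`, `ψ` a test function, in `L^{q*}(ℝ³) × L^q(ℝ³; ℝ³)`. -/
def testPairs (q : ℝ) [Fact (1 < q)] [Fact (q < 3)] :
    Submodule ℝ (Lp ℝ (ENNReal.ofReal (sobolevExp q)) (volume : Measure E3) ×
      Lp E3 (ENNReal.ofReal q) (volume : Measure E3)) where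
  carrier := {P | ∃ ψ : E3 → ℝ, IsTest ψ ∧ P.1 =ᵐ[volume] ψ ∧ P.2 =ᵐ[volume] gradient ψ}
  zero_mem' := by
    refine ⟨0, ⟨contDiff_const, HasCompactSupport.zero⟩, Lp.coeFn_zero _ _ _, ?_⟩
    have : gradient (0 : E3 → ℝ) = 0 := by
      funext x
      simp [gradient]
    rw [this]
    exact Lp.coeFn_zero _ _ _
  add_mem' := by
    rintro P Q ⟨ψ, hψ, h1, h2⟩ ⟨χ, hχ, k1, k2⟩
    refine ⟨ψ + χ, ⟨hψ.1.add hχ.1, hψ.2.add hχ.2⟩, (Lp.coeFn_add _ _).trans (h1.add k1), ?_⟩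
    rw [hψ.gradient_add hχ]
    exact (Lp.coeFn_add _ _).trans (h2.add k2)
  smul_mem' := by
    rintro c P ⟨ψ, hψ, h1, h2⟩
    refine ⟨c • ψ, ⟨hψ.1.const_smul c, ?_⟩, (Lp.coeFn_smul _ _).trans (h1.const_smul c), ?_⟩
    · exact hψ.2.smul_left (f := fun _ => c)
    · rw [hψ.gradient_smul]
      exact (Lp.coeFn_smul _ _).trans (h2.const_smul c)

/-- The closure of the pairs `(ψ, ∇ψ)`, `ψ ∈ C_0^∞(ℝ³)`, in `L^{q*}(ℝ³) × L^q(ℝ³; ℝ³)`. -/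
def D1Submodule (q : ℝ) [Fact (1 < q)] [Fact (q < 3)] :
    Submodule ℝ (Lp ℝ (ENNReal.ofReal (sobolevExp q)) (volume : Measure E3) ×
      Lp E3 (ENNReal.ofReal q) (volume : Measure E3)) :=
  (testPairs q).topologicalClosure

/-- The Sobolev inequality `‖φ‖_{q*} ≤ C ‖∇φ‖_q` on the closure. -/
theorem exists_norm_fst_le_norm_snd (q : ℝ) [h1 : Fact (1 < q)] [h3 : Fact (q < 3)] :
    ∃ C : ℝ, ∀ P ∈ D1Submodule q, ‖P.1‖ ≤ C * ‖P.2‖ := by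
  refine ⟨eLpNormLESNormFDerivOfEqInnerConst (volume : Measure E3) q.toNNReal, ?_⟩
  intro P hP
  suffices h : ∀ P ∈ testPairs q, ‖P.1‖ ≤
      eLpNormLESNormFDerivOfEqInnerConst (volume : Measure E3) q.toNNReal * ‖P.2‖ from
    closure_minimal h
      (isClosed_le continuous_fst.norm (continuous_const.mul continuous_snd.norm)) hP
  clear! P
  rintro P ⟨ψ, hψ, e1, e2⟩
  have a := h1.out
  have b := h3.out
  have hs : 1 < sobolevExp q := Fact.out
  have key := eLpNorm_le_eLpNorm_fderiv_of_eq_inner (volume : Measure E3) (F' := ℝ)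
    (u := ψ) (hψ.1.of_le (by simp)) hψ.2 (p := q.toNNReal) (p' := (sobolevExp q).toNNReal)
    (by simpa using a.le) (by simp) (by
      rw [NNReal.coe_inv, Real.coe_toNNReal _ (by linarith), Real.coe_toNNReal _ (by linarith)]
      have : (3 : ℝ) - q ≠ 0 := by linarith
      have : q ≠ 0 := by linarith
      simp only [sobolevExp, finrank_euclideanSpace, Fintype.card_fin]
      push_cast
      field_simp)
  have hg : eLpNorm (fderiv ℝ ψ) (q.toNNReal : ℝ≥0∞) (volume : Measure E3)
      = eLpNorm (gradient ψ) (q.toNNReal : ℝ≥0∞) volume :=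
    eLpNorm_congr_norm_ae (Eventually.of_forall fun x => by simp [gradient])
  rw [hg, ← eLpNorm_congr_ae e1, ← eLpNorm_congr_ae e2] at key
  have := ENNReal.toReal_mono (ENNReal.mul_ne_top ENNReal.coe_ne_top (Lp.eLpNorm_ne_top P.2)) key
  rw [ENNReal.toReal_mul] at this
  rw [Lp.norm_def, Lp.norm_def]
  exact this

/-- The homogeneous Sobolev space `D^{1,q}(ℝ³)`, `1 < q < 3`: the completion of `C_0^∞(ℝ³)` for the
norm `(∫ |∇φ|^q)^(1/q)`.  By the Sobolev inequality a sequence of test functions that is Cauchy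
for this norm converges in `L^{q*}(ℝ³)`, and so the completion is the closure of the pairs
`(ψ, ∇ψ)` in `L^{q*} × L^q`; its norm (given below) is the norm of the gradient alone. -/
def D1 (q : ℝ) [Fact (1 < q)] [Fact (q < 3)] : Type := D1Submodule q

section D1

variable {q : ℝ} [Fact (1 < q)] [Fact (q < 3)]

instance : AddCommGroup (D1 q) := inferInstanceAs (AddCommGroup (D1Submodule q))

instance : Module ℝ (D1 q) := inferInstanceAs (Module ℝ (D1Submodule q))

/-- The inclusion of `D^{1,q}(ℝ³)` in `L^{q*}(ℝ³)` as a linear map. -/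
def D1.fnLM (q : ℝ) [Fact (1 < q)] [Fact (q < 3)] :
    D1 q →ₗ[ℝ] Lp ℝ (ENNReal.ofReal (sobolevExp q)) (volume : Measure E3) :=
  (LinearMap.fst ℝ _ _).comp (D1Submodule q).subtype

/-- The gradient as a linear map from `D^{1,q}(ℝ³)` to `L^q(ℝ³; ℝ³)`. -/
def D1.gradLM (q : ℝ) [Fact (1 < q)] [Fact (q < 3)] :
    D1 q →ₗ[ℝ] Lp E3 (ENNReal.ofReal q) (volume : Measure E3) :=
  (LinearMap.snd ℝ _ _).comp (D1Submodule q).subtype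

theorem D1.gradLM_injective : Function.Injective (D1.gradLM q) := by
  rw [← LinearMap.ker_eq_bot, LinearMap.ker_eq_bot']
  rintro ⟨P, hP⟩ h0
  obtain ⟨C, hC⟩ := exists_norm_fst_le_norm_snd q
  have h2 : P.2 = 0 := h0
  have h1 : ‖P.1‖ ≤ 0 := by simpa [h2] using hC P hP
  exact Subtype.ext (Prod.ext (norm_le_zero_iff.1 h1) h2)

/-- The norm of `D^{1,q}(ℝ³)` is `‖φ‖ = ‖∇φ‖_{L^q}`. -/
instance : NormedAddCommGroup (D1 q) :=
  NormedAddCommGroup.induced (D1 q) _ (D1.gradLM q) D1.gradLM_injective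

instance : NormedSpace ℝ (D1 q) :=
  NormedSpace.induced ℝ (D1 q) _ (D1.gradLM q)

/-- The function in `L^{q*}(ℝ³)` underlying an element of `D^{1,q}(ℝ³)`. -/
def D1.fn (φ : D1 q) : E3 → ℝ := D1.fnLM q φ

/-- The gradient of an element of `D^{1,q}(ℝ³)`, a function in `L^q(ℝ³; ℝ³)`. -/
def D1.grad (φ : D1 q) : E3 → E3 := D1.gradLM q φ

end D1

/-! ### The quasilinear Poisson equation -/

/-- `φ ∈ D^{1,q}(ℝ³)` solves `-Δ_q φ = |u|^s` in the dual of `D^{1,q}(ℝ³)`: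
`∫ |∇φ|^{q-2} ∇φ · ∇v = ∫ |u|^s v` for all `v ∈ D^{1,q}(ℝ³)`. -/
def IsSolution {p q : ℝ} [Fact (1 < p)] [Fact (1 < q)] [Fact (q < 3)] (s : ℝ)
    (u : W1 p) (φ : D1 q) : Prop :=
  ∀ v : D1 q,
    ∫ x, ‖φ.grad x‖ ^ (q - 2) * inner ℝ (φ.grad x) (v.grad x) = ∫ x, |u.fn x| ^ s * v.fn x

/-- The integrand `(1/q) |∇φ|^q - |u|^s φ` of the energy. -/
def energyDensity {p q : ℝ} [Fact (1 < p)] [Fact (1 < q)] [Fact (q < 3)] (s : ℝ)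
    (u : W1 p) (φ : D1 q) (x : E3) : ℝ :=
  1 / q * ‖φ.grad x‖ ^ q - |u.fn x| ^ s * φ.fn x

/-- Weak convergence of a sequence in a real normed space. -/
def WeakConv {X : Type*} [NormedAddCommGroup X] [NormedSpace ℝ X] (a : ℕ → X) (b : X) : Prop :=
  ∀ ℓ : StrongDual ℝ X, Tendsto (fun n => ℓ (a n)) atTop (𝓝 (ℓ b))

end QSP

end

/-! Write m for the exponent dual to q*, and r = s m. The bounds on s say exactly that s > 1 and p <
r < p*. Hence W^{1,p} embeds in L^r, |u|^s lies in L^m = (L^{q*})', and v ↦ ∫ |u|^s v is a bounded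
functional ℓ on D^{1,q}. The solution is the minimizer of the strictly convex energy ‖φ‖^q / q -
ℓ(φ).

All quantitative input comes from one compactness principle, `exists_le_mul_norm_rpow_add`: if two
continuous homogeneous functions have the same degree and the first is nonpositive wherever the
second vanishes, then the first is at most an arbitrarily small multiple of the norm power plus a
multiple of the second. For 1 < q < ∞, without distinguishing q < 2 from q ≥ 2, it bounds ‖a-b‖^q by
a small error plus the convexity defect, or plus the monotonicity expression of a ↦ |a|^{q-2} a. It
also gives the continuity of u ↦ |u|^s and of u ↦ |u|^{s-2} u v from L^r to L^m.

Existence: by the convexity defect almost minimizers are close to each other, so minimizing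
sequences are Cauchy. Uniqueness: the monotonicity inequality. Positivity: a test function may be
replaced by a smoothed absolute value at almost no cost in energy, so nonnegative almost minimizers
converge to the solution. The identities of (ii) follow from uniqueness and a change of variables,
(iii) from testing the equation with its own solution, (v) from monotonicity and the continuity of u
↦ |u|^s.

For (iv), mollification gives local compactness of W^{1,p} in L^r, so |u_n|^s converges in L^m on
balls. The two equations are subtracted and tested with η(φ_n - φ). The only dangerous term is (φ_n
- φ)∇η, and Hölder with 1/q = 1/q* + 1/3 bounds it by ‖∇η‖_3. Since a ball in ℝ³ has zero 3-capacity
(`exists_cutoff_small_gradient`), η can be chosen to make this as small as desired. Thus the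
gradients converge in L^q on every ball. As every functional on D^{1,q} has the form v ↦ ∫
|∇w|^{q-2} ∇w·∇v, and ∇w has small tails, weak convergence follows for the whole sequence, without
subsequences. The second limit in (iv) pairs a strongly convergent factor with a weakly convergent
one. -/

noncomputable section

namespace QSP

/-! ### Pointwise inequalities from homogeneity and compactness -/

section Pointwise

/-- A continuous `r`-homogeneous function that is nonpositive on the zero set of a nonnegative one
`k` is bounded by `ε ‖x‖ ^ r + C k x`. -/
theorem exists_le_mul_norm_rpow_add {X : Type*} [NormedAddCommGroup X] [NormedSpace ℝ X]
    [FiniteDimensional ℝ X] {r : ℝ} {h k : X → ℝ} (hh : Continuous h)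
    (hk : Continuous k) (hhr : ∀ t : ℝ, 0 < t → ∀ x, h (t • x) = t ^ r * h x)
    (hkr : ∀ t : ℝ, 0 < t → ∀ x, k (t • x) = t ^ r * k x) (hk0 : ∀ x, 0 ≤ k x)
    (hz : ∀ x, k x = 0 → h x ≤ 0) (h0 : h 0 ≤ 0) {ε : ℝ} (hε : 0 < ε) :
    ∃ C, 0 ≤ C ∧ ∀ x, h x ≤ ε * ‖x‖ ^ r + C * k x := by
  -- By homogeneity it is enough to argue on the unit sphere, which is compact in finite dimension.
  suffices H : ∃ C, 0 ≤ C ∧ ∀ x, ‖x‖ = 1 → h x ≤ ε + C * k x by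
    obtain ⟨C, hC, H⟩ := H
    refine ⟨C, hC, fun x => ?_⟩
    by_cases hx : x = 0
    · subst hx
      have := hk0 0
      have : 0 ≤ ε * ‖(0 : X)‖ ^ r := by positivity
      nlinarith [mul_nonneg hC (hk0 0)]
    · have hn : 0 < ‖x‖ := norm_pos_iff.2 hx
      have e : x = ‖x‖ • (‖x‖⁻¹ • x) := by rw [smul_smul, mul_inv_cancel₀ hn.ne', one_smul]
      have h1 : ‖(‖x‖⁻¹ • x)‖ = 1 := by
        rw [norm_smul, norm_inv, norm_norm, inv_mul_cancel₀ hn.ne']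
      have h2 := H _ h1
      have h3 := hhr _ hn (‖x‖⁻¹ • x)
      have h4 := hkr _ hn (‖x‖⁻¹ • x)
      rw [← e] at h3 h4
      rw [h3, h4]
      have : 0 < ‖x‖ ^ r := Real.rpow_pos_of_pos hn r
      nlinarith [mul_le_mul_of_nonneg_left h2 this.le]
  have hS : IsCompact (Metric.sphere (0 : X) 1) := by
    have := FiniteDimensional.proper ℝ X
    exact isCompact_sphere 0 1
  -- Outside this compact set the term `ε` suffices. On it `h` is positive, so `k` cannot vanish and
  -- has a positive minimum; the constant is max `h` / min `k`.
  set K : Set X := Metric.sphere (0 : X) 1 ∩ {x | ε ≤ h x}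
  have hK : IsCompact K := hS.inter_right (isClosed_le continuous_const hh)
  rcases K.eq_empty_or_nonempty with hE | hN
  · refine ⟨0, le_rfl, fun x hx => ?_⟩
    by_contra hcon
    have : x ∈ K := ⟨by simpa using hx, by simp at hcon ⊢; linarith⟩
    rw [hE] at this
    exact this
  · obtain ⟨x₀, hx₀, hmin⟩ := hK.exists_isMinOn hN hk.continuousOn
    obtain ⟨x₁, hx₁, hmax⟩ := hK.exists_isMaxOn hN hh.continuousOn
    have hpos : 0 < k x₀ := by
      rcases (hk0 x₀).lt_or_eq with h | h
      · exact h
      · have := hz x₀ h.symm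
        have := hx₀.2
        simp at this
        linarith
    have hM : 0 < h x₁ := lt_of_lt_of_le hε hx₁.2
    refine ⟨h x₁ / k x₀, by positivity, fun x hx => ?_⟩
    by_cases hxK : x ∈ K
    · have a : k x₀ ≤ k x := hmin hxK
      have b : h x ≤ h x₁ := hmax hxK
      have : h x₁ ≤ h x₁ / k x₀ * k x := by
        rw [div_mul_eq_mul_div, le_div_iff₀ hpos]
        exact mul_le_mul_of_nonneg_left a hM.le
      linarith
    · have : h x < ε := by
        by_contra hcon
        exact hxK ⟨by simpa using hx, by simpa using hcon⟩
      have : 0 ≤ h x₁ / k x₀ * k x := mul_nonneg (by positivity) (hk0 x)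
      linarith

/-- The map `a ↦ ‖a‖ ^ (q - 2) a`. -/
def duality {E : Type*} [NormedAddCommGroup E] [NormedSpace ℝ E] (q : ℝ) (a : E) : E :=
  ‖a‖ ^ (q - 2) • a

theorem norm_duality {E : Type*} [NormedAddCommGroup E] [NormedSpace ℝ E] {q : ℝ} (hq : 1 < q)
    (a : E) : ‖duality q a‖ = ‖a‖ ^ (q - 1) := by
  rw [duality, norm_smul, Real.norm_of_nonneg (by positivity)]
  by_cases ha : a = 0
  · simp [ha, Real.zero_rpow (by linarith : q - 1 ≠ 0)]
  · have := norm_pos_iff.2 ha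
    rw [← Real.rpow_add_one this.ne']
    ring_nf

theorem duality_smul {E : Type*} [NormedAddCommGroup E] [NormedSpace ℝ E] {q : ℝ}
    {t : ℝ} (ht : 0 < t) (a : E) : duality q (t • a) = t ^ (q - 1) • duality q a := by
  rw [duality, duality, norm_smul, Real.norm_of_nonneg ht.le,
    Real.mul_rpow ht.le (norm_nonneg a), smul_smul, smul_smul]
  congr 1
  rw [show q - 1 = q - 2 + 1 by ring, Real.rpow_add_one ht.ne']
  ring

theorem continuous_duality {E : Type*} [NormedAddCommGroup E] [NormedSpace ℝ E] {q : ℝ}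
    (hq : 1 < q) : Continuous (duality q : E → E) := by
  rw [continuous_iff_continuousAt]
  intro a
  by_cases ha : a = 0
  · subst ha
    have h0 : duality q (0 : E) = 0 := by simp [duality]
    rw [ContinuousAt, h0, tendsto_zero_iff_norm_tendsto_zero]
    simp_rw [norm_duality hq]
    have : Tendsto (fun x : E => ‖x‖ ^ (q - 1)) (𝓝 0) (𝓝 (‖(0 : E)‖ ^ (q - 1))) :=
      (continuous_norm.rpow_const (fun _ => Or.inr (by linarith))).tendsto 0
    simpa [Real.zero_rpow (by linarith : q - 1 ≠ 0)] using this
  · exact (continuousAt_id.norm.rpow_const (Or.inl (norm_ne_zero_iff.2 ha))).smul continuousAt_id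

theorem inner_duality_self {E : Type*} [NormedAddCommGroup E] [InnerProductSpace ℝ E] {q : ℝ}
    (hq : 1 < q) (a : E) : inner ℝ (duality q a) a = ‖a‖ ^ q := by
  rw [duality, real_inner_smul_left, real_inner_self_eq_norm_sq]
  by_cases ha : a = 0
  · simp [ha, Real.zero_rpow (by linarith : q ≠ 0)]
  · have := norm_pos_iff.2 ha
    rw [← Real.rpow_natCast, ← Real.rpow_add this]
    norm_num

/-- Cauchy–Schwarz followed by Young's inequality with exponents q/(q-1) and q. -/
theorem inner_duality_le {E : Type*} [NormedAddCommGroup E] [InnerProductSpace ℝ E] {q : ℝ}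
    (hq : 1 < q) (a b : E) : inner ℝ (duality q a) b ≤ (1 - 1 / q) * ‖a‖ ^ q + 1 / q * ‖b‖ ^ q := by
  refine (real_inner_le_norm _ _).trans ?_
  rw [norm_duality hq]
  have hc : (q / (q - 1)).HolderConjugate q := (Real.HolderConjugate.conjExponent hq).symm
  have := Real.young_inequality_of_nonneg (a := ‖a‖ ^ (q - 1)) (b := ‖b‖) (by positivity)
    (norm_nonneg b) hc
  rw [← Real.rpow_mul (norm_nonneg a)] at this
  have e : (q - 1) * (q / (q - 1)) = q := by
    have : q - 1 ≠ 0 := by linarith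
    field_simp
  rw [e] at this
  have h1 : q ≠ 0 := by linarith
  have h2 : q - 1 ≠ 0 := by linarith
  calc _ ≤ _ := this
    _ = _ := by field_simp

/-- The first-order convexity inequality for `‖·‖ ^ q`. -/
theorem norm_rpow_add_le {E : Type*} [NormedAddCommGroup E] [InnerProductSpace ℝ E] {q : ℝ}
    (hq : 1 < q) (a b : E) : ‖a‖ ^ q + q * inner ℝ (duality q a) (b - a) ≤ ‖b‖ ^ q := by
  have h := inner_duality_le hq a b
  rw [inner_sub_right, inner_duality_self hq]
  have hq0 : 0 < q := by linarith
  have h3 := mul_le_mul_of_nonneg_left h hq0.le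
  have e : q * ((1 - 1 / q) * ‖a‖ ^ q + 1 / q * ‖b‖ ^ q) = q * ‖a‖ ^ q - ‖a‖ ^ q + ‖b‖ ^ q := by
    field_simp
  rw [e] at h3
  linarith

theorem inner_duality_sub_nonneg {E : Type*} [NormedAddCommGroup E] [InnerProductSpace ℝ E]
    {q : ℝ} (hq : 1 < q) (a b : E) :
    0 ≤ inner ℝ (duality q a - duality q b) (a - b) := by
  have h1 := norm_rpow_add_le hq a b
  have h2 := norm_rpow_add_le hq b a
  rw [← neg_sub a b, inner_neg_right] at h1
  rw [inner_sub_left]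
  have : 0 < q := by linarith
  by_contra hc
  push Not at hc
  nlinarith

theorem norm_half_add_rpow_le {E : Type*} [NormedAddCommGroup E] [InnerProductSpace ℝ E] {q : ℝ}
    (hq : 1 < q) (a b : E) :
    ‖(1 / 2 : ℝ) • (a + b)‖ ^ q ≤ 1 / 2 * ‖a‖ ^ q + 1 / 2 * ‖b‖ ^ q := by
  have h1 := norm_rpow_add_le hq ((1 / 2 : ℝ) • (a + b)) a
  have h2 := norm_rpow_add_le hq ((1 / 2 : ℝ) • (a + b)) b
  have e : b - (1 / 2 : ℝ) • (a + b) = -(a - (1 / 2 : ℝ) • (a + b)) := by module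
  rw [e, inner_neg_right] at h2
  linarith

/-- Strict convexity enters twice: that of t ↦ t^q forces equal norms, and then that of the
Euclidean ball forces equal vectors. -/
theorem eq_of_norm_half_add_rpow {E : Type*} [NormedAddCommGroup E] [InnerProductSpace ℝ E]
    {q : ℝ} (hq : 1 < q) {a b : E}
    (h : 1 / 2 * ‖a‖ ^ q + 1 / 2 * ‖b‖ ^ q ≤ ‖(1 / 2 : ℝ) • (a + b)‖ ^ q) : a = b := by
  have hle : ‖(1 / 2 : ℝ) • (a + b)‖ ≤ 1 / 2 * ‖a‖ + 1 / 2 * ‖b‖ := by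
    rw [norm_smul, Real.norm_of_nonneg (by norm_num)]
    have := norm_add_le a b
    linarith
  have hmono : ‖(1 / 2 : ℝ) • (a + b)‖ ^ q ≤ (1 / 2 * ‖a‖ + 1 / 2 * ‖b‖) ^ q :=
    Real.rpow_le_rpow (norm_nonneg _) hle (by linarith)
  have hab : ‖a‖ = ‖b‖ := by
    by_contra hne
    have := (strictConvexOn_rpow hq).2 (Set.mem_Ici.2 (norm_nonneg a))
      (Set.mem_Ici.2 (norm_nonneg b)) hne (show (0 : ℝ) < 1 / 2 by norm_num)
      (show (0 : ℝ) < 1 / 2 by norm_num) (by norm_num)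
    simp only [smul_eq_mul] at this
    linarith
  by_contra hne
  have := norm_combo_lt_of_ne (le_refl ‖a‖) hab.ge hne (a := 1 / 2) (b := 1 / 2)
    (by norm_num) (by norm_num) (by norm_num)
  rw [← smul_add] at this
  have := Real.rpow_lt_rpow (norm_nonneg _) this (show 0 < q by linarith)
  rw [← hab] at h
  linarith

theorem max_rpow_le {a b r : ℝ} (ha : 0 ≤ a) (hb : 0 ≤ b) : (max a b) ^ r ≤ a ^ r + b ^ r := by
  have := Real.rpow_nonneg ha r
  have := Real.rpow_nonneg hb r
  rcases max_cases a b with h | h <;> rw [h.1] <;> linarith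

theorem min_mul_rpow {a b r t : ℝ} (ha : 0 ≤ a) (hb : 0 ≤ b) (ht : 0 < t) :
    (min (t * a) (t * b)) ^ r = t ^ r * (min a b) ^ r := by
  rw [← mul_min_of_nonneg _ _ ht.le, Real.mul_rpow ht.le (le_min ha hb)]

variable {E : Type*} [NormedAddCommGroup E] [InnerProductSpace ℝ E] [FiniteDimensional ℝ E]

/-- The midpoint defect is homogeneous of degree q and vanishes only on the diagonal, where `a - b`
vanishes too. This takes the place of Clarkson's inequalities and is uniform in the range of q. -/
theorem exists_norm_sub_rpow_le_excess {q : ℝ} (hq : 1 < q) {ε : ℝ} (hε : 0 < ε) :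
    ∃ C, 0 ≤ C ∧ ∀ a b : E, ‖a - b‖ ^ q ≤ ε * (‖a‖ ^ q + ‖b‖ ^ q) +
      C * (1 / 2 * ‖a‖ ^ q + 1 / 2 * ‖b‖ ^ q - ‖(1 / 2 : ℝ) • (a + b)‖ ^ q) := by
  have hq0 : 0 ≤ q := by linarith
  obtain ⟨C, hC, h⟩ := exists_le_mul_norm_rpow_add (X := E × E) (r := q)
    (h := fun x => ‖x.1 - x.2‖ ^ q)
    (k := fun x => 1 / 2 * ‖x.1‖ ^ q + 1 / 2 * ‖x.2‖ ^ q - ‖(1 / 2 : ℝ) • (x.1 + x.2)‖ ^ q)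
    (by fun_prop (disch := exact fun _ => Or.inr hq0))
    (by fun_prop (disch := exact fun _ => Or.inr hq0))
    (by
      intro t ht x
      simp only [Prod.smul_fst, Prod.smul_snd, ← smul_sub, norm_smul, Real.norm_of_nonneg ht.le]
      rw [Real.mul_rpow ht.le (norm_nonneg _)])
    (by
      intro t ht x
      simp only [Prod.smul_fst, Prod.smul_snd, ← smul_add]
      rw [smul_comm (1 / 2 : ℝ) t, norm_smul t, norm_smul t, norm_smul t,
        Real.norm_of_nonneg ht.le]
      simp only [Real.mul_rpow ht.le (norm_nonneg _)]
      ring)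
    (fun x => by
      have := norm_half_add_rpow_le hq x.1 x.2
      linarith)
    (fun x hx => by
      have := eq_of_norm_half_add_rpow hq (a := x.1) (b := x.2) (by linarith)
      simp [this, Real.zero_rpow (by linarith : q ≠ 0)])
    (by simp [Real.zero_rpow (by linarith : q ≠ 0)]) hε
  refine ⟨C, hC, fun a b => (h (a, b)).trans ?_⟩
  have := max_rpow_le (r := q) (norm_nonneg a) (norm_nonneg b)
  have := mul_le_mul_of_nonneg_left this hε.le
  simp only [Prod.norm_def]
  linarith

/-- Adding the first-order convexity inequalities from `a` and from `b` to the midpoint bounds the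
midpoint defect by q/4 times the monotonicity expression. -/
theorem exists_norm_sub_rpow_le_inner {q : ℝ} (hq : 1 < q) {ε : ℝ} (hε : 0 < ε) :
    ∃ C, 0 ≤ C ∧ ∀ a b : E, ‖a - b‖ ^ q ≤ ε * (‖a‖ ^ q + ‖b‖ ^ q) +
      C * inner ℝ (duality q a - duality q b) (a - b) := by
  obtain ⟨C, hC, h⟩ := exists_norm_sub_rpow_le_excess (E := E) hq hε
  refine ⟨C * (q / 4), by positivity, fun a b => (h a b).trans ?_⟩
  have h1 := norm_rpow_add_le hq a ((1 / 2 : ℝ) • (a + b))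
  have h2 := norm_rpow_add_le hq b ((1 / 2 : ℝ) • (a + b))
  have e1 : (1 / 2 : ℝ) • (a + b) - a = -((1 / 2 : ℝ) • (a - b)) := by module
  have e2 : (1 / 2 : ℝ) • (a + b) - b = (1 / 2 : ℝ) • (a - b) := by module
  rw [e1, inner_neg_right, inner_smul_right] at h1
  rw [e2, inner_smul_right] at h2
  rw [inner_sub_left, mul_assoc]
  have : 1 / 2 * ‖a‖ ^ q + 1 / 2 * ‖b‖ ^ q - ‖(1 / 2 : ℝ) • (a + b)‖ ^ q ≤
    q / 4 * (inner ℝ (duality q a) (a - b) - inner ℝ (duality q b) (a - b)) := by linarith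
  gcongr

/-- Unlike in Young's inequality, the term with the large constant is small as soon as either factor
is small. In the applications one factor is small on a ball and the other outside it. -/
theorem exists_rpow_mul_le_min {q : ℝ} (hq : 1 < q) {ε : ℝ} (hε : 0 < ε) :
    ∃ C, 0 ≤ C ∧ ∀ a b : ℝ, 0 ≤ a → 0 ≤ b → a ^ (q - 1) * b ≤ ε * (a ^ q + b ^ q) +
      C * (min a b) ^ q := by
  have hq0 : 0 ≤ q := by linarith
  have hq1 : 0 ≤ q - 1 := by linarith
  obtain ⟨C, hC, h⟩ := exists_le_mul_norm_rpow_add (X := ℝ × ℝ) (r := q)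
    (h := fun x => |x.1| ^ (q - 1) * |x.2|)
    (k := fun x => (min |x.1| |x.2|) ^ q)
    (by fun_prop (disch := exact fun _ => Or.inr hq1))
    (by fun_prop (disch := exact fun _ => Or.inr hq0))
    (by
      intro t ht x
      simp only [Prod.smul_fst, Prod.smul_snd, smul_eq_mul, abs_mul, abs_of_pos ht]
      rw [Real.mul_rpow ht.le (abs_nonneg _)]
      have : t ^ q = t ^ (q - 1) * t := by
        rw [← Real.rpow_add_one ht.ne']
        ring_nf
      rw [this]
      ring)
    (by
      intro t ht x
      simp only [Prod.smul_fst, Prod.smul_snd, smul_eq_mul, abs_mul, abs_of_pos ht]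
      exact min_mul_rpow (abs_nonneg _) (abs_nonneg _) ht)
    (fun x => by positivity)
    (fun x hx => by
      rw [Real.rpow_eq_zero (by positivity) (by linarith)] at hx
      rcases min_choice |x.1| |x.2| with h | h <;> rw [h] at hx <;> simp [hx]
      simp [Real.zero_rpow (by linarith : q - 1 ≠ 0)])
    (by simp) hε
  refine ⟨C, hC, fun a b ha hb => ?_⟩
  have h1 := h (a, b)
  simp only [abs_of_nonneg ha, abs_of_nonneg hb, Prod.norm_def, Real.norm_eq_abs] at h1
  have := mul_le_mul_of_nonneg_left (max_rpow_le (r := q) ha hb) hε.le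
  linarith

/-- The pointwise form of the continuity of u ↦ |u|^s from L^{sm} to L^m. -/
theorem exists_abs_rpow_sub_le {s m : ℝ} (hs : 0 < s) (hm : 0 < m) {ε : ℝ} (hε : 0 < ε) :
    ∃ C, 0 ≤ C ∧ ∀ a b : ℝ, |(|a| ^ s - |b| ^ s)| ^ m ≤
      ε * (|a| ^ (s * m) + |b| ^ (s * m)) + C * |a - b| ^ (s * m) := by
  have hsm : 0 < s * m := by positivity
  obtain ⟨C, hC, h⟩ := exists_le_mul_norm_rpow_add (X := ℝ × ℝ) (r := s * m)
    (h := fun x => |(|x.1| ^ s - |x.2| ^ s)| ^ m)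
    (k := fun x => |x.1 - x.2| ^ (s * m))
    ((((continuous_fst.abs.rpow_const fun _ => Or.inr hs.le).sub
      (continuous_snd.abs.rpow_const fun _ => Or.inr hs.le)).abs).rpow_const
        fun _ => Or.inr hm.le)
    ((continuous_fst.sub continuous_snd).abs.rpow_const fun _ => Or.inr hsm.le)
    (by
      intro t ht x
      simp only [Prod.smul_fst, Prod.smul_snd, smul_eq_mul, abs_mul, abs_of_pos ht]
      rw [Real.mul_rpow ht.le (abs_nonneg _), Real.mul_rpow ht.le (abs_nonneg _), ← mul_sub,
        abs_mul, Real.mul_rpow (by positivity) (by positivity), abs_of_nonneg (by positivity),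
        Real.rpow_mul ht.le])
    (by
      intro t ht x
      simp only [Prod.smul_fst, Prod.smul_snd, smul_eq_mul, ← mul_sub, abs_mul, abs_of_pos ht]
      rw [Real.mul_rpow ht.le (abs_nonneg _)])
    (fun x => by positivity)
    (fun x hx => by
      rw [Real.rpow_eq_zero (by positivity) (by linarith), abs_eq_zero, sub_eq_zero] at hx
      simp [hx, Real.zero_rpow hm.ne'])
    (by simp [Real.zero_rpow hm.ne']) hε
  refine ⟨C, hC, fun a b => ?_⟩
  have h1 := h (a, b)
  simp only [Prod.norm_def, Real.norm_eq_abs] at h1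
  have := mul_le_mul_of_nonneg_left (max_rpow_le (r := s * m) (abs_nonneg a) (abs_nonneg b)) hε.le
  linarith

/-- The left side vanishes when `a = b` and when `c = 0`, hence on the zero set of the minimum.
Again only one of the two has to be small at a given point. -/
theorem exists_abs_duality_sub_mul_le {s m : ℝ} (hs : 1 < s) (hm : 0 < m) {ε : ℝ} (hε : 0 < ε) :
    ∃ C, 0 ≤ C ∧ ∀ a b c : ℝ, |(duality s a - duality s b) * c| ^ m ≤
      ε * (|a| ^ (s * m) + |b| ^ (s * m) + |c| ^ (s * m)) + C * (min |a - b| |c|) ^ (s * m) := by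
  have hsm : 0 < s * m := by positivity
  obtain ⟨C, hC, h⟩ := exists_le_mul_norm_rpow_add (X := ℝ × ℝ × ℝ) (r := s * m)
    (h := fun x => |(duality s x.1 - duality s x.2.1) * x.2.2| ^ m)
    (k := fun x => (min |x.1 - x.2.1| |x.2.2|) ^ (s * m))
    ((((((continuous_duality hs).comp continuous_fst).sub
      ((continuous_duality hs).comp continuous_snd.fst)).mul continuous_snd.snd).abs).rpow_const
        fun _ => Or.inr hm.le)
    (((continuous_fst.sub continuous_snd.fst).abs.min continuous_snd.snd.abs).rpow_const
      fun _ => Or.inr hsm.le)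
    (by
      intro t ht x
      simp only [Prod.smul_fst, Prod.smul_snd]
      rw [duality_smul ht, duality_smul ht, ← smul_sub, smul_mul_smul_comm,
        ← Real.rpow_add_one ht.ne', smul_eq_mul, abs_mul,
        Real.mul_rpow (by positivity) (by positivity), abs_of_nonneg (by positivity),
        sub_add_cancel, Real.rpow_mul ht.le])
    (by
      intro t ht x
      simp only [Prod.smul_fst, Prod.smul_snd, smul_eq_mul, ← mul_sub, abs_mul, abs_of_pos ht]
      exact min_mul_rpow (abs_nonneg _) (abs_nonneg _) ht)
    (fun x => by positivity)
    (fun x hx => by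
      rw [Real.rpow_eq_zero (by positivity) (by linarith)] at hx
      rcases min_choice |x.1 - x.2.1| |x.2.2| with h | h
      · rw [h, abs_eq_zero, sub_eq_zero] at hx
        simp [hx, Real.zero_rpow hm.ne']
      · rw [h, abs_eq_zero] at hx
        simp [hx, Real.zero_rpow hm.ne'])
    (by simp [Real.zero_rpow hm.ne']) hε
  refine ⟨C, hC, fun a b c => ?_⟩
  have h1 := h (a, b, c)
  simp only [Prod.norm_def, Real.norm_eq_abs] at h1
  have h2 := max_rpow_le (r := s * m) (abs_nonneg a)
    (le_max_of_le_left (abs_nonneg b) : 0 ≤ max |b| |c|)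
  have h3 := max_rpow_le (r := s * m) (abs_nonneg b) (abs_nonneg c)
  have := mul_le_mul_of_nonneg_left (h2.trans (add_le_add_right h3 _)) hε.le
  linarith

theorem exists_rpow_le_add {p r P : ℝ} (hp : 0 < p) (hpr : p < r) (hrP : r < P) {ε : ℝ}
    (hε : 0 < ε) :
    ∃ C, 0 ≤ C ∧ ∀ d : ℝ, 0 ≤ d → d ^ r ≤ ε * d ^ P + C * d ^ p := by
  have hPr : 0 < P - r := by linarith
  -- The threshold at which d^r = ε d^P: below it the lower power dominates, above it the higher
  -- one.
  set K : ℝ := (1 / ε) ^ (1 / (P - r)) with hK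
  have hK0 : 0 < K := by positivity
  refine ⟨K ^ (r - p), by positivity, fun d hd => ?_⟩
  rcases hd.eq_or_lt with rfl | hd
  · rw [Real.zero_rpow (by linarith), Real.zero_rpow (by linarith), Real.zero_rpow hp.ne']
    simp
  rcases le_total d K with h | h
  · have e : d ^ r = d ^ (r - p) * d ^ p := by rw [← Real.rpow_add hd]; ring_nf
    have h1 : d ^ (r - p) ≤ K ^ (r - p) := Real.rpow_le_rpow hd.le h (by linarith)
    rw [e]
    have := mul_le_mul_of_nonneg_right h1 (Real.rpow_nonneg hd.le p)
    have : 0 ≤ ε * d ^ P := by positivity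
    linarith
  · have e : d ^ P = d ^ (P - r) * d ^ r := by rw [← Real.rpow_add hd]; ring_nf
    have h1 : K ^ (P - r) ≤ d ^ (P - r) := Real.rpow_le_rpow hK0.le h hPr.le
    have h2 : K ^ (P - r) = 1 / ε := by
      rw [hK, ← Real.rpow_mul (by positivity), one_div_mul_cancel hPr.ne', Real.rpow_one]
    rw [h2, div_le_iff₀ hε] at h1
    have h3 : 0 < d ^ r := by positivity
    have : 0 ≤ K ^ (r - p) * d ^ p := by positivity
    rw [e]
    nlinarith

end Pointwise

/-! ### Integrals, Hölder pairings and limits -/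

section IntegralTools

variable {α : Type*} [MeasurableSpace α] {μ : Measure α}
variable {F G : Type*} [NormedAddCommGroup F] [NormedAddCommGroup G]

theorem memLp_ofReal_iff {a : ℝ} (ha : 0 < a) {f : α → F} (hf : AEStronglyMeasurable f μ) :
    MemLp f (ENNReal.ofReal a) μ ↔ Integrable (fun x => ‖f x‖ ^ a) μ := by
  have h := integrable_norm_rpow_iff hf (p := ENNReal.ofReal a) (by simpa using ha) (by simp)
  rw [ENNReal.toReal_ofReal ha.le] at h
  exact h.symm

theorem _root_.MeasureTheory.MemLp.integrable_rpow {a : ℝ} {f : α → F}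
    (hf : MemLp f (ENNReal.ofReal a) μ) (ha : 0 < a) : Integrable (fun x => ‖f x‖ ^ a) μ :=
  (memLp_ofReal_iff ha hf.1).1 hf

theorem eLpNorm_ofReal_eq {a : ℝ} {f : α → F} (hf : MemLp f (ENNReal.ofReal a) μ) (ha : 0 < a) :
    eLpNorm f (ENNReal.ofReal a) μ = ENNReal.ofReal ((∫ x, ‖f x‖ ^ a ∂μ) ^ (1 / a)) := by
  rw [hf.eLpNorm_eq_integral_rpow_norm (by simpa using ha) (by simp),
    ENNReal.toReal_ofReal ha.le, one_div]

theorem integral_rpow_nonneg (f : α → F) (a : ℝ) : 0 ≤ ∫ x, ‖f x‖ ^ a ∂μ :=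
  integral_nonneg fun _ => by positivity

theorem Lp_norm_eq {a : ℝ} (ha : 0 < a) (f : Lp F (ENNReal.ofReal a) μ) :
    ‖f‖ = (∫ x, ‖f x‖ ^ a ∂μ) ^ (1 / a) := by
  have h0 := integral_rpow_nonneg (μ := μ) f a
  rw [Lp.norm_def, eLpNorm_ofReal_eq (Lp.memLp f) ha, ENNReal.toReal_ofReal (by positivity)]

theorem Lp_norm_rpow {a : ℝ} (ha : 0 < a) (f : Lp F (ENNReal.ofReal a) μ) :
    ‖f‖ ^ a = ∫ x, ‖f x‖ ^ a ∂μ := by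
  rw [Lp_norm_eq ha, ← Real.rpow_mul (integral_rpow_nonneg _ _), one_div_mul_cancel ha.ne',
    Real.rpow_one]

theorem integral_rpow_le_of_eLpNorm_le {a K : ℝ} (ha : 0 < a) (hK : 0 ≤ K) {f : α → F}
    (hf : AEStronglyMeasurable f μ) (h : eLpNorm f (ENNReal.ofReal a) μ ≤ ENNReal.ofReal K) :
    MemLp f (ENNReal.ofReal a) μ ∧ ∫ x, ‖f x‖ ^ a ∂μ ≤ K ^ a := by
  have hm : MemLp f (ENNReal.ofReal a) μ := ⟨hf, h.trans_lt ENNReal.ofReal_lt_top⟩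
  refine ⟨hm, ?_⟩
  rw [eLpNorm_ofReal_eq hm ha, ENNReal.ofReal_le_ofReal_iff hK] at h
  have h0 := integral_rpow_nonneg (μ := μ) f a
  have := Real.rpow_le_rpow (by positivity) h ha.le
  rwa [← Real.rpow_mul h0, one_div_mul_cancel ha.ne', Real.rpow_one] at this

theorem eLpNorm_le_of_integral_rpow_le {a K : ℝ} (ha : 0 < a) (hK : 0 ≤ K) {f : α → F}
    (hf : MemLp f (ENNReal.ofReal a) μ) (h : ∫ x, ‖f x‖ ^ a ∂μ ≤ K ^ a) :
    eLpNorm f (ENNReal.ofReal a) μ ≤ ENNReal.ofReal K := by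
  rw [eLpNorm_ofReal_eq hf ha]
  apply ENNReal.ofReal_le_ofReal
  have := Real.rpow_le_rpow (integral_rpow_nonneg _ _) h (by positivity : 0 ≤ 1 / a)
  rwa [← Real.rpow_mul hK, mul_one_div_cancel ha.ne', Real.rpow_one] at this

theorem integrable_norm_mul_norm {a b : ℝ} (hab : a.HolderConjugate b) {f : α → F} {g : α → G}
    (hf : MemLp f (ENNReal.ofReal a) μ) (hg : MemLp g (ENNReal.ofReal b) μ) :
    Integrable (fun x => ‖f x‖ * ‖g x‖) μ := by
  have := hab.ennrealOfReal
  exact hf.norm.integrable_mul hg.norm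

theorem integrable_mul_of_memLp {a b : ℝ} (hab : a.HolderConjugate b) {f g : α → ℝ}
    (hf : MemLp f (ENNReal.ofReal a) μ) (hg : MemLp g (ENNReal.ofReal b) μ) :
    Integrable (fun x => f x * g x) μ := by
  have := hab.ennrealOfReal
  exact hf.integrable_mul hg

theorem integrable_inner_of_memLp [InnerProductSpace ℝ F] {a b : ℝ} (hab : a.HolderConjugate b)
    {f g : α → F} (hf : MemLp f (ENNReal.ofReal a) μ) (hg : MemLp g (ENNReal.ofReal b) μ) :
    Integrable (fun x => inner ℝ (f x) (g x)) μ :=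
  (integrable_norm_mul_norm hab hf hg).mono' (hf.1.inner hg.1)
    (Eventually.of_forall fun _ => norm_inner_le_norm _ _)

theorem abs_integral_mul_le {a b : ℝ} (hab : a.HolderConjugate b) {f g : α → ℝ}
    (hf : MemLp f (ENNReal.ofReal a) μ) (hg : MemLp g (ENNReal.ofReal b) μ) :
    |∫ x, f x * g x ∂μ| ≤ (∫ x, ‖f x‖ ^ a ∂μ) ^ (1 / a) * (∫ x, ‖g x‖ ^ b ∂μ) ^ (1 / b) := by
  refine (abs_integral_le_integral_abs).trans (le_trans (le_of_eq ?_)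
    (integral_mul_norm_le_Lp_mul_Lq hab hf hg))
  simp [abs_mul]

theorem abs_integral_inner_le [InnerProductSpace ℝ F] {a b : ℝ} (hab : a.HolderConjugate b)
    {f g : α → F} (hf : MemLp f (ENNReal.ofReal a) μ) (hg : MemLp g (ENNReal.ofReal b) μ) :
    |∫ x, inner ℝ (f x) (g x) ∂μ| ≤
      (∫ x, ‖f x‖ ^ a ∂μ) ^ (1 / a) * (∫ x, ‖g x‖ ^ b ∂μ) ^ (1 / b) := by
  refine (abs_integral_le_integral_abs).trans (le_trans ?_
    (integral_mul_norm_le_Lp_mul_Lq hab hf hg))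
  exact integral_mono_of_nonneg (Eventually.of_forall fun _ => abs_nonneg _)
    (integrable_norm_mul_norm hab hf hg) (Eventually.of_forall fun _ => abs_real_inner_le_norm _ _)

/-- The form in which the pointwise inequalities yield limits: the small multiple contributes `ε`,
the large constant multiplies a null sequence. -/
theorem tendsto_zero_of_le_add {a : ℕ → ℝ} (h0 : ∀ n, 0 ≤ a n)
    (h : ∀ ε : ℝ, 0 < ε → ∃ b : ℕ → ℝ, Tendsto b atTop (𝓝 0) ∧ ∀ n, a n ≤ ε + b n) :
    Tendsto a atTop (𝓝 0) := by
  rw [Metric.tendsto_atTop]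
  intro ε hε
  obtain ⟨b, hb, hab⟩ := h (ε / 2) (by positivity)
  obtain ⟨N, hN⟩ := (Metric.tendsto_atTop.1 hb) (ε / 2) (by positivity)
  refine ⟨N, fun n hn => ?_⟩
  have h1 := hN n hn
  rw [Real.dist_eq, sub_zero] at h1 ⊢
  rw [abs_of_nonneg (h0 n)]
  have := hab n
  have := le_abs_self (b n)
  linarith

/-- The tails of a convergent integral are small. -/
theorem exists_setIntegral_compl_ball_le {h : E3 → ℝ} (hh : Integrable h) {ε : ℝ} (hε : 0 < ε) :
    ∃ R : ℝ, 1 ≤ R ∧ ∫ x in (Metric.ball (0 : E3) R)ᶜ, h x ≤ ε := by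
  have hcov : AECover (volume : Measure E3) atTop (fun n : ℕ => Metric.ball (0 : E3) n) :=
    aecover_ball tendsto_natCast_atTop_atTop
  have ht := hcov.integral_tendsto_of_countably_generated hh
  obtain ⟨n, hn, hn1⟩ := (((Metric.tendsto_nhds.1 ht) ε hε).and (eventually_ge_atTop 1)).exists
  refine ⟨n, by exact_mod_cast hn1, ?_⟩
  have := integral_add_compl (Metric.isOpen_ball (x := (0 : E3)) (ε := n)).measurableSet hh
  rw [Real.dist_eq] at hn
  have := (abs_lt.1 hn).1
  linarith

/-- Minkowski's integral inequality for a probability measure. -/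
theorem eLpNorm_integral_le {X Y : Type*} [MeasurableSpace X] [MeasurableSpace Y]
    {ν : Measure X} [SFinite ν] {κ : Measure Y} [IsProbabilityMeasure κ] [NormedSpace ℝ F]
    {p : ℝ≥0∞} (hp1 : 1 ≤ p) (hp : p ≠ ⊤) {f : X → Y → F}
    (hf : StronglyMeasurable (Function.uncurry f)) {K : ℝ≥0∞}
    (h : ∀ᵐ y ∂κ, eLpNorm (fun x => f x y) p ν ≤ K) :
    eLpNorm (fun x => ∫ y, f x y ∂κ) p ν ≤ K := by
  have hp0 : p ≠ 0 := (zero_lt_one.trans_le hp1).ne'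
  have hpr : 0 < p.toReal := ENNReal.toReal_pos hp0 hp
  have hsec (x : X) : StronglyMeasurable (f x) := hf.comp_measurable measurable_prodMk_left
  -- Jensen's inequality, through the inclusion of L^p in L^1 for a probability measure; Tonelli
  -- then exchanges the integrals.
  have h1 (x : X) : ‖∫ y, f x y ∂κ‖ₑ ^ p.toReal ≤ ∫⁻ y, ‖f x y‖ₑ ^ p.toReal ∂κ := by
    have a1 : ‖∫ y, f x y ∂κ‖ₑ ≤ eLpNorm (f x) p κ := by
      refine (enorm_integral_le_lintegral_enorm _).trans ?_
      rw [← eLpNorm_one_eq_lintegral_enorm]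
      exact eLpNorm_le_eLpNorm_of_exponent_le hp1 (hsec x).aestronglyMeasurable
    refine (ENNReal.rpow_le_rpow a1 hpr.le).trans (le_of_eq ?_)
    rw [eLpNorm_eq_lintegral_rpow_enorm_toReal hp0 hp, ← ENNReal.rpow_mul,
      one_div_mul_cancel hpr.ne', ENNReal.rpow_one]
  rw [eLpNorm_eq_lintegral_rpow_enorm_toReal hp0 hp]
  have h2 : ∫⁻ x, ‖∫ y, f x y ∂κ‖ₑ ^ p.toReal ∂ν ≤ K ^ p.toReal := by
    calc _ ≤ ∫⁻ x, ∫⁻ y, ‖f x y‖ₑ ^ p.toReal ∂κ ∂ν := lintegral_mono h1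
      _ = ∫⁻ y, ∫⁻ x, ‖f x y‖ₑ ^ p.toReal ∂ν ∂κ :=
        lintegral_lintegral_swap ((hf.enorm.pow_const _).aemeasurable)
      _ ≤ ∫⁻ _, K ^ p.toReal ∂κ := by
        apply lintegral_mono_ae
        filter_upwards [h] with y hy
        rw [eLpNorm_eq_lintegral_rpow_enorm_toReal hp0 hp] at hy
        have := ENNReal.rpow_le_rpow hy hpr.le
        rwa [← ENNReal.rpow_mul, one_div_mul_cancel hpr.ne', ENNReal.rpow_one] at this
      _ = K ^ p.toReal := by simp
  refine (ENNReal.rpow_le_rpow h2 (by positivity)).trans (le_of_eq ?_)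
  rw [← ENNReal.rpow_mul, mul_one_div_cancel hpr.ne', ENNReal.rpow_one]

/-- Fatou's lemma. It passes norm bounds to almost everywhere limits, so approximations need bounded
norms only. -/
theorem eLpNorm_le_of_tendsto_ae {p : ℝ≥0∞} {f : ℕ → α → F} {g : α → F} {K : ℝ≥0∞}
    (hf : ∀ n, AEStronglyMeasurable (f n) μ) (h : ∀ n, eLpNorm (f n) p μ ≤ K)
    (hlim : ∀ᵐ x ∂μ, Tendsto (fun n => f n x) atTop (𝓝 (g x))) : eLpNorm g p μ ≤ K :=
  (Lp.eLpNorm_lim_le_liminf_eLpNorm hf g hlim).trans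
    ((liminf_le_liminf (Eventually.of_forall h)).trans (by simp))

end IntegralTools

/-! ### Gradients, test functions and cutoffs -/

section Gradient

theorem gradient_mul {f g : E3 → ℝ} {x : E3} (hf : DifferentiableAt ℝ f x)
    (hg : DifferentiableAt ℝ g x) :
    gradient (fun y => f y * g y) x = f x • gradient g x + g x • gradient f x := by
  simp only [gradient]
  rw [fderiv_fun_mul hf hg, map_add, map_smulₛₗ, map_smulₛₗ]
  simp

theorem gradient_comp_affine {ψ : E3 → ℝ} (hψ : Differentiable ℝ ψ) (t : ℝ) (y x : E3) :
    gradient (fun x => ψ (t • x + y)) x = t • gradient ψ (t • x + y) := by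
  have h1 : HasFDerivAt (fun x : E3 => t • x + y) (t • ContinuousLinearMap.id ℝ E3) x :=
    ((hasFDerivAt_id x).const_smul t).add_const y
  have h2 := (hψ (t • x + y)).hasFDerivAt.comp x h1
  have h3 : fderiv ℝ (fun x => ψ (t • x + y)) x = t • fderiv ℝ ψ (t • x + y) := by
    refine h2.fderiv.trans ?_
    ext v
    simp
  simp only [gradient]
  rw [h3, map_smulₛₗ]
  simp

theorem inner_gradient {ψ : E3 → ℝ} (x v : E3) : inner ℝ (gradient ψ x) v = fderiv ℝ ψ x v := by
  simp [gradient]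

theorem norm_gradient {ψ : E3 → ℝ} (x : E3) : ‖gradient ψ x‖ = ‖fderiv ℝ ψ x‖ := by
  simp [gradient]

theorem IsTest.memLp {ψ : E3 → ℝ} (h : IsTest ψ) (a : ℝ≥0∞) : MemLp ψ a :=
  h.1.continuous.memLp_of_hasCompactSupport h.2

theorem IsTest.memLp_gradient {ψ : E3 → ℝ} (h : IsTest ψ) (a : ℝ≥0∞) : MemLp (gradient ψ) a :=
  h.continuous_gradient.memLp_of_hasCompactSupport h.hasCompactSupport_gradient

theorem IsTest.differentiable {ψ : E3 → ℝ} (h : IsTest ψ) : Differentiable ℝ ψ :=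
  h.1.differentiable (by simp)

theorem IsTest.comp_affine {ψ : E3 → ℝ} (h : IsTest ψ) {t : ℝ} (ht : t ≠ 0) (y : E3) :
    IsTest fun x => ψ (t • x + y) := by
  refine ⟨h.1.comp ((contDiff_id.const_smul t).add contDiff_const), ?_⟩
  exact h.2.comp_homeomorph ((Homeomorph.smulOfNeZero t ht).trans (Homeomorph.addRight y))

theorem IsTest.mul_contDiff {η f : E3 → ℝ} (h : IsTest η) (hf : ContDiff ℝ ∞ f) :
    IsTest fun x => η x * f x :=
  ⟨h.1.mul hf, h.2.mul_right⟩

/-- A fixed bump function, equal to `1` on the unit ball, supported in the ball of radius `2`. -/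
def unitBump : ContDiffBump (0 : E3) := ⟨1, 2, one_pos, one_lt_two⟩

/-- The dilated bump function, equal to `1` on the ball of radius `ρ`. -/
def cutoff (ρ : ℝ) (x : E3) : ℝ := unitBump (ρ⁻¹ • x)

theorem isTest_unitBump : IsTest unitBump := ⟨unitBump.contDiff, unitBump.hasCompactSupport⟩

theorem isTest_cutoff {ρ : ℝ} (hρ : 0 < ρ) : IsTest (cutoff ρ) := by
  have := isTest_unitBump.comp_affine (inv_ne_zero hρ.ne') 0
  simp only [add_zero] at this
  exact this

theorem cutoff_nonneg (ρ : ℝ) (x : E3) : 0 ≤ cutoff ρ x := unitBump.nonneg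

theorem cutoff_le_one (ρ : ℝ) (x : E3) : cutoff ρ x ≤ 1 := unitBump.le_one

theorem cutoff_eq_one {ρ : ℝ} (hρ : 0 < ρ) {x : E3} (hx : ‖x‖ ≤ ρ) : cutoff ρ x = 1 := by
  apply unitBump.one_of_mem_closedBall
  simp only [unitBump, mem_closedBall_zero_iff, norm_smul, norm_inv, Real.norm_of_nonneg hρ.le]
  rw [inv_mul_le_iff₀ hρ]
  simpa using hx

theorem cutoff_eq_zero {ρ : ℝ} (hρ : 0 < ρ) {x : E3} (hx : 2 * ρ ≤ ‖x‖) : cutoff ρ x = 0 := by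
  apply unitBump.zero_of_le_dist
  simp only [unitBump, dist_zero_right, norm_smul, norm_inv, Real.norm_of_nonneg hρ.le]
  rw [le_inv_mul_iff₀ hρ]
  linarith

theorem gradient_cutoff (ρ : ℝ) (x : E3) :
    gradient (cutoff ρ) x = ρ⁻¹ • gradient unitBump (ρ⁻¹ • x) := by
  have := gradient_comp_affine isTest_unitBump.differentiable ρ⁻¹ 0 x
  simp only [add_zero] at this
  exact this

theorem exists_norm_gradient_cutoff_le : ∃ C, 0 < C ∧ ∀ ρ : ℝ, 0 < ρ → ∀ x,
    ‖gradient (cutoff ρ) x‖ ≤ C / ρ := by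
  obtain ⟨C, hC⟩ := isTest_unitBump.hasCompactSupport_gradient.exists_bound_of_continuous
    isTest_unitBump.continuous_gradient
  refine ⟨max C 1, by positivity, fun ρ hρ x => ?_⟩
  rw [gradient_cutoff, norm_smul, norm_inv, Real.norm_of_nonneg hρ.le, div_eq_inv_mul]
  gcongr
  exact (hC _).trans (le_max_left _ _)

end Gradient

/-! ### Mollification -/

section Mollify

variable {F : Type*} [NormedAddCommGroup F] [NormedSpace ℝ F]

/-- The probability measure with density a normed bump function. -/
def bumpMeasure (φ : ContDiffBump (0 : E3)) : Measure E3 :=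
  volume.withDensity fun y => ENNReal.ofReal (φ.normed volume y)

theorem measurable_bump (φ : ContDiffBump (0 : E3)) :
    Measurable fun y => ENNReal.ofReal (φ.normed volume y) :=
  (φ.continuous_normed.measurable).ennreal_ofReal

instance (φ : ContDiffBump (0 : E3)) : IsProbabilityMeasure (bumpMeasure φ) := ⟨by
  rw [bumpMeasure, withDensity_apply _ MeasurableSet.univ, Measure.restrict_univ,
    ← ofReal_integral_eq_lintegral_ofReal φ.integrable_normed
      (Eventually.of_forall φ.nonneg_normed), φ.integral_normed, ENNReal.ofReal_one]⟩

theorem integral_bumpMeasure (φ : ContDiffBump (0 : E3)) (f : E3 → F) :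
    ∫ y, f y ∂bumpMeasure φ = ∫ y, φ.normed volume y • f y := by
  rw [bumpMeasure, integral_withDensity_eq_integral_toReal_smul (measurable_bump φ) (by simp)]
  simp_rw [ENNReal.toReal_ofReal (φ.nonneg_normed _)]

theorem ae_bumpMeasure_norm_le (φ : ContDiffBump (0 : E3)) :
    ∀ᵐ y ∂bumpMeasure φ, ‖y‖ ≤ φ.rOut := by
  rw [bumpMeasure, ae_withDensity_iff (measurable_bump φ)]
  refine Eventually.of_forall fun y hy => ?_
  have h0 : y ∈ Function.support (φ.normed volume) := fun h => hy (by simp [h])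
  rw [φ.support_normed_eq, mem_ball_zero_iff] at h0
  exact h0.le

/-- The convolution with a normed bump function. -/
def mollify (φ : ContDiffBump (0 : E3)) (u : E3 → F) (x : E3) : F :=
  ∫ y, φ.normed volume y • u (x - y)

theorem mollify_eq_convolution (φ : ContDiffBump (0 : E3)) (u : E3 → F) :
    mollify φ u = convolution (φ.normed volume) u (ContinuousLinearMap.lsmul ℝ ℝ) volume := rfl

theorem mollify_eq_integral (φ : ContDiffBump (0 : E3)) (u : E3 → F) (x : E3) :
    mollify φ u x = ∫ y, u (x - y) ∂bumpMeasure φ := (integral_bumpMeasure φ _).symm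

theorem contDiff_mollify [CompleteSpace F] (φ : ContDiffBump (0 : E3)) {u : E3 → F}
    (hu : LocallyIntegrable u) :
    ContDiff ℝ ∞ (mollify φ u) :=
  φ.hasCompactSupport_normed.contDiff_convolution_left (ContinuousLinearMap.lsmul ℝ ℝ)
    φ.contDiff_normed hu

/-- A mollification is an average of translates for the probability measure `bumpMeasure φ`, and
translates have equal norms. -/
theorem eLpNorm_mollify_le (φ : ContDiffBump (0 : E3)) {u : E3 → F} (hu : StronglyMeasurable u)
    {p : ℝ≥0∞} (hp1 : 1 ≤ p) (hp : p ≠ ⊤) : eLpNorm (mollify φ u) p ≤ eLpNorm u p := by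
  simp_rw [funext (mollify_eq_integral φ u)]
  refine eLpNorm_integral_le hp1 hp (f := fun x y => u (x - y))
    (hu.comp_measurable measurable_sub) (Eventually.of_forall fun y => le_of_eq ?_)
  exact eLpNorm_comp_measurePreserving hu.aestronglyMeasurable
    (measurePreserving_sub_right volume y)

theorem isTest_normed_sub (φ : ContDiffBump (0 : E3)) (x : E3) :
    IsTest fun y => φ.normed volume (x - y) := by
  have h : IsTest (φ.normed (volume : Measure E3)) :=
    ⟨φ.contDiff_normed, φ.hasCompactSupport_normed⟩
  have := h.comp_affine (t := -1) (by norm_num) x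
  simpa [neg_add_eq_sub] using this

/-- Differentiation falls on the kernel, and y ↦ ρ(x - y) is an admissible test function. The sign
from the chain rule cancels the sign in the definition of the weak gradient. -/
theorem gradient_mollify (φ : ContDiffBump (0 : E3)) {u : E3 → ℝ} {g : E3 → E3}
    (hu : LocallyIntegrable u) (h : HasWeakGrad u g) (x : E3) :
    gradient (mollify φ u) x = mollify φ g x := by
  have hφ : IsTest (φ.normed (volume : Measure E3)) :=
    ⟨φ.contDiff_normed, φ.hasCompactSupport_normed⟩
  have hd := φ.hasCompactSupport_normed.hasFDerivAt_convolution_left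
    (ContinuousLinearMap.lsmul ℝ ℝ) (φ.contDiff_normed (μ := volume) (n := 1)) hu x
  have hψ := h _ (isTest_normed_sub φ x)
  have hgr (y : E3) : gradient (fun y => φ.normed volume (x - y)) y =
      -gradient (φ.normed volume) (x - y) := by
    have := gradient_comp_affine hφ.differentiable (-1) x y
    simpa [neg_add_eq_sub] using this
  have i1 : Integrable (fun y => u y • gradient (fun y => φ.normed volume (x - y)) y) :=
    hu.integrable_smul_right_of_hasCompactSupport (isTest_normed_sub φ x).continuous_gradient
      (isTest_normed_sub φ x).hasCompactSupport_gradient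
  have e1 : mollify φ g x = ∫ y, φ.normed volume (x - y) • g y := by
    rw [mollify, ← integral_sub_left_eq_self _ volume x]
    simp
  have e2 : fderiv ℝ (mollify φ u) x = innerSL ℝ (mollify φ g x) := by
    rw [e1, ← neg_neg (∫ y, φ.normed volume (x - y) • g y), ← hψ, map_neg,
      ← ContinuousLinearMap.integral_comp_comm _ i1, ← integral_neg, mollify_eq_convolution,
      hd.fderiv, convolution_eq_swap]
    congr 1
    funext y
    ext v
    rw [hgr]
    simp only [smul_neg, map_neg, neg_neg, map_smul, ContinuousLinearMap.precompL_apply,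
      ContinuousLinearMap.lsmul_apply, smul_apply, smul_eq_mul]
    rw [mul_comm]
    exact congrArg _ (inner_gradient _ _).symm
  refine ext_inner_right ℝ fun v => ?_
  rw [inner_gradient, e2, innerSL_apply_apply]

end Mollify

/-! ### Approximation, Sobolev inequality and translation estimates in W^{1,p} -/

section Sobolev

theorem exists_eLpNorm_le_gradient {p : ℝ} (h1 : 1 < p) (h3 : p < 3) :
    ∃ C : ℝ≥0, ∀ ψ : E3 → ℝ, IsTest ψ → eLpNorm ψ (ENNReal.ofReal (sobolevExp p)) ≤
      C * eLpNorm (gradient ψ) (ENNReal.ofReal p) := by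
  refine ⟨eLpNormLESNormFDerivOfEqInnerConst (volume : Measure E3) p.toNNReal, fun ψ hψ => ?_⟩
  have hs : 0 < sobolevExp p := div_pos (by linarith) (by linarith)
  have key := eLpNorm_le_eLpNorm_fderiv_of_eq_inner (volume : Measure E3) (F' := ℝ)
    (u := ψ) (hψ.1.of_le (by simp)) hψ.2 (p := p.toNNReal) (p' := (sobolevExp p).toNNReal)
    (by simpa using h1.le) (by simp) (by
      rw [NNReal.coe_inv, Real.coe_toNNReal _ (by linarith), Real.coe_toNNReal _ (by linarith)]
      have : (3 : ℝ) - p ≠ 0 := by linarith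
      have : p ≠ 0 := by linarith
      simp only [sobolevExp, finrank_euclideanSpace, Fintype.card_fin]
      push_cast
      field_simp)
  have hg : eLpNorm (fderiv ℝ ψ) (p.toNNReal : ℝ≥0∞) (volume : Measure E3)
      = eLpNorm (gradient ψ) (p.toNNReal : ℝ≥0∞) volume :=
    eLpNorm_congr_norm_ae (Eventually.of_forall fun x => by simp [gradient])
  rw [hg] at key
  exact key

variable {p : ℝ} [Fact (1 < p)]

theorem one_le_ofReal : 1 ≤ ENNReal.ofReal p := Fact.out

theorem W1.stronglyMeasurable_fn (u : W1 p) : StronglyMeasurable u.fn := Lp.stronglyMeasurable _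

theorem W1.stronglyMeasurable_grad (u : W1 p) : StronglyMeasurable u.grad :=
  Lp.stronglyMeasurable _

theorem W1.memLp_fn (u : W1 p) : MemLp u.fn (ENNReal.ofReal p) := Lp.memLp _

theorem W1.memLp_grad (u : W1 p) : MemLp u.grad (ENNReal.ofReal p) := Lp.memLp _

theorem W1.locallyIntegrable_fn (u : W1 p) : LocallyIntegrable u.fn :=
  u.memLp_fn.locallyIntegrable one_le_ofReal

theorem W1.locallyIntegrable_grad (u : W1 p) : LocallyIntegrable u.grad :=
  u.memLp_grad.locallyIntegrable one_le_ofReal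

theorem W1.hasWeakGrad (u : W1 p) : HasWeakGrad u.fn u.grad := u.2

theorem W1.eLpNorm_fn_le (u : W1 p) : eLpNorm u.fn (ENNReal.ofReal p) ≤ ENNReal.ofReal ‖u‖ := by
  have h : ‖u.1.fst‖ ≤ ‖u.1‖ := WithLp.norm_fst_le _ u.1
  rw [Lp.norm_def] at h
  exact (ENNReal.le_ofReal_iff_toReal_le (Lp.eLpNorm_ne_top _) (norm_nonneg _)).2 h

theorem W1.eLpNorm_grad_le (u : W1 p) :
    eLpNorm u.grad (ENNReal.ofReal p) ≤ ENNReal.ofReal ‖u‖ := by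
  have h : ‖u.1.snd‖ ≤ ‖u.1‖ := WithLp.norm_snd_le _ u.1
  rw [Lp.norm_def] at h
  exact (ENNReal.le_ofReal_iff_toReal_le (Lp.eLpNorm_ne_top _) (norm_nonneg _)).2 h

theorem W1.fn_sub (u v : W1 p) : (u - v).fn =ᵐ[volume] fun x => u.fn x - v.fn x :=
  Lp.coeFn_sub u.1.fst v.1.fst

theorem W1.fn_smul (t : ℝ) (u : W1 p) : (t • u).fn =ᵐ[volume] fun x => t * u.fn x :=
  Lp.coeFn_smul t u.1.fst

/-- A sequence of bump functions whose supports shrink to the origin. -/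
def shrinkingBump (n : ℕ) : ContDiffBump (0 : E3) :=
  ⟨1 / (n + 1), 2 / (n + 1), by positivity, by gcongr; norm_num⟩

theorem tendsto_shrinkingBump_rOut : Tendsto (fun n => (shrinkingBump n).rOut) atTop (𝓝 0) := by
  have := (tendsto_one_div_add_atTop_nhds_zero_nat (𝕜 := ℝ)).const_mul 2
  simpa [shrinkingBump, div_eq_mul_inv] using this

/-- Sobolev functions are almost everywhere limits of test functions whose gradients are bounded
by the Sobolev norm. -/
theorem exists_test_approx (p : ℝ) [Fact (1 < p)] : ∃ C : ℝ, 0 < C ∧ ∀ u : W1 p,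
    ∃ ψ : ℕ → E3 → ℝ, (∀ n, IsTest (ψ n)) ∧
      (∀ᵐ x, Tendsto (fun n => ψ n x) atTop (𝓝 (u.fn x))) ∧
      ∀ n, eLpNorm (gradient (ψ n)) (ENNReal.ofReal p) ≤ ENNReal.ofReal (C * ‖u‖) := by
  obtain ⟨C, hC, hcut⟩ := exists_norm_gradient_cutoff_le
  refine ⟨1 + C, by positivity, fun u => ?_⟩
  have hpos (n : ℕ) : (0 : ℝ) < n + 1 := by positivity
  have hm (n : ℕ) : ContDiff ℝ ∞ (mollify (shrinkingBump n) u.fn) :=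
    contDiff_mollify _ u.locallyIntegrable_fn
  -- Mollify, then cut off at radius n + 1. The cutoff has values in [0, 1] and gradient at most
  -- C/(n + 1) ≤ C, so the gradient norm stays below (1 + C)‖u‖.
  refine ⟨fun n x => cutoff (n + 1) x * mollify (shrinkingBump n) u.fn x,
    fun n => (isTest_cutoff (hpos n)).mul_contDiff (hm n), ?_, fun n => ?_⟩
  -- Lebesgue differentiation; `K = 2` is the ratio of the outer to the inner radius of the bumps.
  · have h := ContDiffBump.ae_convolution_tendsto_right_of_locallyIntegrable (μ := volume)
      (K := 2) tendsto_shrinkingBump_rOut (Eventually.of_forall fun n => by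
        simp only [shrinkingBump]
        exact le_of_eq (by ring)) u.locallyIntegrable_fn
    filter_upwards [h] with x hx
    refine hx.congr' ?_
    obtain ⟨N, hN⟩ := exists_nat_ge ‖x‖
    filter_upwards [eventually_ge_atTop N] with n hn
    rw [cutoff_eq_one (hpos n), one_mul, mollify_eq_convolution]
    have : (N : ℝ) ≤ n := by exact_mod_cast hn
    linarith
  · set v := mollify (shrinkingBump n) u.fn
    set g := mollify (shrinkingBump n) u.grad
    have hv : Continuous v := (hm n).continuous
    have hg : Continuous g := (contDiff_mollify _ u.locallyIntegrable_grad).continuous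
    have hgr : gradient (fun x => cutoff (n + 1) x * v x) =
        (cutoff (n + 1) • g) + (v • gradient (cutoff (n + 1))) := by
      funext x
      rw [gradient_mul ((isTest_cutoff (hpos n)).differentiable x)
        ((hm n).differentiable (by simp) x),
        gradient_mollify _ u.locallyIntegrable_fn u.hasWeakGrad]
      rfl
    have hc := isTest_cutoff (hpos n)
    rw [hgr]
    refine (eLpNorm_add_le (hc.1.continuous.smul hg).aestronglyMeasurable
      (hv.smul hc.continuous_gradient).aestronglyMeasurable one_le_ofReal).trans ?_
    rw [add_mul, one_mul, ENNReal.ofReal_add (norm_nonneg _) (by positivity)]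
    have b1 : eLpNorm g (ENNReal.ofReal p) ≤ ENNReal.ofReal ‖u‖ :=
      (eLpNorm_mollify_le _ u.stronglyMeasurable_grad one_le_ofReal (by simp)).trans
        u.eLpNorm_grad_le
    have b2 : eLpNorm v (ENNReal.ofReal p) ≤ ENNReal.ofReal ‖u‖ :=
      (eLpNorm_mollify_le _ u.stronglyMeasurable_fn one_le_ofReal (by simp)).trans
        u.eLpNorm_fn_le
    gcongr
    · refine (eLpNorm_mono fun x => ?_).trans b1
      simp only [Pi.smul_apply', norm_smul, Real.norm_of_nonneg (cutoff_nonneg _ x)]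
      exact mul_le_of_le_one_left (norm_nonneg _) (cutoff_le_one _ x)
    · rw [ENNReal.ofReal_mul hC.le]
      refine (eLpNorm_le_mul_eLpNorm_of_ae_le_mul (c := C) (g := v)
        (Eventually.of_forall fun x => ?_) _).trans (by gcongr)
      simp only [Pi.smul_apply', norm_smul]
      rw [mul_comm]
      gcongr
      refine (hcut _ (hpos n) x).trans (div_le_self hC.le ?_)
      linarith [(Nat.cast_nonneg n : (0 : ℝ) ≤ n)]

/-- The Sobolev inequality on `W^{1,p}`. -/
theorem exists_eLpNorm_sobolevExp_le (hp : p < 3) : ∃ C : ℝ, 0 < C ∧ ∀ u : W1 p,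
    eLpNorm u.fn (ENNReal.ofReal (sobolevExp p)) ≤ ENNReal.ofReal (C * ‖u‖) := by
  obtain ⟨C, hC, h⟩ := exists_test_approx p
  obtain ⟨D, hD⟩ := exists_eLpNorm_le_gradient (p := p) Fact.out hp
  -- `D` may be zero; adding 1 keeps the constant positive.
  refine ⟨(D + 1) * C, by positivity, fun u => ?_⟩
  obtain ⟨ψ, hψ, hlim, hb⟩ := h u
  refine eLpNorm_le_of_tendsto_ae (fun n => (hψ n).1.continuous.aestronglyMeasurable)
    (fun n => ?_) hlim
  refine (hD _ (hψ n)).trans ?_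
  rw [mul_assoc, ENNReal.ofReal_mul (by positivity)]
  gcongr
  · rw [← ENNReal.ofReal_coe_nnreal]
    exact ENNReal.ofReal_le_ofReal (by simp)
  · exact hb n

/-- The increment is the average over the segment from x to x + h of the derivative in direction h,
so Minkowski's inequality applies. -/
theorem IsTest.eLpNorm_translate_sub_le {ψ : E3 → ℝ} (hψ : IsTest ψ) (h : E3) :
    eLpNorm (fun x => ψ (x + h) - ψ x) (ENNReal.ofReal p) ≤
      ENNReal.ofReal ‖h‖ * eLpNorm (gradient ψ) (ENNReal.ofReal p) := by
  set κ : Measure ℝ := volume.restrict (Set.Ioc 0 1)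
  have : IsProbabilityMeasure κ := ⟨by simp [κ]⟩
  set f : E3 → ℝ → ℝ := fun x τ => inner ℝ (gradient ψ (x + τ • h)) h
  have hf : Continuous (Function.uncurry f) :=
    (hψ.continuous_gradient.comp (continuous_fst.add (continuous_snd.smul continuous_const))).inner
      continuous_const
  have e (x : E3) : ψ (x + h) - ψ x = ∫ τ, f x τ ∂κ := by
    have hd (τ : ℝ) : HasDerivAt (fun τ : ℝ => ψ (x + τ • h)) (f x τ) τ := by
      have h1 : HasDerivAt (fun τ : ℝ => x + τ • h) h τ := by
        simpa using ((hasDerivAt_id τ).smul_const h).const_add x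
      have h2 := (hψ.differentiable (x + τ • h)).hasFDerivAt.comp_hasDerivAt τ h1
      rw [show f x τ = fderiv ℝ ψ (x + τ • h) h from inner_gradient _ _]
      exact h2
    have := intervalIntegral.integral_eq_sub_of_hasDerivAt (a := 0) (b := 1)
      (fun τ _ => hd τ)
      ((hf.comp (continuous_const.prodMk continuous_id)).intervalIntegrable (μ := volume) 0 1)
    rw [intervalIntegral.integral_of_le zero_le_one] at this
    simp only [one_smul, zero_smul, add_zero] at this
    exact this.symm
  simp_rw [e]
  refine eLpNorm_integral_le one_le_ofReal (by simp) hf.stronglyMeasurable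
    (Eventually.of_forall fun τ => ?_)
  refine (eLpNorm_le_mul_eLpNorm_of_ae_le_mul (c := ‖h‖) (g := fun x => gradient ψ (x + τ • h))
    (Eventually.of_forall fun x => ?_) _).trans ?_
  · rw [mul_comm]
    exact norm_inner_le_norm _ _
  · gcongr
    exact (eLpNorm_comp_measurePreserving hψ.continuous_gradient.aestronglyMeasurable
      (measurePreserving_add_right volume (τ • h))).le

theorem exists_eLpNorm_translate_sub_le (p : ℝ) [Fact (1 < p)] : ∃ C : ℝ, 0 < C ∧
    ∀ (u : W1 p) (h : E3), eLpNorm (fun x => u.fn (x + h) - u.fn x) (ENNReal.ofReal p) ≤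
      ENNReal.ofReal (C * ‖h‖ * ‖u‖) := by
  obtain ⟨C, hC, H⟩ := exists_test_approx p
  refine ⟨C, hC, fun u h => ?_⟩
  obtain ⟨ψ, hψ, hlim, hb⟩ := H u
  have hlim' := (measurePreserving_add_right volume h).quasiMeasurePreserving.ae hlim
  refine eLpNorm_le_of_tendsto_ae (f := fun n x => ψ n (x + h) - ψ n x) (fun n => ?_)
    (fun n => ?_) ?_
  · have := (hψ n).1.continuous
    exact Continuous.aestronglyMeasurable (by fun_prop)
  · refine ((hψ n).eLpNorm_translate_sub_le h).trans ?_
    rw [show C * ‖h‖ * ‖u‖ = ‖h‖ * (C * ‖u‖) by ring, ENNReal.ofReal_mul (norm_nonneg h)]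
    gcongr
    exact hb n
  · filter_upwards [hlim, hlim'] with x h1 h2
    exact h2.sub h1

/-- The mollification error averages the increments u(x - y) - u(x) over ‖y‖ at most the radius of
the bump. Being uniform on bounded sets of W^{1,p}, the bound is the source of local compactness. -/
theorem exists_eLpNorm_mollify_sub_le (p : ℝ) [Fact (1 < p)] : ∃ C : ℝ, 0 < C ∧
    ∀ (u : W1 p) (φ : ContDiffBump (0 : E3)),
      eLpNorm (fun x => mollify φ u.fn x - u.fn x) (ENNReal.ofReal p) ≤
        ENNReal.ofReal (C * φ.rOut * ‖u‖) := by
  obtain ⟨C, hC, H⟩ := exists_eLpNorm_translate_sub_le p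
  refine ⟨C, hC, fun u φ => ?_⟩
  have e (x : E3) : mollify φ u.fn x - u.fn x = ∫ y, (u.fn (x - y) - u.fn x) ∂bumpMeasure φ := by
    have hi : Integrable (fun y => u.fn (x - y)) (bumpMeasure φ) := by
      rw [bumpMeasure, integrable_withDensity_iff_integrable_smul' (measurable_bump φ) (by simp)]
      simp_rw [ENNReal.toReal_ofReal (φ.nonneg_normed _)]
      exact φ.hasCompactSupport_normed.convolutionExists_left (ContinuousLinearMap.lsmul ℝ ℝ)
        φ.continuous_normed u.locallyIntegrable_fn x
    rw [integral_sub hi (integrable_const _), ← mollify_eq_integral]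
    simp
  simp_rw [e]
  refine eLpNorm_integral_le one_le_ofReal (by simp) (f := fun x y => u.fn (x - y) - u.fn x)
    ((u.stronglyMeasurable_fn.comp_measurable measurable_sub).sub
      (u.stronglyMeasurable_fn.comp_measurable measurable_fst)) ?_
  filter_upwards [ae_bumpMeasure_norm_le φ] with y hy
  simp_rw [sub_eq_add_neg _ y]
  refine (H u (-y)).trans (ENNReal.ofReal_le_ofReal ?_)
  rw [norm_neg]
  gcongr

end Sobolev

/-! ### Weak convergence, embeddings and local compactness -/

section Compactness

/-- Banach–Steinhaus for the images in the bidual, into which the space embeds isometrically. -/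
theorem WeakConv.exists_bound {X : Type*} [NormedAddCommGroup X] [NormedSpace ℝ X] {a : ℕ → X}
    {b : X} (h : WeakConv a b) : ∃ M, 0 ≤ M ∧ ∀ n, ‖a n - b‖ ≤ M := by
  have h1 (ℓ : StrongDual ℝ X) :
      ∃ C, ∀ n, ‖NormedSpace.inclusionInDoubleDual ℝ X (a n - b) ℓ‖ ≤ C := by
    obtain ⟨C, hC⟩ := ((h ℓ).sub_const (ℓ b)).norm.bddAbove_range
    refine ⟨C, fun n => ?_⟩
    have := hC ⟨n, rfl⟩
    simpa using this
  obtain ⟨C, hC⟩ := banach_steinhaus h1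
  refine ⟨max C 0, le_max_right _ _, fun n => ?_⟩
  have := (NormedSpace.inclusionInDoubleDualLi ℝ (E := X)).norm_map (a n - b)
  rw [← this]
  exact (hC n).trans (le_max_left _ _)

/-- The functional `f ↦ ∫ k f` on `L^a`, for `k` in the dual Lebesgue space. -/
def lpPairing {a b : ℝ} [Fact (1 ≤ ENNReal.ofReal a)] (hab : a.HolderConjugate b) {k : E3 → ℝ}
    (hk : MemLp k (ENNReal.ofReal b)) :
    StrongDual ℝ (Lp ℝ (ENNReal.ofReal a) (volume : Measure E3)) :=
  LinearMap.mkContinuous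
    { toFun := fun f => ∫ x, k x * f x
      map_add' := fun f g => by
        rw [← integral_add (integrable_mul_of_memLp hab.symm hk (Lp.memLp f))
          (integrable_mul_of_memLp hab.symm hk (Lp.memLp g))]
        refine integral_congr_ae ?_
        filter_upwards [Lp.coeFn_add f g] with x hx
        rw [hx, Pi.add_apply, mul_add]
      map_smul' := fun c f => by
        rw [RingHom.id_apply, smul_eq_mul, ← integral_const_mul]
        refine integral_congr_ae ?_
        filter_upwards [Lp.coeFn_smul c f] with x hx
        rw [hx, Pi.smul_apply, smul_eq_mul]
        ring }
    ((∫ x, ‖k x‖ ^ b) ^ (1 / b)) fun f => by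
      rw [Lp_norm_eq hab.pos]
      exact abs_integral_mul_le hab.symm hk (Lp.memLp f)

theorem lpPairing_apply {a b : ℝ} [Fact (1 ≤ ENNReal.ofReal a)] (hab : a.HolderConjugate b)
    {k : E3 → ℝ} (hk : MemLp k (ENNReal.ofReal b))
    (f : Lp ℝ (ENNReal.ofReal a) (volume : Measure E3)) : lpPairing hab hk f = ∫ x, k x * f x := rfl

theorem norm_lpPairing_le {a b : ℝ} [Fact (1 ≤ ENNReal.ofReal a)] (hab : a.HolderConjugate b)
    {k : E3 → ℝ} (hk : MemLp k (ENNReal.ofReal b)) :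
    ‖lpPairing hab hk‖ ≤ (∫ x, ‖k x‖ ^ b) ^ (1 / b) :=
  LinearMap.mkContinuous_norm_le _ (Real.rpow_nonneg (integral_rpow_nonneg _ _) _) _

variable {p : ℝ} [Fact (1 < p)]

/-- The inclusion of `W^{1,p}` in `L^p`. -/
def W1.fnL (p : ℝ) [Fact (1 < p)] : W1 p →L[ℝ] Lp ℝ (ENNReal.ofReal p) (volume : Measure E3) :=
  LinearMap.mkContinuous
    { toFun := fun u => u.1.fst
      map_add' := fun _ _ => rfl
      map_smul' := fun _ _ => rfl } 1 fun u => by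
    rw [one_mul]
    exact WithLp.norm_fst_le _ u.1

theorem W1.fnL_apply (u : W1 p) : (W1.fnL p u : E3 → ℝ) = u.fn := rfl

theorem W1.integral_abs_fn_rpow_le (u : W1 p) : ∫ x, |u.fn x| ^ p ≤ ‖u‖ ^ p := by
  have h1 : 1 < p := Fact.out
  have := (integral_rpow_le_of_eLpNorm_le (by linarith) (norm_nonneg u)
    u.memLp_fn.1 u.eLpNorm_fn_le).2
  simpa using this

theorem holderConjugate_conjExponent : p.HolderConjugate (p / (p - 1)) :=
  Real.HolderConjugate.conjExponent Fact.out

theorem memLp_bump_sub (φ : ContDiffBump (0 : E3)) (x : E3) (b : ℝ≥0∞) :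
    MemLp (fun y => φ.normed volume (x - y)) b := (isTest_normed_sub φ x).memLp b

/-- The value of a mollification at a point is a bounded functional of `u`; thus weak convergence
becomes pointwise convergence of mollifications. -/
theorem lpPairing_bump (φ : ContDiffBump (0 : E3)) (u : W1 p) (x : E3) :
    lpPairing holderConjugate_conjExponent (memLp_bump_sub φ x _) (W1.fnL p u) =
      mollify φ u.fn x := by
  rw [lpPairing_apply, W1.fnL_apply, mollify, ← integral_sub_left_eq_self _ volume x]
  simp

/-- By translation invariance the L^{p'} norm of the kernel, and with it the bound, does not depend
on `x`. -/
theorem exists_abs_mollify_le (φ : ContDiffBump (0 : E3)) : ∃ K, 0 ≤ K ∧ ∀ (u : W1 p) (x : E3),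
    |mollify φ u.fn x| ≤ K * ‖u‖ := by
  refine ⟨(∫ y, ‖φ.normed volume y‖ ^ (p / (p - 1))) ^ (1 / (p / (p - 1))),
    Real.rpow_nonneg (integral_rpow_nonneg _ _) _, fun u x => ?_⟩
  rw [← lpPairing_bump, ← Real.norm_eq_abs]
  refine (ContinuousLinearMap.le_opNorm _ _).trans ?_
  gcongr
  · refine (norm_lpPairing_le _ _).trans (le_of_eq ?_)
    rw [integral_sub_left_eq_self (fun y => ‖φ.normed volume y‖ ^ (p / (p - 1))) volume x]
  · exact WithLp.norm_fst_le _ u.1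

theorem WeakConv.tendsto_mollify {a : ℕ → W1 p} {u : W1 p} (h : WeakConv a u)
    (φ : ContDiffBump (0 : E3)) (x : E3) :
    Tendsto (fun n => mollify φ (a n - u).fn x) atTop (𝓝 0) := by
  have := (h ((lpPairing holderConjugate_conjExponent (memLp_bump_sub φ x _)).comp
    (W1.fnL p))).sub_const (((lpPairing holderConjugate_conjExponent
      (memLp_bump_sub φ x _)).comp (W1.fnL p)) u)
  simp_rw [← map_sub, sub_self, map_zero, ContinuousLinearMap.comp_apply, lpPairing_bump] at this
  exact this

theorem add_rpow_le {a b p : ℝ} (ha : 0 ≤ a) (hb : 0 ≤ b) (hp : 0 ≤ p) :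
    (a + b) ^ p ≤ 2 ^ p * (a ^ p + b ^ p) := by
  have h1 : a + b ≤ 2 * max a b := by linarith [le_max_left a b, le_max_right a b]
  refine (Real.rpow_le_rpow (by positivity) h1 hp).trans ?_
  rw [Real.mul_rpow (by norm_num) (by positivity)]
  gcongr
  exact max_rpow_le ha hb

theorem integrableOn_const_ball (R c : ℝ) :
    IntegrableOn (fun _ => c) (Metric.ball (0 : E3) R) volume :=
  integrableOn_const (measure_ball_lt_top (μ := (volume : Measure E3))).ne

/-- Local compactness of the embedding of `W^{1,p}` in `L^p`. -/
theorem WeakConv.tendsto_setIntegral_ball {a : ℕ → W1 p} {u : W1 p} (h : WeakConv a u) (R : ℝ) :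
    Tendsto (fun n => ∫ x in Metric.ball 0 R, |(a n - u).fn x| ^ p) atTop (𝓝 0) := by
  have hp1 : 1 < p := Fact.out
  have hp0 : 0 < p := by linarith
  obtain ⟨M, hM0, hM⟩ := h.exists_bound
  obtain ⟨C, hC, H⟩ := exists_eLpNorm_mollify_sub_le p
  refine tendsto_zero_of_le_add (fun n => integral_nonneg fun x => by positivity) fun ε hε => ?_
  -- The scale is fixed first: the mollification error is below `ε` for all n at once. At this scale
  -- only the mollified sequence remains.
  have hsmall : Tendsto (fun k => 2 ^ p * (C * (shrinkingBump k).rOut * M) ^ p) atTop (𝓝 0) := by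
    have := (((tendsto_shrinkingBump_rOut.const_mul C).mul_const M).rpow_const
      (p := p) (Or.inr hp0.le)).const_mul (2 ^ p)
    simpa [Real.zero_rpow hp0.ne'] using this
  obtain ⟨k, hk⟩ := ((tendsto_order.1 hsmall).2 ε hε).exists
  set φ := shrinkingBump k
  obtain ⟨K, hK0, hK⟩ := exists_abs_mollify_le (p := p) φ
  have hmc (n : ℕ) : Continuous (mollify φ (a n - u).fn) :=
    (contDiff_mollify φ (a n - u).locallyIntegrable_fn).continuous
  have hbd (n : ℕ) (x : E3) : |mollify φ (a n - u).fn x| ^ p ≤ (K * M) ^ p := by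
    refine Real.rpow_le_rpow (abs_nonneg _) ((hK _ _).trans ?_) hp0.le
    gcongr
    exact hM n
  have hmeas (n : ℕ) : AEStronglyMeasurable (fun x => |mollify φ (a n - u).fn x| ^ p)
      (volume.restrict (Metric.ball 0 R)) :=
    ((hmc n).abs.rpow_const fun _ => Or.inr hp0.le).aestronglyMeasurable
  have hint (n : ℕ) : IntegrableOn (fun x => |mollify φ (a n - u).fn x| ^ p)
      (Metric.ball 0 R) :=
    (integrableOn_const_ball R ((K * M) ^ p)).mono' (hmeas n) (Eventually.of_forall fun x => by
      rw [Real.norm_of_nonneg (by positivity)]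
      exact hbd n x)
  refine ⟨fun n => 2 ^ p * ∫ x in Metric.ball 0 R, |mollify φ (a n - u).fn x| ^ p, ?_,
    fun n => ?_⟩
  -- The mollifications tend to zero pointwise and are uniformly bounded, so dominated convergence
  -- applies on the ball.
  · have : Tendsto (fun n => ∫ x in Metric.ball (0 : E3) R, |mollify φ (a n - u).fn x| ^ p)
        atTop (𝓝 (∫ x in Metric.ball (0 : E3) R, (0 : ℝ))) := by
      refine tendsto_integral_of_dominated_convergence (fun _ => (K * M) ^ p) hmeas
        (integrableOn_const_ball R _) (fun n => Eventually.of_forall fun x => ?_)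
        (Eventually.of_forall fun x => ?_)
      · rw [Real.norm_of_nonneg (by positivity)]
        exact hbd n x
      · have := (h.tendsto_mollify φ x).abs.rpow_const (p := p) (Or.inr hp0.le)
        simpa [Real.zero_rpow hp0.ne'] using this
    simpa using this.const_mul (2 ^ p)
  · have hm : AEStronglyMeasurable (fun x => mollify φ (a n - u).fn x - (a n - u).fn x) volume :=
      (hmc n).aestronglyMeasurable.sub (a n - u).memLp_fn.1
    have hnn : 0 ≤ C * φ.rOut := mul_nonneg hC.le φ.rOut_pos.le
    obtain ⟨h1, h2⟩ := integral_rpow_le_of_eLpNorm_le (K := C * φ.rOut * M) hp0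
      (by positivity) hm ((H (a n - u) φ).trans (ENNReal.ofReal_le_ofReal (by
        gcongr
        exact hM n)))
    have i1 := h1.integrable_rpow hp0
    calc ∫ x in Metric.ball 0 R, |(a n - u).fn x| ^ p
        ≤ ∫ x in Metric.ball 0 R, 2 ^ p * (‖mollify φ (a n - u).fn x - (a n - u).fn x‖ ^ p +
            |mollify φ (a n - u).fn x| ^ p) := by
          refine integral_mono_of_nonneg (Eventually.of_forall fun x => by positivity)
            ((i1.integrableOn.add (hint n)).const_mul _) (Eventually.of_forall fun x => ?_)
          refine le_trans ?_ (add_rpow_le (norm_nonneg _) (abs_nonneg _) hp0.le)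
          refine Real.rpow_le_rpow (abs_nonneg _) ?_ hp0.le
          rw [norm_sub_rev, Real.norm_eq_abs]
          have := abs_add_le ((a n - u).fn x - mollify φ (a n - u).fn x)
            (mollify φ (a n - u).fn x)
          simpa using this
      _ = 2 ^ p * (∫ x in Metric.ball 0 R, ‖mollify φ (a n - u).fn x - (a n - u).fn x‖ ^ p) +
            2 ^ p * ∫ x in Metric.ball 0 R, |mollify φ (a n - u).fn x| ^ p := by
          rw [integral_const_mul, integral_add i1.integrableOn (hint n), mul_add]
      _ ≤ _ := by
          gcongr
          refine le_trans ?_ hk.le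
          gcongr
          exact (setIntegral_le_integral i1 (Eventually.of_forall fun x => by positivity)).trans h2

/-- The continuous embedding of `W^{1,p}` in `L^r` for `r` between `p` and the Sobolev exponent. -/
theorem W1.exists_integral_rpow_le (hp : p < 3) {r : ℝ} (h1 : p < r) (h2 : r < sobolevExp p) :
    ∃ C, 0 < C ∧ ∀ u : W1 p, MemLp u.fn (ENNReal.ofReal r) ∧ ∫ x, |u.fn x| ^ r ≤ C * ‖u‖ ^ r := by
  have hp1 : 1 < p := Fact.out
  have hp0 : 0 < p := by linarith
  have hr0 : 0 < r := by linarith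
  have hP0 : 0 < sobolevExp p := by linarith
  obtain ⟨K, hK, hS⟩ := exists_eLpNorm_sobolevExp_le (p := p) hp
  obtain ⟨D, hD, hI⟩ := exists_rpow_le_add hp0 h1 h2 one_pos
  -- Interpolating pointwise between the powers p and p* gives a bound with the wrong homogeneity,
  -- corrected afterwards by normalizing `u`.
  have key (u : W1 p) : MemLp u.fn (ENNReal.ofReal r) ∧
      ∫ x, |u.fn x| ^ r ≤ (K * ‖u‖) ^ sobolevExp p + D * ‖u‖ ^ p := by
    obtain ⟨m1, b1⟩ := integral_rpow_le_of_eLpNorm_le hP0 (by positivity) u.memLp_fn.1 (hS u)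
    have b2 := u.integral_abs_fn_rpow_le
    have i1 := m1.integrable_rpow hP0
    have i2 := u.memLp_fn.integrable_rpow hp0
    have hle (x : E3) : |u.fn x| ^ r ≤ ‖u.fn x‖ ^ sobolevExp p + D * ‖u.fn x‖ ^ p := by
      have := hI |u.fn x| (abs_nonneg _)
      simpa using this
    refine ⟨(memLp_ofReal_iff hr0 u.memLp_fn.1).2 ((i1.add (i2.const_mul D)).mono'
      (u.memLp_fn.1.norm.aemeasurable.pow_const r).aestronglyMeasurable
      (Eventually.of_forall fun x => ?_)), ?_⟩
    · rw [Real.norm_of_nonneg (by positivity)]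
      exact hle x
    · refine (integral_mono_of_nonneg (Eventually.of_forall fun x => by positivity)
        (i1.add (i2.const_mul D)) (Eventually.of_forall hle)).trans ?_
      simp only [Pi.add_apply]
      rw [integral_add i1 (i2.const_mul D), integral_const_mul]
      gcongr
      exact b2
  -- The value of the preceding bound at ‖u‖ = 1.
  refine ⟨K ^ sobolevExp p + D, by positivity, fun u => ⟨(key u).1, ?_⟩⟩
  rcases eq_or_ne u 0 with rfl | hu
  · have := (key 0).2
    simp only [norm_zero, mul_zero, Real.zero_rpow hP0.ne', Real.zero_rpow hp0.ne',
      Real.zero_rpow hr0.ne', add_zero] at this ⊢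
    exact this
  · have hn : 0 < ‖u‖ := norm_pos_iff.2 hu
    have h3 := (key (‖u‖⁻¹ • u)).2
    rw [norm_smul, norm_inv, norm_norm, inv_mul_cancel₀ hn.ne', mul_one, Real.one_rpow,
      mul_one] at h3
    have h4 : ∫ x, |(‖u‖⁻¹ • u).fn x| ^ r = (‖u‖ ^ r)⁻¹ * ∫ x, |u.fn x| ^ r := by
      rw [← integral_const_mul]
      refine integral_congr_ae ?_
      filter_upwards [W1.fn_smul ‖u‖⁻¹ u] with x hx
      rw [hx, abs_mul, Real.mul_rpow (abs_nonneg _) (abs_nonneg _),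
        abs_of_nonneg (by positivity), Real.inv_rpow hn.le]
    rw [h4, inv_mul_le_iff₀ (by positivity)] at h3
    linarith

/-- Local compactness of the embedding of `W^{1,p}` in `L^r` for `r` strictly below the Sobolev
exponent. -/
theorem WeakConv.tendsto_setIntegral_ball_rpow (hp : p < 3) {r : ℝ} (h1 : p < r)
    (h2 : r < sobolevExp p) {a : ℕ → W1 p} {u : W1 p} (h : WeakConv a u) (R : ℝ) :
    Tendsto (fun n => ∫ x in Metric.ball 0 R, |(a n - u).fn x| ^ r) atTop (𝓝 0) := by
  have hp1 : 1 < p := Fact.out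
  have hp0 : 0 < p := by linarith
  have hP0 : 0 < sobolevExp p := by linarith
  obtain ⟨M, hM0, hM⟩ := h.exists_bound
  obtain ⟨K, hK, hS⟩ := exists_eLpNorm_sobolevExp_le (p := p) hp
  refine tendsto_zero_of_le_add (fun n => integral_nonneg fun x => by positivity) fun ε hε => ?_
  have hB : 0 < (K * M) ^ sobolevExp p + 1 := by positivity
  -- The high power is only bounded, so its coefficient must absorb that bound; the power p tends to
  -- zero on the ball.
  obtain ⟨D, hD, hI⟩ := exists_rpow_le_add hp0 h1 h2 (div_pos hε hB)
  refine ⟨fun n => D * ∫ x in Metric.ball 0 R, |(a n - u).fn x| ^ p,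
    by simpa using (h.tendsto_setIntegral_ball R).const_mul D, fun n => ?_⟩
  obtain ⟨m1, b1⟩ := integral_rpow_le_of_eLpNorm_le (K := K * M) hP0 (by positivity)
    (a n - u).memLp_fn.1 ((hS (a n - u)).trans (ENNReal.ofReal_le_ofReal (by
      gcongr
      exact hM n)))
  have i1 := m1.integrable_rpow hP0
  have i2 := (a n - u).memLp_fn.integrable_rpow hp0
  simp only [Real.norm_eq_abs] at i1 i2 b1
  refine (integral_mono_of_nonneg (Eventually.of_forall fun x => by positivity)
    ((i1.integrableOn.const_mul _).add (i2.integrableOn.const_mul D))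
    (Eventually.of_forall fun x => hI _ (abs_nonneg _))).trans ?_
  simp only [Pi.add_apply]
  rw [integral_add (i1.integrableOn.const_mul _) (i2.integrableOn.const_mul D),
    integral_const_mul, integral_const_mul]
  gcongr
  rw [div_mul_eq_mul_div, div_le_iff₀ hB]
  gcongr
  refine (setIntegral_le_integral i1 (Eventually.of_forall fun x => by positivity)).trans ?_
  linarith

end Compactness

/-! ### The space D^{1,q} and the q-Laplacian as a duality map -/

section HomogeneousSobolev

variable {q : ℝ} [h1q : Fact (1 < q)] [h3q : Fact (q < 3)]

theorem one_lt_sobolevExp (q : ℝ) [Fact (1 < q)] [Fact (q < 3)] : 1 < sobolevExp q := Fact.out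

theorem sobolevExp_pos (q : ℝ) [Fact (1 < q)] [Fact (q < 3)] : 0 < sobolevExp q :=
  zero_lt_one.trans (one_lt_sobolevExp q)

namespace D1

theorem memLp_fn (φ : D1 q) : MemLp φ.fn (ENNReal.ofReal (sobolevExp q)) := Lp.memLp _

theorem memLp_grad (φ : D1 q) : MemLp φ.grad (ENNReal.ofReal q) := Lp.memLp _

theorem fn_smul (c : ℝ) (φ : D1 q) : (c • φ).fn =ᵐ[volume] fun x => c * φ.fn x := by
  rw [fn, map_smul]
  exact Lp.coeFn_smul _ _

theorem grad_add (φ ψ : D1 q) : (φ + ψ).grad =ᵐ[volume] fun x => φ.grad x + ψ.grad x := by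
  rw [grad, map_add]
  exact Lp.coeFn_add _ _

theorem grad_sub (φ ψ : D1 q) : (φ - ψ).grad =ᵐ[volume] fun x => φ.grad x - ψ.grad x := by
  rw [grad, map_sub]
  exact Lp.coeFn_sub _ _

theorem grad_smul (c : ℝ) (φ : D1 q) : (c • φ).grad =ᵐ[volume] fun x => c • φ.grad x := by
  rw [grad, map_smul]
  exact Lp.coeFn_smul _ _

theorem norm_eq (φ : D1 q) : ‖φ‖ = ‖gradLM q φ‖ := rfl

theorem norm_rpow (φ : D1 q) : ‖φ‖ ^ q = ∫ x, ‖φ.grad x‖ ^ q := by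
  have := h1q.out
  rw [norm_eq, Lp_norm_rpow (by linarith)]
  rfl

theorem integrable_grad_rpow (φ : D1 q) : Integrable fun x => ‖φ.grad x‖ ^ q :=
  φ.memLp_grad.integrable_rpow (zero_lt_one.trans h1q.out)

theorem exists_norm_fnLM_le (q : ℝ) [Fact (1 < q)] [Fact (q < 3)] :
    ∃ C, 0 < C ∧ ∀ φ : D1 q, ‖fnLM q φ‖ ≤ C * ‖φ‖ := by
  obtain ⟨C, hC⟩ := exists_norm_fst_le_norm_snd q
  refine ⟨max C 1, by positivity, fun φ => (hC φ.1 φ.2).trans ?_⟩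
  exact mul_le_mul_of_nonneg_right (le_max_left _ _) (norm_nonneg _)

/-- The continuous inclusion of `D^{1,q}` in `L^{q*}`. -/
def fnL (q : ℝ) [Fact (1 < q)] [Fact (q < 3)] :
    D1 q →L[ℝ] Lp ℝ (ENNReal.ofReal (sobolevExp q)) (volume : Measure E3) :=
  LinearMap.mkContinuous (fnLM q) (exists_norm_fnLM_le q).choose
    (exists_norm_fnLM_le q).choose_spec.2

/-- The gradient as a linear isometry. -/
def gradLI (q : ℝ) [Fact (1 < q)] [Fact (q < 3)] :
    D1 q →ₗᵢ[ℝ] Lp E3 (ENNReal.ofReal q) (volume : Measure E3) where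
  toLinearMap := gradLM q
  norm_map' _ := rfl

theorem exists_integral_fn_rpow_le (q : ℝ) [Fact (1 < q)] [Fact (q < 3)] : ∃ C, 0 < C ∧
    ∀ φ : D1 q, (∫ x, |φ.fn x| ^ sobolevExp q) ^ (1 / sobolevExp q) ≤ C * ‖φ‖ := by
  obtain ⟨C, hC, h⟩ := exists_norm_fnLM_le q
  refine ⟨C, hC, fun φ => ?_⟩
  have := h φ
  rwa [Lp_norm_eq (sobolevExp_pos q)] at this

/-- The norm sees only the gradient; the Sobolev inequality recovers convergence of the functions in
L^{q*}. -/
theorem tendsto_iff {a : ℕ → D1 q} {φ : D1 q} : Tendsto a atTop (𝓝 φ) ↔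
    Tendsto (fun n => (a n).1) atTop (𝓝 φ.1) := by
  constructor
  · intro h
    exact Tendsto.prodMk_nhds (((fnL q).continuous.tendsto φ).comp h)
      (((gradLI q).continuous.tendsto φ).comp h)
  · intro h
    exact (gradLI q).isometry.isEmbedding.tendsto_nhds_iff.2 ((continuous_snd.tendsto _).comp h)

instance : CompleteSpace (D1 q) := by
  apply Metric.complete_of_cauchySeq_tendsto
  intro a ha
  have h1 : CauchySeq fun n => (a n).1.1 :=
    (fnL q).uniformContinuous.comp_cauchySeq ha
  have h2 : CauchySeq fun n => (a n).1.2 :=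
    (gradLI q).isometry.uniformContinuous.comp_cauchySeq ha
  obtain ⟨f, hf⟩ := cauchySeq_tendsto_of_complete h1
  obtain ⟨g, hg⟩ := cauchySeq_tendsto_of_complete h2
  have hfg : Tendsto (fun n => (a n).1) atTop (𝓝 (f, g)) := hf.prodMk_nhds hg
  have hmem : (f, g) ∈ D1Submodule q :=
    (testPairs q).isClosed_topologicalClosure.mem_of_tendsto hfg
      (Eventually.of_forall fun n => (a n).2)
  exact ⟨⟨(f, g), hmem⟩, tendsto_iff.2 hfg⟩

/-- The element of `D^{1,q}` defined by a test function. -/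
def ofTest {ψ : E3 → ℝ} (hψ : IsTest ψ) : D1 q :=
  ⟨((hψ.memLp _).toLp ψ, (hψ.memLp_gradient _).toLp (gradient ψ)),
    Submodule.le_topologicalClosure _ ⟨ψ, hψ, (hψ.memLp _).coeFn_toLp,
      (hψ.memLp_gradient _).coeFn_toLp⟩⟩

theorem fn_ofTest {ψ : E3 → ℝ} (hψ : IsTest ψ) : (ofTest hψ : D1 q).fn =ᵐ[volume] ψ :=
  (hψ.memLp _).coeFn_toLp

theorem grad_ofTest {ψ : E3 → ℝ} (hψ : IsTest ψ) :
    (ofTest hψ : D1 q).grad =ᵐ[volume] gradient ψ :=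
  (hψ.memLp_gradient _).coeFn_toLp

theorem exists_seq_test (φ : D1 q) : ∃ (ψ : ℕ → E3 → ℝ) (hψ : ∀ n, IsTest (ψ n)),
    Tendsto (fun n => ofTest (hψ n)) atTop (𝓝 φ) := by
  obtain ⟨P, hP, hlim⟩ := mem_closure_iff_seq_limit.1
    (show φ.1 ∈ closure ((testPairs q : Submodule ℝ _) : Set _) from φ.2)
  choose ψ hψ h1 h2 using hP
  refine ⟨ψ, hψ, tendsto_iff.2 ?_⟩
  convert! hlim using 2 with n
  exact Prod.ext (Lp.ext ((fn_ofTest (hψ n)).trans (h1 n).symm))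
    (Lp.ext ((grad_ofTest (hψ n)).trans (h2 n).symm))

theorem tendsto_eLpNorm_of_test {ψ : ℕ → E3 → ℝ} {hψ : ∀ n, IsTest (ψ n)} {φ : D1 q}
    (h : Tendsto (fun n => ofTest (hψ n)) atTop (𝓝 φ)) :
    Tendsto (fun n => eLpNorm (ψ n - φ.fn) (ENNReal.ofReal (sobolevExp q))) atTop (𝓝 0) ∧
    Tendsto (fun n => eLpNorm (gradient (ψ n) - φ.grad) (ENNReal.ofReal q)) atTop (𝓝 0) := by
  constructor
  · refine ((Lp.tendsto_Lp_iff_tendsto_eLpNorm' _ _).1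
      (((fnL q).continuous.tendsto φ).comp h)).congr fun n => eLpNorm_congr_ae ?_
    exact (fn_ofTest (hψ n)).sub (EventuallyEq.refl _ _)
  · refine ((Lp.tendsto_Lp_iff_tendsto_eLpNorm' _ _).1
      (((gradLI q).continuous.tendsto φ).comp h)).congr fun n => eLpNorm_congr_ae ?_
    exact (grad_ofTest (hψ n)).sub (EventuallyEq.refl _ _)

/-- The means of constructing elements of D^{1,q}: apply the operation, here a dilation or a cutoff,
to approximating test functions and pass to the limit in both components. -/
theorem exists_of_tendsto {f : E3 → ℝ} {g : E3 → E3}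
    (hf : MemLp f (ENNReal.ofReal (sobolevExp q))) (hg : MemLp g (ENNReal.ofReal q))
    {ψ : ℕ → E3 → ℝ} (hψ : ∀ n, IsTest (ψ n))
    (h1 : Tendsto (fun n => eLpNorm (ψ n - f) (ENNReal.ofReal (sobolevExp q))) atTop (𝓝 0))
    (h2 : Tendsto (fun n => eLpNorm (gradient (ψ n) - g) (ENNReal.ofReal q)) atTop (𝓝 0)) :
    ∃ φ : D1 q, φ.fn =ᵐ[volume] f ∧ φ.grad =ᵐ[volume] g := by
  have k1 := (Lp.tendsto_Lp_iff_tendsto_eLpNorm'' ψ (fun n => (hψ n).memLp _) f hf).2 h1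
  have k2 := (Lp.tendsto_Lp_iff_tendsto_eLpNorm'' (fun n => gradient (ψ n))
    (fun n => (hψ n).memLp_gradient _) g hg).2 h2
  have hmem : (hf.toLp f, hg.toLp g) ∈ D1Submodule q :=
    (testPairs q).isClosed_topologicalClosure.mem_of_tendsto (k1.prodMk_nhds k2)
      (Eventually.of_forall fun n => (ofTest (hψ n) : D1 q).2)
  exact ⟨⟨_, hmem⟩, hf.coeFn_toLp, hg.coeFn_toLp⟩

/-! ### The `q`-Laplacian as a duality map -/

theorem memLp_duality_grad (φ : D1 q) :
    MemLp (fun x => duality q (φ.grad x)) (ENNReal.ofReal (q / (q - 1))) := by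
  have hq := h1q.out
  have hm : AEStronglyMeasurable (fun x => duality q (φ.grad x)) volume :=
    (continuous_duality hq).comp_aestronglyMeasurable φ.memLp_grad.1
  rw [memLp_ofReal_iff (div_pos (by linarith) (by linarith)) hm]
  refine φ.integrable_grad_rpow.congr (Eventually.of_forall fun x => ?_)
  have : q - 1 ≠ 0 := by linarith
  simp only [norm_duality hq]
  rw [← Real.rpow_mul (norm_nonneg _), mul_div_cancel₀ _ this]

theorem integrable_form (φ v : D1 q) :
    Integrable fun x => inner ℝ (duality q (φ.grad x)) (v.grad x) :=
  integrable_inner_of_memLp holderConjugate_conjExponent.symm φ.memLp_duality_grad v.memLp_grad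

/-- The form `∫ |∇φ|^{q-2} ∇φ · ∇v`. -/
def form (φ v : D1 q) : ℝ := ∫ x, inner ℝ (duality q (φ.grad x)) (v.grad x)

theorem form_eq (φ v : D1 q) :
    form φ v = ∫ x, ‖φ.grad x‖ ^ (q - 2) * inner ℝ (φ.grad x) (v.grad x) := by
  simp only [form, duality, real_inner_smul_left]

theorem form_self (φ : D1 q) : form φ φ = ‖φ‖ ^ q := by
  rw [form, norm_rpow]
  simp only [inner_duality_self h1q.out]

theorem exists_norm_sub_rpow_le_excess {ε : ℝ} (hε : 0 < ε) :
    ∃ C, 0 ≤ C ∧ ∀ φ ψ : D1 q, ‖φ - ψ‖ ^ q ≤ ε * (‖φ‖ ^ q + ‖ψ‖ ^ q) +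
      C * (1 / 2 * ‖φ‖ ^ q + 1 / 2 * ‖ψ‖ ^ q - ‖(1 / 2 : ℝ) • (φ + ψ)‖ ^ q) := by
  obtain ⟨C, hC, h⟩ := QSP.exists_norm_sub_rpow_le_excess (E := E3) h1q.out hε
  refine ⟨C, hC, fun φ ψ => ?_⟩
  simp only [norm_rpow]
  have i1 := φ.integrable_grad_rpow
  have i2 := ψ.integrable_grad_rpow
  have i3 := ((1 / 2 : ℝ) • (φ + ψ)).integrable_grad_rpow
  have j1 : Integrable fun x => ε * (‖φ.grad x‖ ^ q + ‖ψ.grad x‖ ^ q) :=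
    (i1.add i2).const_mul ε
  have j2 : Integrable fun x => 1 / 2 * ‖φ.grad x‖ ^ q + 1 / 2 * ‖ψ.grad x‖ ^ q :=
    (i1.const_mul _).add (i2.const_mul _)
  have j3 : Integrable fun x => C * (1 / 2 * ‖φ.grad x‖ ^ q + 1 / 2 * ‖ψ.grad x‖ ^ q -
      ‖((1 / 2 : ℝ) • (φ + ψ)).grad x‖ ^ q) := (j2.sub i3).const_mul C
  rw [← integral_add i1 i2, ← integral_const_mul, ← integral_const_mul (1 / 2 : ℝ),
    ← integral_const_mul (1 / 2 : ℝ), ← integral_add (i1.const_mul _) (i2.const_mul _),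
    ← integral_sub j2 i3, ← integral_const_mul, ← integral_add j1 j3]
  refine integral_mono_ae (φ - ψ).integrable_grad_rpow (j1.add j3) ?_
  filter_upwards [grad_sub φ ψ, grad_smul (1 / 2 : ℝ) (φ + ψ), grad_add φ ψ] with x e1 e2 e3
  rw [e1, e2, e3]
  exact h _ _

theorem exists_norm_sub_rpow_le_form {ε : ℝ} (hε : 0 < ε) :
    ∃ C, 0 ≤ C ∧ ∀ φ ψ : D1 q, ‖φ - ψ‖ ^ q ≤ ε * (‖φ‖ ^ q + ‖ψ‖ ^ q) +
      C * (form φ (φ - ψ) - form ψ (φ - ψ)) := by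
  obtain ⟨C, hC, h⟩ := QSP.exists_norm_sub_rpow_le_inner (E := E3) h1q.out hε
  refine ⟨C, hC, fun φ ψ => ?_⟩
  simp only [norm_rpow, form]
  have i1 := φ.integrable_grad_rpow
  have i2 := ψ.integrable_grad_rpow
  have i3 := integrable_form φ (φ - ψ)
  have i4 := integrable_form ψ (φ - ψ)
  have j1 : Integrable fun x => ε * (‖φ.grad x‖ ^ q + ‖ψ.grad x‖ ^ q) :=
    (i1.add i2).const_mul ε
  have j2 : Integrable fun x => C * (inner ℝ (duality q (φ.grad x)) ((φ - ψ).grad x) -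
      inner ℝ (duality q (ψ.grad x)) ((φ - ψ).grad x)) := (i3.sub i4).const_mul C
  rw [← integral_add i1 i2, ← integral_const_mul, ← integral_sub i3 i4, ← integral_const_mul,
    ← integral_add j1 j2]
  refine integral_mono_ae (φ - ψ).integrable_grad_rpow (j1.add j2) ?_
  filter_upwards [grad_sub φ ψ] with x e1
  rw [e1, ← inner_sub_left]
  exact h _ _

theorem norm_rpow_add_form_le (φ ψ : D1 q) : ‖φ‖ ^ q + q * form φ (ψ - φ) ≤ ‖ψ‖ ^ q := by
  have i1 := φ.integrable_grad_rpow
  have i3 := integrable_form φ (ψ - φ)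
  simp only [norm_rpow, form]
  rw [← integral_const_mul, ← integral_add i1 (i3.const_mul q)]
  refine integral_mono_ae (i1.add (i3.const_mul q)) ψ.integrable_grad_rpow ?_
  filter_upwards [grad_sub ψ φ] with x e1
  rw [e1]
  exact norm_rpow_add_le h1q.out _ _

/-- The monotonicity term vanishes, so ‖φ - ψ‖^q is at most ε times a fixed number for every ε > 0.
-/
theorem eq_of_form_eq {φ ψ : D1 q} (h : ∀ v, form φ v = form ψ v) : φ = ψ := by
  have hq := h1q.out
  have key : ∀ ε : ℝ, 0 < ε → ‖φ - ψ‖ ^ q ≤ ε * (‖φ‖ ^ q + ‖ψ‖ ^ q) := fun ε hε => by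
    obtain ⟨C, -, hC⟩ := exists_norm_sub_rpow_le_form (q := q) hε
    have := hC φ ψ
    rwa [h, sub_self, mul_zero, add_zero] at this
  have h0 : ‖φ - ψ‖ ^ q ≤ 0 := by
    refine le_of_forall_pos_le_add fun ε hε => ?_
    have hB : 0 < ‖φ‖ ^ q + ‖ψ‖ ^ q + 1 := by positivity
    refine (key (ε / (‖φ‖ ^ q + ‖ψ‖ ^ q + 1)) (by positivity)).trans ?_
    rw [zero_add, div_mul_eq_mul_div, div_le_iff₀ hB]
    nlinarith
  have h1 : ‖φ - ψ‖ ^ q = 0 := le_antisymm h0 (by positivity)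
  rw [Real.rpow_eq_zero (norm_nonneg _) (by linarith), norm_eq_zero, sub_eq_zero] at h1
  exact h1

/-- The energy `(1/q) ‖φ‖^q - ℓ φ`. -/
def energy (ℓ : StrongDual ℝ (D1 q)) (φ : D1 q) : ℝ := 1 / q * ‖φ‖ ^ q - ℓ φ

theorem exists_energy_coercive (ℓ : StrongDual ℝ (D1 q)) :
    ∃ K, ∀ φ : D1 q, 1 / (2 * q) * ‖φ‖ ^ q - K ≤ energy ℓ φ := by
  have hq := h1q.out
  have hq0 : 0 < q := by linarith
  -- Beyond this threshold ‖ℓ‖ ≤ ‖φ‖^{q-1}/(2q), so half of the leading term absorbs the linear one.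
  set X : ℝ := (2 * q * ‖ℓ‖) ^ (1 / (q - 1)) with hX
  have hX0 : 0 ≤ X := by positivity
  refine ⟨‖ℓ‖ * X, fun φ => ?_⟩
  have h1 : ℓ φ ≤ ‖ℓ‖ * ‖φ‖ := (le_abs_self _).trans (ℓ.le_opNorm φ)
  suffices h2 : ‖ℓ‖ * ‖φ‖ ≤ 1 / (2 * q) * ‖φ‖ ^ q + ‖ℓ‖ * X by
    have e : 1 / q * ‖φ‖ ^ q = 2 * (1 / (2 * q) * ‖φ‖ ^ q) := by field_simp
    rw [energy, e]
    linarith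
  have hn : 0 ≤ 1 / (2 * q) * ‖φ‖ ^ q := by positivity
  rcases le_total ‖φ‖ X with h | h
  · have := mul_le_mul_of_nonneg_left h (norm_nonneg ℓ)
    linarith
  · have h3 : X ^ (q - 1) ≤ ‖φ‖ ^ (q - 1) := Real.rpow_le_rpow hX0 h (by linarith)
    rw [hX, ← Real.rpow_mul (by positivity), one_div_mul_cancel (by linarith), Real.rpow_one] at h3
    have h4 : ‖φ‖ ^ q = ‖φ‖ ^ (q - 1) * ‖φ‖ := by
      rcases (norm_nonneg φ).eq_or_lt with h0 | h0
      · rw [← h0, Real.zero_rpow hq0.ne', mul_zero]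
      · rw [← Real.rpow_add_one h0.ne', sub_add_cancel]
    have h5 := mul_le_mul_of_nonneg_right h3 (norm_nonneg φ)
    rw [← h4] at h5
    have h6 : ‖ℓ‖ * ‖φ‖ ≤ 1 / (2 * q) * ‖φ‖ ^ q := by
      rw [div_mul_eq_mul_div, le_div_iff₀ (by positivity)]
      linarith
    have : 0 ≤ ‖ℓ‖ * X := by positivity
    linarith

/-- Almost minimizers of the energy are close to each other. -/
theorem norm_sub_rpow_le_of_energy_le {ℓ : StrongDual ℝ (D1 q)} {m : ℝ}
    (hm : ∀ φ, m ≤ energy ℓ φ) {η : ℝ} (hη : 0 < η) :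
    ∃ δ, 0 < δ ∧ ∀ φ ψ, energy ℓ φ ≤ m + δ → energy ℓ ψ ≤ m + δ → ‖φ - ψ‖ ^ q ≤ η := by
  have hq := h1q.out
  have hq0 : 0 < q := by linarith
  obtain ⟨K, hK⟩ := exists_energy_coercive ℓ
  set B : ℝ := 2 * q * (|m + 1 + K| + 1)
  have hB : 0 < B := by positivity
  have hbd (φ : D1 q) (h : energy ℓ φ ≤ m + 1) : ‖φ‖ ^ q ≤ B := by
    have h1 := (hK φ).trans h
    have h2 : 1 / (2 * q) * ‖φ‖ ^ q ≤ |m + 1 + K| + 1 := by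
      linarith [le_abs_self (m + 1 + K)]
    rw [div_mul_eq_mul_div, one_mul, div_le_iff₀ (by positivity)] at h2
    linarith
  obtain ⟨C, hC, hex⟩ := exists_norm_sub_rpow_le_excess (q := q) (ε := η / (4 * B)) (by positivity)
  -- The entry 1 keeps both functions in the set where ‖·‖^q ≤ B. The other makes C q δ ≤ η/2, and
  -- the choice ε = η/(4B) accounts for the remaining η/2.
  refine ⟨min 1 (η / (2 * q * (C + 1))), by positivity, fun φ ψ h1 h2 => ?_⟩
  set δ := min 1 (η / (2 * q * (C + 1)))
  have hδ1 : δ ≤ 1 := min_le_left _ _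
  have hδ2 : δ ≤ η / (2 * q * (C + 1)) := min_le_right _ _
  have b1 := hbd φ (by linarith)
  have b2 := hbd ψ (by linarith)
  -- The energy of the midpoint is at least `m`. The linear terms cancel, so the convexity defect is
  -- at most q δ.
  have h3 := hm ((1 / 2 : ℝ) • (φ + ψ))
  rw [energy] at h1 h2 h3
  rw [map_smul, map_add, smul_eq_mul] at h3
  have h4 : 1 / 2 * ‖φ‖ ^ q + 1 / 2 * ‖ψ‖ ^ q - ‖(1 / 2 : ℝ) • (φ + ψ)‖ ^ q ≤ q * δ := by
    have h5 : 1 / q * (1 / 2 * ‖φ‖ ^ q + 1 / 2 * ‖ψ‖ ^ q - ‖(1 / 2 : ℝ) • (φ + ψ)‖ ^ q) ≤ δ := by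
      linarith
    rw [div_mul_eq_mul_div, one_mul, div_le_iff₀ hq0] at h5
    linarith
  calc ‖φ - ψ‖ ^ q ≤ _ := hex φ ψ
    _ ≤ η / (4 * B) * (B + B) + C * (q * (η / (2 * q * (C + 1)))) := by
        gcongr
        exact h4.trans (by gcongr)
    _ = η / 2 + η / 2 * (C / (C + 1)) := by field_simp; ring
    _ ≤ η / 2 + η / 2 * 1 := by
        gcongr
        rw [div_le_one (by positivity)]
        linarith
    _ = η := by ring

theorem continuous_energy (ℓ : StrongDual ℝ (D1 q)) : Continuous (energy ℓ) :=
  ((continuous_norm.rpow_const fun _ => Or.inr (zero_le_one.trans h1q.out.le)).const_mul _).sub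
    ℓ.continuous

/-- A minimizing sequence is Cauchy, hence converges in norm; neither reflexivity nor weak
compactness is needed. -/
theorem exists_energy_min (ℓ : StrongDual ℝ (D1 q)) : ∃ φ, ∀ ψ, energy ℓ φ ≤ energy ℓ ψ := by
  have hq0 : 0 < q := zero_lt_one.trans h1q.out
  obtain ⟨K, hK⟩ := exists_energy_coercive ℓ
  have hbdd : BddBelow (Set.range (energy ℓ)) := ⟨-K, by
    rintro _ ⟨φ, rfl⟩
    refine le_trans ?_ (hK φ)
    have : 0 ≤ 1 / (2 * q) * ‖φ‖ ^ q := by positivity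
    linarith⟩
  set m := ⨅ φ, energy ℓ φ
  have hm (φ : D1 q) : m ≤ energy ℓ φ := ciInf_le hbdd φ
  have hseq (n : ℕ) : ∃ φ, energy ℓ φ < m + 1 / (n + 1) :=
    exists_lt_of_ciInf_lt (by
      have : (0 : ℝ) < 1 / (n + 1) := by positivity
      linarith)
  choose a ha using hseq
  have hlim : Tendsto (fun n : ℕ => m + 1 / ((n : ℝ) + 1)) atTop (𝓝 m) := by
    simpa using (tendsto_one_div_add_atTop_nhds_zero_nat (𝕜 := ℝ)).const_add m
  have hc : CauchySeq a := by
    rw [Metric.cauchySeq_iff]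
    intro η hη
    obtain ⟨δ, hδ, H⟩ := norm_sub_rpow_le_of_energy_le hm (η := (η / 2) ^ q) (by positivity)
    obtain ⟨N, hN⟩ := eventually_atTop.1 ((tendsto_order.1 hlim).2 (m + δ) (by linarith))
    refine ⟨N, fun i hi j hj => ?_⟩
    have := H (a i) (a j) ((ha i).trans (hN i hi)).le ((ha j).trans (hN j hj)).le
    rw [Real.rpow_le_rpow_iff (norm_nonneg _) (by positivity) hq0] at this
    rw [dist_eq_norm]
    linarith
  obtain ⟨φ, hφ⟩ := cauchySeq_tendsto_of_complete hc
  refine ⟨φ, fun ψ => le_trans ?_ (hm ψ)⟩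
  exact le_of_tendsto_of_tendsto (((continuous_energy ℓ).tendsto φ).comp hφ) hlim
    (Eventually.of_forall fun n => (ha n).le)

theorem hasDerivAt_norm_rpow_line (φ v : D1 q) :
    HasDerivAt (fun t : ℝ => ‖φ + t • v‖ ^ q) (q * form φ v) 0 := by
  have hq := h1q.out
  have hq0 : 0 < q := by linarith
  have e (t : ℝ) : ‖φ + t • v‖ ^ q = ∫ x, ‖φ.grad x + t • v.grad x‖ ^ q := by
    rw [norm_rpow]
    refine integral_congr_ae ?_
    filter_upwards [grad_add φ (t • v), grad_smul t v] with x h1 h2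
    rw [h1, h2]
  simp_rw [e]
  have hd (a b : E3) (t : ℝ) : HasDerivAt (fun t : ℝ => ‖a + t • b‖ ^ q)
      (q * inner ℝ (duality q (a + t • b)) b) t := by
    have h1 : HasDerivAt (fun τ : ℝ => a + τ • b) b t := by
      simpa using ((hasDerivAt_id t).smul_const b).const_add a
    have h2 := (hasFDerivAt_norm_rpow (a + t • b) hq).comp_hasDerivAt t h1
    have e3 : q * inner ℝ (duality q (a + t • b)) b =
        ((q * ‖a + t • b‖ ^ (q - 2)) • innerSL ℝ (a + t • b)) b := by
      rw [duality, real_inner_smul_left, smul_apply, innerSL_apply_apply, smul_eq_mul]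
      ring
    rw [e3]
    exact h2
  have hmeas (t : ℝ) : AEStronglyMeasurable (fun x => φ.grad x + t • v.grad x) volume :=
    φ.memLp_grad.1.add (v.memLp_grad.1.const_smul t)
  -- Differentiation under the integral for |t| < 1, where the derivative is dominated by q(|∇φ| +
  -- |∇v|)^q.
  have key := hasDerivAt_integral_of_dominated_loc_of_deriv_le (μ := (volume : Measure E3))
    (F := fun (t : ℝ) x => ‖φ.grad x + t • v.grad x‖ ^ q) (x₀ := (0 : ℝ))
    (F' := fun t x => q * inner ℝ (duality q (φ.grad x + t • v.grad x)) (v.grad x))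
    (bound := fun x => q * (2 ^ q * (‖φ.grad x‖ ^ q + ‖v.grad x‖ ^ q)))
    (s := Metric.ball 0 1) (Metric.ball_mem_nhds 0 one_pos)
    (Eventually.of_forall fun t => ((hmeas t).norm.aemeasurable.pow_const q).aestronglyMeasurable)
    (by simpa using φ.integrable_grad_rpow)
    (((continuous_duality hq).comp_aestronglyMeasurable (hmeas 0)).inner
      v.memLp_grad.1 |>.const_mul q)
    (Eventually.of_forall fun x t ht => ?_)
    (((φ.integrable_grad_rpow.add v.integrable_grad_rpow).const_mul _).const_mul _)
    (Eventually.of_forall fun x t _ => hd _ _ t)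
  · simpa [form, integral_const_mul] using key.2
  · rw [norm_mul, Real.norm_of_nonneg hq0.le]
    gcongr
    refine (norm_inner_le_norm _ _).trans ?_
    rw [norm_duality hq]
    refine le_trans ?_ (add_rpow_le (norm_nonneg _) (norm_nonneg _) hq0.le)
    have h1 : ‖φ.grad x + t • v.grad x‖ ≤ ‖φ.grad x‖ + ‖v.grad x‖ := by
      refine (norm_add_le _ _).trans ?_
      gcongr
      rw [norm_smul]
      rw [mem_ball_zero_iff] at ht
      exact mul_le_of_le_one_left (norm_nonneg _) ht.le
    have h2 : ‖v.grad x‖ ≤ ‖φ.grad x‖ + ‖v.grad x‖ := by linarith [norm_nonneg (φ.grad x)]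
    rcases (add_nonneg (norm_nonneg (φ.grad x)) (norm_nonneg (v.grad x))).eq_or_lt with h0 | h0
    · rw [← h0] at h2 ⊢
      have : ‖v.grad x‖ = 0 := le_antisymm h2 (norm_nonneg _)
      rw [this, mul_zero]
      positivity
    · calc _ ≤ (‖φ.grad x‖ + ‖v.grad x‖) ^ (q - 1) * (‖φ.grad x‖ + ‖v.grad x‖) := by
            gcongr
        _ = _ := by rw [← Real.rpow_add_one h0.ne', sub_add_cancel]

/-- The Euler–Lagrange equation: the energy along a line is differentiable with a minimum at 0. -/
theorem form_eq_of_energy_min {ℓ : StrongDual ℝ (D1 q)} {φ : D1 q}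
    (h : ∀ ψ, energy ℓ φ ≤ energy ℓ ψ) (v : D1 q) : form φ v = ℓ v := by
  have hq0 : 0 < q := zero_lt_one.trans h1q.out
  have hd : HasDerivAt (fun t : ℝ => energy ℓ (φ + t • v)) (1 / q * (q * form φ v) - ℓ v) 0 := by
    have h1 := (hasDerivAt_norm_rpow_line φ v).const_mul (1 / q)
    have h2 : HasDerivAt (fun t : ℝ => ℓ (φ + t • v)) (ℓ v) 0 := by
      simp only [map_add, map_smul, smul_eq_mul]
      simpa using ((hasDerivAt_id (0 : ℝ)).mul_const (ℓ v)).const_add (ℓ φ)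
    exact h1.sub h2
  have hmin : IsLocalMin (fun t : ℝ => energy ℓ (φ + t • v)) 0 :=
    Eventually.of_forall fun t => by simpa using h (φ + t • v)
  have := hmin.hasDerivAt_eq_zero hd
  rw [← mul_assoc, one_div_mul_cancel hq0.ne', one_mul] at this
  linarith

/-- Every functional on `D^{1,q}` is represented by the `q`-Laplacian. -/
theorem exists_form_eq (ℓ : StrongDual ℝ (D1 q)) : ∃ φ : D1 q, ∀ v, form φ v = ℓ v := by
  obtain ⟨φ, hφ⟩ := exists_energy_min ℓ
  exact ⟨φ, form_eq_of_energy_min hφ⟩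

/-- By convexity the energy lies above its linearization at φ, which is constant when the equation
holds. -/
theorem energy_le_of_form_eq {ℓ : StrongDual ℝ (D1 q)} {φ : D1 q} (h : ∀ v, form φ v = ℓ v)
    (ψ : D1 q) : energy ℓ φ ≤ energy ℓ ψ := by
  have hq0 : 0 < q := zero_lt_one.trans h1q.out
  have h1 := norm_rpow_add_form_le φ ψ
  rw [h, map_sub] at h1
  have h2 := mul_le_mul_of_nonneg_left h1 (one_div_nonneg.2 hq0.le)
  have e : 1 / q * (‖φ‖ ^ q + q * (ℓ ψ - ℓ φ)) = 1 / q * ‖φ‖ ^ q + (ℓ ψ - ℓ φ) := by field_simp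
  rw [e] at h2
  rw [energy, energy]
  linarith

end D1

end HomogeneousSobolev

/-! ### Nonnegativity of solutions -/

section Positivity

/-- A smooth approximation of the absolute value that vanishes at the origin. -/
def smoothAbs (δ t : ℝ) : ℝ := √(t ^ 2 + δ ^ 2) - δ

theorem smoothAbs_nonneg (δ t : ℝ) : 0 ≤ smoothAbs δ t := by
  rw [smoothAbs, sub_nonneg]
  exact Real.le_sqrt_of_sq_le (by nlinarith [sq_nonneg t])

theorem sub_le_smoothAbs (δ t : ℝ) : t - δ ≤ smoothAbs δ t := by
  rw [smoothAbs]
  gcongr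
  exact Real.le_sqrt_of_sq_le (by nlinarith [sq_nonneg δ])

theorem smoothAbs_zero {δ : ℝ} (hδ : 0 < δ) : smoothAbs δ 0 = 0 := by
  simp [smoothAbs, Real.sqrt_sq hδ.le]

theorem contDiff_smoothAbs {δ : ℝ} (hδ : 0 < δ) : ContDiff ℝ ∞ (smoothAbs δ) :=
  (((contDiff_id.pow 2).add contDiff_const).sqrt fun t => by
    simp only [id]
    positivity).sub contDiff_const

theorem abs_deriv_smoothAbs_le {δ : ℝ} (hδ : 0 < δ) (t : ℝ) : |deriv (smoothAbs δ) t| ≤ 1 := by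
  have hpos : 0 < t ^ 2 + δ ^ 2 := by positivity
  have h1 : HasDerivAt (fun t : ℝ => t ^ 2 + δ ^ 2) (2 * t) t := by
    simpa using (hasDerivAt_pow 2 t).add_const (δ ^ 2)
  have h2 : HasDerivAt (smoothAbs δ) (2 * t / (2 * √(t ^ 2 + δ ^ 2))) t :=
    (h1.sqrt hpos.ne').sub_const δ
  rw [h2.deriv, mul_div_mul_left _ _ two_ne_zero, abs_div, abs_of_nonneg (Real.sqrt_nonneg _),
    div_le_one (Real.sqrt_pos.2 hpos)]
  exact Real.le_sqrt_of_sq_le (by rw [sq_abs]; nlinarith [sq_nonneg δ])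

theorem IsTest.smoothAbs {ψ : E3 → ℝ} (hψ : IsTest ψ) {δ : ℝ} (hδ : 0 < δ) :
    IsTest fun x => smoothAbs δ (ψ x) :=
  ⟨(contDiff_smoothAbs hδ).comp hψ.1, hψ.2.comp_left (smoothAbs_zero hδ)⟩

theorem IsTest.norm_gradient_smoothAbs_le {ψ : E3 → ℝ} (hψ : IsTest ψ) {δ : ℝ} (hδ : 0 < δ)
    (x : E3) : ‖gradient (fun x => QSP.smoothAbs δ (ψ x)) x‖ ≤ ‖gradient ψ x‖ := by
  have h1 : HasDerivAt (QSP.smoothAbs δ) (deriv (QSP.smoothAbs δ) (ψ x)) (ψ x) :=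
    ((contDiff_smoothAbs hδ).differentiable (by simp) _).hasDerivAt
  have h2 := h1.comp_hasFDerivAt x (hψ.differentiable x).hasFDerivAt
  rw [norm_gradient, norm_gradient]
  refine (congrArg norm h2.fderiv).le.trans ?_
  rw [norm_smul]
  exact mul_le_of_le_one_left (norm_nonneg _) (abs_deriv_smoothAbs_le hδ _)

variable {q : ℝ} [h1q : Fact (1 < q)] [h3q : Fact (q < 3)]

/-- The exponent conjugate to the Sobolev exponent. -/
def dualExp (q : ℝ) : ℝ := sobolevExp q / (sobolevExp q - 1)

theorem holderConjugate_dualExp (q : ℝ) [Fact (1 < q)] [Fact (q < 3)] :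
    (sobolevExp q).HolderConjugate (dualExp q) := holderConjugate_conjExponent

theorem dualExp_pos (q : ℝ) [Fact (1 < q)] [Fact (q < 3)] : 0 < dualExp q :=
  (holderConjugate_dualExp q).symm.pos

namespace D1

/-- The functional `v ↦ ∫ f v`. -/
def source {f : E3 → ℝ} (hf : MemLp f (ENNReal.ofReal (dualExp q))) : StrongDual ℝ (D1 q) :=
  (lpPairing (holderConjugate_dualExp q) hf).comp (fnL q)

theorem source_apply {f : E3 → ℝ} (hf : MemLp f (ENNReal.ofReal (dualExp q))) (v : D1 q) :
    source hf v = ∫ x, f x * v.fn x := rfl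

theorem integrable_source {f : E3 → ℝ} (hf : MemLp f (ENNReal.ofReal (dualExp q))) (v : D1 q) :
    Integrable fun x => f x * v.fn x :=
  integrable_mul_of_memLp (holderConjugate_dualExp q).symm hf v.memLp_fn

theorem exists_abs_source_le (q : ℝ) [Fact (1 < q)] [Fact (q < 3)] : ∃ K, 0 < K ∧
    ∀ (f : E3 → ℝ) (_ : MemLp f (ENNReal.ofReal (dualExp q))) (v : D1 q),
      |∫ x, f x * v.fn x| ≤ K * (∫ x, |f x| ^ dualExp q) ^ (1 / dualExp q) * ‖v‖ := by
  obtain ⟨K, hK, h⟩ := exists_integral_fn_rpow_le q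
  refine ⟨K, hK, fun f hf v => ?_⟩
  refine (abs_integral_mul_le (holderConjugate_dualExp q).symm hf v.memLp_fn).trans ?_
  have := mul_le_mul_of_nonneg_left (h v)
    (Real.rpow_nonneg (integral_rpow_nonneg (μ := volume) f (dualExp q)) (1 / dualExp q))
  refine this.trans (le_of_eq ?_)
  simp only [Real.norm_eq_abs]
  ring

theorem norm_ofTest_le {ψ χ : E3 → ℝ} (hψ : IsTest ψ) (hχ : IsTest χ)
    (h : ∀ x, ‖gradient χ x‖ ≤ ‖gradient ψ x‖) : ‖(ofTest hχ : D1 q)‖ ≤ ‖(ofTest hψ : D1 q)‖ := by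
  rw [norm_eq, norm_eq]
  refine Lp.norm_le_norm_of_ae_le ?_
  filter_upwards [grad_ofTest (q := q) hψ, grad_ofTest (q := q) hχ] with x h1 h2
  have h1' : gradLM q (ofTest hψ) x = gradient ψ x := h1
  have h2' : gradLM q (ofTest hχ) x = gradient χ x := h2
  rw [h1', h2']
  exact h x

/-- `smoothAbs δ ∘ ψ` remains a test function, does not increase the gradient, and is at least ψ -
δ. Since `f ≥ 0`, the linear term loses at most δ times the integral of `f` against a cutoff equal
to 1 on a ball outside which ψ vanishes. -/
theorem exists_nonneg_test_energy_le {f : E3 → ℝ} (hf : MemLp f (ENNReal.ofReal (dualExp q)))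
    (hf0 : ∀ x, 0 ≤ f x) {ψ : E3 → ℝ} (hψ : IsTest ψ) {η : ℝ} (hη : 0 < η) :
    ∃ (χ : E3 → ℝ) (hχ : IsTest χ), (∀ x, 0 ≤ χ x) ∧
      energy (source hf) (ofTest hχ) ≤ energy (source hf) (ofTest hψ) + η := by
  have hq0 : 0 < q := zero_lt_one.trans h1q.out
  obtain ⟨R, hR0, hR⟩ : ∃ R, 0 < R ∧ ∀ x, R < ‖x‖ → ψ x = 0 := by
    obtain ⟨R, hR⟩ := hψ.2.isCompact.isBounded.subset_closedBall (0 : E3)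
    refine ⟨max R 1, by positivity, fun x hx => ?_⟩
    by_contra h
    have := hR (subset_tsupport ψ h)
    rw [mem_closedBall_zero_iff] at this
    linarith [le_max_left R 1]
  have hcut := isTest_cutoff hR0
  have hI0 : 0 ≤ source hf (ofTest hcut) := by
    rw [source_apply]
    refine integral_nonneg_of_ae ?_
    filter_upwards [fn_ofTest (q := q) hcut] with x hx
    rw [hx]
    exact mul_nonneg (hf0 x) (cutoff_nonneg _ _)
  -- Makes the loss in the linear term at most η; the added 1 avoids division by zero.
  set δ : ℝ := η / (source hf (ofTest hcut) + 1) with hδ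
  have hδ0 : 0 < δ := by positivity
  refine ⟨_, hψ.smoothAbs hδ0, fun x => smoothAbs_nonneg _ _, ?_⟩
  have h1 : source hf (ofTest hψ) ≤
      source hf (ofTest (hψ.smoothAbs hδ0)) + δ * source hf (ofTest hcut) := by
    simp only [source_apply]
    rw [← integral_const_mul, ← integral_add (integrable_source hf _)
      ((integrable_source hf _).const_mul δ)]
    refine integral_mono_ae (integrable_source hf _)
      ((integrable_source hf _).add ((integrable_source hf _).const_mul δ)) ?_
    filter_upwards [fn_ofTest (q := q) hψ, fn_ofTest (q := q) hcut,
      fn_ofTest (q := q) (hψ.smoothAbs hδ0)] with x e1 e2 e3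
    rw [e1, e2, e3]
    have : ψ x ≤ QSP.smoothAbs δ (ψ x) + δ * cutoff R x := by
      rcases le_or_gt ‖x‖ R with h | h
      · rw [cutoff_eq_one hR0 h]
        linarith [sub_le_smoothAbs δ (ψ x)]
      · rw [hR x h]
        exact add_nonneg (smoothAbs_nonneg _ _) (mul_nonneg hδ0.le (cutoff_nonneg _ _))
    nlinarith [mul_le_mul_of_nonneg_left this (hf0 x)]
  have h2 : δ * source hf (ofTest hcut) ≤ η := by
    rw [hδ, div_mul_eq_mul_div, div_le_iff₀ (by positivity)]
    nlinarith
  have h3 : ‖(ofTest (hψ.smoothAbs hδ0) : D1 q)‖ ^ q ≤ ‖(ofTest hψ : D1 q)‖ ^ q :=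
    Real.rpow_le_rpow (norm_nonneg _)
      (norm_ofTest_le hψ _ (hψ.norm_gradient_smoothAbs_le hδ0)) hq0.le
  have h4 := mul_le_mul_of_nonneg_left h3 (one_div_nonneg.2 hq0.le)
  rw [energy, energy]
  linarith

/-- Solutions with a nonnegative right-hand side are nonnegative. -/
theorem fn_nonneg_of_form_eq {f : E3 → ℝ} (hf : MemLp f (ENNReal.ofReal (dualExp q)))
    (hf0 : ∀ x, 0 ≤ f x) {φ : D1 q} (h : ∀ v, form φ v = source hf v) :
    ∀ᵐ x, 0 ≤ φ.fn x := by
  have hq0 : 0 < q := zero_lt_one.trans h1q.out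
  have hmin := energy_le_of_form_eq h
  obtain ⟨ψ, hψ, hlim⟩ := exists_seq_test φ
  choose χ hχ hχ0 hχe using fun n : ℕ =>
    exists_nonneg_test_energy_le hf hf0 (hψ n) (η := 1 / ((n : ℝ) + 1)) (by positivity)
  have he : Tendsto (fun n : ℕ => energy (source hf) (ofTest (hψ n)) + 1 / ((n : ℝ) + 1)) atTop
      (𝓝 (energy (source hf) φ)) := by
    simpa using (((continuous_energy (source hf)).tendsto φ).comp hlim).add
      (tendsto_one_div_add_atTop_nhds_zero_nat (𝕜 := ℝ))
  -- The modified test functions are still almost minimizers, hence close to the minimizer φ.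
  have hconv : Tendsto (fun n => (ofTest (hχ n) : D1 q)) atTop (𝓝 φ) := by
    rw [Metric.tendsto_atTop]
    intro η hη
    obtain ⟨δ, hδ, H⟩ := norm_sub_rpow_le_of_energy_le hmin (η := (η / 2) ^ q) (by positivity)
    obtain ⟨N, hN⟩ := eventually_atTop.1 ((tendsto_order.1 he).2
      (energy (source hf) φ + δ) (by linarith))
    refine ⟨N, fun n hn => ?_⟩
    have := H (ofTest (hχ n)) φ ((hχe n).trans (hN n hn).le) (by linarith)
    rw [Real.rpow_le_rpow_iff (norm_nonneg _) (by positivity) hq0] at this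
    rw [dist_eq_norm]
    linarith
  -- The nonnegative cone of L^{q*} is closed.
  have hle : 0 ≤ fnL q φ := by
    refine ge_of_tendsto' (((fnL q).continuous.tendsto φ).comp hconv) fun n => ?_
    rw [← Lp.coeFn_nonneg]
    filter_upwards [fn_ofTest (q := q) (hχ n)] with x hx
    refine (hχ0 n x).trans (le_of_eq ?_)
    exact hx.symm
  rw [← Lp.coeFn_nonneg] at hle
  exact hle

end D1

end Positivity

/-! ### The solution operator: existence, energy, bound, strong continuity -/

section Solutions

variable {p q s : ℝ}

/-- The standing assumption on the exponents: `s (q*)'` lies strictly between `p` and `p*`. -/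
structure Admissible (p q s : ℝ) : Prop where
  lt_three : p < 3
  one_lt : 1 < s
  lt_exp : p < s * dualExp q
  exp_lt : s * dualExp q < sobolevExp p

theorem admissible_of_lt [Fact (1 < q)] [Fact (q < 3)] (hp : p < 3)
    (hs₁ : max 1 ((sobolevExp q - 1) * p / sobolevExp q) < s)
    (hs₂ : s < (sobolevExp q - 1) * sobolevExp p / sobolevExp q) : Admissible p q s := by
  have hQ := one_lt_sobolevExp q
  have hQ0 : 0 < sobolevExp q := by linarith
  have hQ1 : 0 < sobolevExp q - 1 := by linarith
  have h1 := (le_max_right _ _).trans_lt hs₁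
  rw [div_lt_iff₀ hQ0] at h1
  rw [lt_div_iff₀ hQ0] at hs₂
  refine ⟨hp, (le_max_left _ _).trans_lt hs₁, ?_, ?_⟩
  · rw [dualExp, ← mul_div_assoc, lt_div_iff₀ hQ1]
    linarith
  · rw [dualExp, ← mul_div_assoc, div_lt_iff₀ hQ1]
    linarith

variable [h1p : Fact (1 < p)]

theorem Admissible.exp_pos (h : Admissible p q s) : 0 < s * dualExp q :=
  (zero_lt_one.trans h1p.out).trans h.lt_exp

theorem abs_abs_rpow_rpow (a s m : ℝ) : |(|a| ^ s)| ^ m = |a| ^ (s * m) := by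
  rw [abs_of_nonneg (by positivity), ← Real.rpow_mul (abs_nonneg a)]

theorem W1.aestronglyMeasurable_abs_rpow (u : W1 p) (s : ℝ) :
    AEStronglyMeasurable (fun x => |u.fn x| ^ s) volume :=
  (u.memLp_fn.1.norm.aemeasurable.pow_const s).aestronglyMeasurable

theorem Admissible.exists_integral_rpow_le (h : Admissible p q s) : ∃ C, 0 < C ∧ ∀ u : W1 p,
    Integrable (fun x => |u.fn x| ^ (s * dualExp q)) ∧
      ∫ x, |u.fn x| ^ (s * dualExp q) ≤ C * ‖u‖ ^ (s * dualExp q) := by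
  obtain ⟨C, hC, H⟩ := W1.exists_integral_rpow_le h.lt_three h.lt_exp h.exp_lt
  exact ⟨C, hC, fun u => ⟨(H u).1.integrable_rpow h.exp_pos, (H u).2⟩⟩

theorem Admissible.integrable_rpow (h : Admissible p q s) (u : W1 p) :
    Integrable fun x => |u.fn x| ^ (s * dualExp q) := by
  obtain ⟨C, -, H⟩ := h.exists_integral_rpow_le
  exact (H u).1

variable [h1q : Fact (1 < q)] [h3q : Fact (q < 3)]

theorem Admissible.memLp (h : Admissible p q s) (u : W1 p) :
    MemLp (fun x => |u.fn x| ^ s) (ENNReal.ofReal (dualExp q)) := by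
  rw [memLp_ofReal_iff (dualExp_pos q) (u.aestronglyMeasurable_abs_rpow s)]
  simp only [Real.norm_eq_abs, abs_abs_rpow_rpow]
  exact h.integrable_rpow u

theorem Admissible.isSolution_iff (h : Admissible p q s) {u : W1 p} {φ : D1 q} :
    IsSolution s u φ ↔ ∀ v, D1.form φ v = D1.source (h.memLp u) v := by
  refine forall_congr' fun v => ?_
  rw [D1.form_eq, D1.source_apply]

theorem Admissible.existsUnique_solution (h : Admissible p q s) (u : W1 p) :
    ∃! φ : D1 q, IsSolution s u φ := by
  obtain ⟨φ, hφ⟩ := D1.exists_form_eq (D1.source (q := q) (h.memLp u))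
  refine ⟨φ, h.isSolution_iff.2 hφ, fun ψ hψ => D1.eq_of_form_eq fun v => ?_⟩
  rw [hφ, h.isSolution_iff.1 hψ]

theorem Admissible.integrable_energyDensity (h : Admissible p q s) (u : W1 p) (φ : D1 q) :
    Integrable (energyDensity s u φ) :=
  (φ.integrable_grad_rpow.const_mul (1 / q)).sub (D1.integrable_source (h.memLp u) φ)

theorem Admissible.integral_energyDensity (h : Admissible p q s) (u : W1 p) (φ : D1 q) :
    ∫ x, energyDensity s u φ x = D1.energy (D1.source (h.memLp u)) φ := by
  rw [D1.energy, D1.source_apply, D1.norm_rpow, ← integral_const_mul,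
    ← integral_sub (φ.integrable_grad_rpow.const_mul (1 / q))
      (D1.integrable_source (h.memLp u) φ)]
  rfl

theorem Admissible.isLeast_energy (h : Admissible p q s) {u : W1 p} {φ : D1 q}
    (hφ : IsSolution s u φ) :
    IsLeast (Set.range fun φ : D1 q => ∫ x, energyDensity s u φ x)
      (∫ x, energyDensity s u φ x) := by
  refine ⟨⟨φ, rfl⟩, ?_⟩
  rintro _ ⟨ψ, rfl⟩
  simp only [h.integral_energyDensity]
  exact D1.energy_le_of_form_eq (h.isSolution_iff.1 hφ) ψ

theorem Admissible.solution_nonneg (h : Admissible p q s) {u : W1 p} {φ : D1 q}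
    (hφ : IsSolution s u φ) : ∀ᵐ x, 0 ≤ φ.fn x :=
  D1.fn_nonneg_of_form_eq (h.memLp u) (fun x => by positivity) (h.isSolution_iff.1 hφ)

/-- Testing with φ itself gives ‖φ‖^q ≤ K ‖|u|^s‖_m ‖φ‖. One factor ‖φ‖ is divided out and the
embedding in L^{sm} bounds the source by ‖u‖^s. -/
theorem Admissible.exists_norm_solution_le (h : Admissible p q s) : ∃ C, 0 < C ∧
    ∀ (u : W1 p) (φ : D1 q), IsSolution s u φ → ‖φ‖ ≤ C * ‖u‖ ^ (s / (q - 1)) := by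
  have hq1 : 0 < q - 1 := by linarith [h1q.out]
  have hm := dualExp_pos q
  obtain ⟨D, hD, hI⟩ := h.exists_integral_rpow_le
  obtain ⟨K, hK, hS⟩ := D1.exists_abs_source_le q
  refine ⟨(K * D ^ (1 / dualExp q)) ^ (1 / (q - 1)), by positivity, fun u φ hφ => ?_⟩
  have h1 : ‖φ‖ ^ q ≤ K * D ^ (1 / dualExp q) * ‖u‖ ^ s * ‖φ‖ := by
    rw [← D1.form_self, h.isSolution_iff.1 hφ, D1.source_apply]
    refine (le_abs_self _).trans ((hS _ (h.memLp u) φ).trans ?_)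
    simp only [abs_abs_rpow_rpow]
    have e : (D * ‖u‖ ^ (s * dualExp q)) ^ (1 / dualExp q) = D ^ (1 / dualExp q) * ‖u‖ ^ s := by
      rw [Real.mul_rpow hD.le (by positivity), ← Real.rpow_mul (norm_nonneg u), mul_assoc,
        mul_one_div_cancel hm.ne', mul_one]
    rw [mul_assoc K (D ^ (1 / dualExp q)) (‖u‖ ^ s), ← e]
    have h0 : 0 ≤ ∫ x, |u.fn x| ^ (s * dualExp q) := integral_nonneg fun x => by positivity
    gcongr
    exact (hI u).2
  have h2 : ‖φ‖ ^ (q - 1) ≤ K * D ^ (1 / dualExp q) * ‖u‖ ^ s := by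
    rcases (norm_nonneg φ).eq_or_lt with h0 | h0
    · rw [← h0, Real.zero_rpow hq1.ne']
      positivity
    · have e : ‖φ‖ ^ q = ‖φ‖ ^ (q - 1) * ‖φ‖ := by
        rw [← Real.rpow_add_one h0.ne', sub_add_cancel]
      rw [e] at h1
      exact le_of_mul_le_mul_right h1 h0
  have h3 := Real.rpow_le_rpow (by positivity) h2 (by positivity : 0 ≤ 1 / (q - 1))
  rw [← Real.rpow_mul (norm_nonneg φ), mul_one_div_cancel hq1.ne', Real.rpow_one,
    Real.mul_rpow (by positivity) (by positivity), ← Real.rpow_mul (norm_nonneg u),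
    mul_one_div] at h3
  exact h3

/-- The set is left free: the whole space serves strong continuity, balls serve weak continuity. -/
theorem Admissible.exists_setIntegral_sub_le (h : Admissible p q s) {ε : ℝ} (hε : 0 < ε) :
    ∃ C, 0 ≤ C ∧ ∀ (u v : W1 p) (S : Set E3),
      ∫ x in S, |(|u.fn x| ^ s - |v.fn x| ^ s)| ^ dualExp q ≤
        ε * (‖u‖ ^ (s * dualExp q) + ‖v‖ ^ (s * dualExp q)) +
          C * ∫ x in S, |(u - v).fn x| ^ (s * dualExp q) := by
  obtain ⟨D, hD, hI⟩ := h.exists_integral_rpow_le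
  obtain ⟨C, hC, H⟩ := exists_abs_rpow_sub_le (zero_lt_one.trans h.one_lt) (dualExp_pos q)
    (ε := ε / D) (by positivity)
  refine ⟨C, hC, fun u v S => ?_⟩
  have i1 := (hI u).1.integrableOn (s := S)
  have i2 := (hI v).1.integrableOn (s := S)
  have i3 := (hI (u - v)).1.integrableOn (s := S)
  have j1 : IntegrableOn (fun x => ε / D * (|u.fn x| ^ (s * dualExp q) +
    |v.fn x| ^ (s * dualExp q))) S := (i1.add i2).const_mul _
  have hnn (w : W1 p) : ∫ x in S, |w.fn x| ^ (s * dualExp q) ≤ D * ‖w‖ ^ (s * dualExp q) :=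
    (setIntegral_le_integral (hI w).1 (Eventually.of_forall fun x => by positivity)).trans (hI w).2
  calc _ ≤ ∫ x in S, (ε / D * (|u.fn x| ^ (s * dualExp q) + |v.fn x| ^ (s * dualExp q)) +
        C * |(u - v).fn x| ^ (s * dualExp q)) := by
        refine integral_mono_of_nonneg (Eventually.of_forall fun x => by positivity)
          (j1.add (i3.const_mul C)) ?_
        filter_upwards [ae_restrict_of_ae (W1.fn_sub u v)] with x hx
        rw [hx]
        exact H _ _
    _ = ε / D * ((∫ x in S, |u.fn x| ^ (s * dualExp q)) + ∫ x in S, |v.fn x| ^ (s * dualExp q)) +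
        C * ∫ x in S, |(u - v).fn x| ^ (s * dualExp q) := by
        rw [integral_add j1 (i3.const_mul C), integral_const_mul, integral_const_mul,
          integral_add i1 i2]
    _ ≤ ε / D * (D * ‖u‖ ^ (s * dualExp q) + D * ‖v‖ ^ (s * dualExp q)) + _ := by
        gcongr
        · exact hnn u
        · exact hnn v
    _ = _ := by
        field_simp

theorem Admissible.tendsto_setIntegral_sub (h : Admissible p q s) {a : ℕ → W1 p} {u : W1 p} {M : ℝ}
    (hM : ∀ n, ‖a n‖ ≤ M) {S : Set E3}
    (hS : Tendsto (fun n => ∫ x in S, |(a n - u).fn x| ^ (s * dualExp q)) atTop (𝓝 0)) :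
    Tendsto (fun n => ∫ x in S, |(|(a n).fn x| ^ s - |u.fn x| ^ s)| ^ dualExp q) atTop (𝓝 0) := by
  have hr := h.exp_pos
  have hM0 : 0 ≤ M := (norm_nonneg _).trans (hM 0)
  refine tendsto_zero_of_le_add (fun n => integral_nonneg fun x => by positivity) fun ε hε => ?_
  have hB : 0 < M ^ (s * dualExp q) + ‖u‖ ^ (s * dualExp q) + 1 := by positivity
  obtain ⟨C, hC, H⟩ := h.exists_setIntegral_sub_le (div_pos hε hB)
  refine ⟨_, by simpa using hS.const_mul C, fun n => (H (a n) u S).trans ?_⟩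
  gcongr
  rw [div_mul_eq_mul_div, div_le_iff₀ hB]
  refine mul_le_mul_of_nonneg_left ?_ hε.le
  have := Real.rpow_le_rpow (norm_nonneg _) (hM n) hr.le
  linarith

/-- Quantitative monotonicity: for a bounded sequence a vanishing monotonicity pairing forces norm
convergence. -/
theorem tendsto_of_tendsto_form {φ : ℕ → D1 q} {ψ : D1 q} {M : ℝ} (hM : ∀ n, ‖φ n‖ ≤ M)
    (h : Tendsto (fun n => D1.form (φ n) (φ n - ψ) - D1.form ψ (φ n - ψ)) atTop (𝓝 0)) :
    Tendsto φ atTop (𝓝 ψ) := by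
  have hq0 : 0 < q := zero_lt_one.trans h1q.out
  have hM0 : 0 ≤ M := (norm_nonneg _).trans (hM 0)
  have key : Tendsto (fun n => ‖φ n - ψ‖ ^ q) atTop (𝓝 0) := by
    refine tendsto_zero_of_le_add (fun n => by positivity) fun ε hε => ?_
    have hB : 0 < M ^ q + ‖ψ‖ ^ q + 1 := by positivity
    obtain ⟨C, hC, H⟩ := D1.exists_norm_sub_rpow_le_form (q := q) (div_pos hε hB)
    refine ⟨_, by simpa using h.const_mul C, fun n => (H (φ n) ψ).trans ?_⟩
    gcongr
    rw [div_mul_eq_mul_div, div_le_iff₀ hB]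
    refine mul_le_mul_of_nonneg_left ?_ hε.le
    have := Real.rpow_le_rpow (norm_nonneg _) (hM n) hq0.le
    linarith
  rw [tendsto_iff_norm_sub_tendsto_zero]
  have := key.rpow_const (p := 1 / q) (Or.inr (by positivity))
  rw [Real.zero_rpow (by positivity)] at this
  refine this.congr fun n => ?_
  rw [← Real.rpow_mul (norm_nonneg _), mul_one_div_cancel hq0.ne', Real.rpow_one]

/-- The solution depends continuously on the data. -/
theorem Admissible.tendsto_solution (h : Admissible p q s) {a : ℕ → W1 p} {u : W1 p}
    {φ : ℕ → D1 q} {ψ : D1 q} (hφ : ∀ n, IsSolution s (a n) (φ n)) (hψ : IsSolution s u ψ)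
    (ha : Tendsto a atTop (𝓝 u)) : Tendsto φ atTop (𝓝 ψ) := by
  have hm := dualExp_pos q
  have hs := h.exp_pos
  have hq1 : 0 < q - 1 := by linarith [h1q.out]
  obtain ⟨M, hM⟩ := ha.norm.bddAbove_range
  have hM' (n : ℕ) : ‖a n‖ ≤ M := hM ⟨n, rfl⟩
  have hM0 : 0 ≤ M := (norm_nonneg _).trans (hM' 0)
  obtain ⟨C, hC, hb⟩ := h.exists_norm_solution_le
  obtain ⟨K, hK, hS⟩ := D1.exists_abs_source_le q
  obtain ⟨D, hD, hI⟩ := h.exists_integral_rpow_le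
  set B := C * M ^ (s / (q - 1))
  have hB (n : ℕ) : ‖φ n‖ ≤ B := by
    refine (hb _ _ (hφ n)).trans (mul_le_mul_of_nonneg_left ?_ hC.le)
    exact Real.rpow_le_rpow (norm_nonneg _) (hM' n)
      (div_nonneg (by linarith [h.one_lt]) hq1.le)
  refine tendsto_of_tendsto_form hB ?_
  have h0 : Tendsto (fun n => ∫ x in Set.univ, |(a n - u).fn x| ^ (s * dualExp q)) atTop
      (𝓝 0) := by
    have h1 : Tendsto (fun n => D * ‖a n - u‖ ^ (s * dualExp q)) atTop (𝓝 0) := by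
      have := ((tendsto_iff_norm_sub_tendsto_zero.1 ha).rpow_const (p := s * dualExp q)
        (Or.inr hs.le)).const_mul D
      simpa [Real.zero_rpow hs.ne'] using this
    refine squeeze_zero (fun n => integral_nonneg fun x => by positivity) (fun n => ?_) h1
    rw [Measure.restrict_univ]
    exact (hI _).2
  have h1 := h.tendsto_setIntegral_sub hM' h0
  have h2 := ((h1.rpow_const (p := 1 / dualExp q) (Or.inr (by positivity))).const_mul K).mul_const
    (B + ‖ψ‖)
  rw [Real.zero_rpow (by positivity), mul_zero, zero_mul] at h2
  -- By the equations, the monotonicity pairing is the difference of the sources tested with φ_n -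
  -- ψ; the first tends to zero in L^m, the second is bounded.
  refine squeeze_zero_norm (fun n => ?_) h2
  rw [h.isSolution_iff.1 (hφ n), h.isSolution_iff.1 hψ, D1.source_apply, D1.source_apply,
    ← integral_sub (D1.integrable_source (h.memLp _) _) (D1.integrable_source (h.memLp _) _),
    Real.norm_eq_abs, Measure.restrict_univ]
  simp_rw [← sub_mul]
  refine (hS (fun x => |(a n).fn x| ^ s - |u.fn x| ^ s) ((h.memLp (a n)).sub (h.memLp u))
    (φ n - ψ)).trans ?_
  have h0 : 0 ≤ ∫ x, |(|(a n).fn x| ^ s - |u.fn x| ^ s)| ^ dualExp q :=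
    integral_nonneg fun x => by positivity
  gcongr
  exact (norm_sub_le (φ n) ψ).trans (add_le_add_left (hB n) _)

end Solutions

/-! ### Homogeneity, dilations and translations -/

section Affine

/-- Dilations composed with translations. -/
def affineMap (t : ℝ) (y x : E3) : E3 := t • x + y

theorem affineMap_inv {t : ℝ} (ht : t ≠ 0) (y x : E3) :
    affineMap t⁻¹ (-(t⁻¹ • y)) (affineMap t y x) = x := by
  simp only [affineMap, smul_add, smul_smul, inv_mul_cancel₀ ht, one_smul]
  abel

theorem continuous_affineMap (t : ℝ) (y : E3) : Continuous (affineMap t y) := by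
  unfold affineMap
  fun_prop

theorem map_affineMap {t : ℝ} (ht : t ≠ 0) (y : E3) :
    Measure.map (affineMap t y) volume =
      ENNReal.ofReal |(t ^ 3)⁻¹| • (volume : Measure E3) := by
  have h1 := Measure.map_addHaar_smul (volume : Measure E3) ht
  have e : affineMap t y = (fun x => x + y) ∘ (fun x => t • x) := rfl
  rw [e, ← Measure.map_map (measurable_add_const y) (measurable_const_smul t), h1,
    Measure.map_smul, (measurePreserving_add_right volume y).map_eq]
  simp

theorem quasiMeasurePreserving_affineMap {t : ℝ} (ht : t ≠ 0) (y : E3) :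
    Measure.QuasiMeasurePreserving (affineMap t y) (volume : Measure E3) volume :=
  ⟨(continuous_affineMap t y).measurable, by
    rw [map_affineMap ht]
    exact Measure.smul_absolutelyContinuous⟩

theorem integral_comp_affineMap {F : Type*} [NormedAddCommGroup F] [NormedSpace ℝ F]
    {t : ℝ} (y : E3) (f : E3 → F) :
    ∫ x, f (affineMap t y x) = |(t ^ 3)⁻¹| • ∫ x, f x := by
  have h1 := Measure.integral_comp_smul (volume : Measure E3) (fun x => f (x + y)) t
  rw [integral_add_right_eq_self f y] at h1
  simpa [affineMap] using h1

variable {F : Type*} [NormedAddCommGroup F]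

theorem eLpNorm_comp_affineMap {t : ℝ} (ht : t ≠ 0) (y : E3) {f : E3 → F}
    (hf : AEStronglyMeasurable f volume) (p : ℝ≥0∞) :
    eLpNorm (fun x => f (affineMap t y x)) p =
      ENNReal.ofReal |(t ^ 3)⁻¹| ^ (1 / p).toReal * eLpNorm f p := by
  have h0 : ENNReal.ofReal |(t ^ 3)⁻¹| ≠ 0 := by
    rw [ne_eq, ENNReal.ofReal_eq_zero, not_le]
    positivity
  have h1 := eLpNorm_map_measure (p := p) (μ := volume) (g := f) (f := affineMap t y)
    (by rw [map_affineMap ht]; exact hf.smul_measure _)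
    (continuous_affineMap t y).measurable.aemeasurable
  rw [map_affineMap ht, eLpNorm_smul_measure_of_ne_zero h0] at h1
  exact h1.symm

theorem _root_.MeasureTheory.MemLp.comp_affineMap {t : ℝ} (ht : t ≠ 0) (y : E3) {f : E3 → F}
    {p : ℝ≥0∞} (hf : MemLp f p) : MemLp (fun x => f (affineMap t y x)) p := by
  refine ⟨hf.1.comp_quasiMeasurePreserving (quasiMeasurePreserving_affineMap ht y), ?_⟩
  rw [eLpNorm_comp_affineMap ht y hf.1]
  exact ENNReal.mul_lt_top (ENNReal.rpow_lt_top_of_nonneg (by positivity) (by simp)) hf.2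

theorem tendsto_eLpNorm_comp_affineMap {t : ℝ} (ht : t ≠ 0) (y : E3) {f : ℕ → E3 → F}
    (hf : ∀ n, AEStronglyMeasurable (f n) volume) {p : ℝ≥0∞}
    (h : Tendsto (fun n => eLpNorm (f n) p) atTop (𝓝 0)) :
    Tendsto (fun n => eLpNorm (fun x => f n (affineMap t y x)) p) atTop (𝓝 0) := by
  simp_rw [eLpNorm_comp_affineMap ht y (hf _)]
  have := ENNReal.Tendsto.const_mul (a := ENNReal.ofReal |(t ^ 3)⁻¹| ^ (1 / p).toReal) h
    (Or.inr (ENNReal.rpow_lt_top_of_nonneg (by positivity) (by simp)).ne)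
  simpa using this

theorem D1.exists_comp_affineMap {q : ℝ} [Fact (1 < q)] [Fact (q < 3)] {t : ℝ} (ht : t ≠ 0)
    (y : E3) (φ : D1 q) : ∃ ψ : D1 q, (ψ.fn =ᵐ[volume] fun x => φ.fn (affineMap t y x)) ∧
      ψ.grad =ᵐ[volume] fun x => t • φ.grad (affineMap t y x) := by
  obtain ⟨ψ, hψ, hlim⟩ := φ.exists_seq_test
  obtain ⟨l1, l2⟩ := D1.tendsto_eLpNorm_of_test hlim
  have hg (n : ℕ) : gradient (fun x => ψ n (affineMap t y x)) =
      fun x => t • gradient (ψ n) (affineMap t y x) :=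
    funext fun x => gradient_comp_affine (hψ n).differentiable t y x
  refine D1.exists_of_tendsto (φ.memLp_fn.comp_affineMap ht y)
    ((φ.memLp_grad.comp_affineMap ht y).const_smul t)
    (ψ := fun n x => ψ n (affineMap t y x)) (fun n => (hψ n).comp_affine ht y) ?_ ?_
  · exact tendsto_eLpNorm_comp_affineMap ht y (f := fun n => ψ n - φ.fn)
      (fun n => (hψ n).1.continuous.aestronglyMeasurable.sub φ.memLp_fn.1) l1
  · have := tendsto_eLpNorm_comp_affineMap ht y (f := fun n => t • (gradient (ψ n) - φ.grad))
      (p := ENNReal.ofReal q) (fun n => ((hψ n).continuous_gradient.aestronglyMeasurable.sub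
        φ.memLp_grad.1).const_smul t) (by
      simp_rw [eLpNorm_const_smul]
      simpa using ENNReal.Tendsto.const_mul (a := ‖t‖ₑ) l2 (Or.inr (by simp)))
    refine this.congr fun n => ?_
    rw [hg]
    congr 1
    funext x
    simp [smul_sub]

theorem HasWeakGrad.congr {u u' : E3 → ℝ} {g g' : E3 → E3} (h : HasWeakGrad u g)
    (hu : u' =ᵐ[volume] u) (hg : g' =ᵐ[volume] g) : HasWeakGrad u' g' := by
  intro ψ hψ
  have e1 : ∫ x, u' x • gradient ψ x = ∫ x, u x • gradient ψ x := by
    refine integral_congr_ae ?_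
    filter_upwards [hu] with x hx
    rw [hx]
  have e2 : ∫ x, ψ x • g' x = ∫ x, ψ x • g x := by
    refine integral_congr_ae ?_
    filter_upwards [hg] with x hx
    rw [hx]
  rw [e1, e2]
  exact h ψ hψ

/-- The test function is moved to the other side by the inverse map; the Jacobian occurs in both
integrals. -/
theorem HasWeakGrad.comp_affineMap {u : E3 → ℝ} {g : E3 → E3} (h : HasWeakGrad u g) {t : ℝ}
    (ht : t ≠ 0) (y : E3) :
    HasWeakGrad (fun x => u (affineMap t y x)) fun x => t • g (affineMap t y x) := by
  intro ψ hψ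
  have hχ : IsTest fun z => ψ (affineMap t⁻¹ (-(t⁻¹ • y)) z) :=
    hψ.comp_affine (inv_ne_zero ht) _
  have hgr (x : E3) : gradient (fun z => ψ (affineMap t⁻¹ (-(t⁻¹ • y)) z)) (affineMap t y x) =
      t⁻¹ • gradient ψ x := by
    have := gradient_comp_affine hψ.differentiable t⁻¹ (-(t⁻¹ • y)) (affineMap t y x)
    change gradient (fun z => ψ (affineMap t⁻¹ (-(t⁻¹ • y)) z)) (affineMap t y x) =
      t⁻¹ • gradient ψ (affineMap t⁻¹ (-(t⁻¹ • y)) (affineMap t y x)) at this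
    rw [affineMap_inv ht] at this
    exact this
  have h1 := h _ hχ
  have e1 := integral_comp_affineMap (t := t) y
    fun z => u z • gradient (fun z => ψ (affineMap t⁻¹ (-(t⁻¹ • y)) z)) z
  have e2 := integral_comp_affineMap (t := t) y
    fun z => ψ (affineMap t⁻¹ (-(t⁻¹ • y)) z) • g z
  simp only [hgr, affineMap_inv ht] at e1 e2
  rw [h1, smul_neg, ← e2] at e1
  have e3 : ∫ x, u (affineMap t y x) • gradient ψ x =
      t • ∫ x, u (affineMap t y x) • t⁻¹ • gradient ψ x := by
    rw [← integral_smul]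
    refine integral_congr_ae (Eventually.of_forall fun x => ?_)
    simp only
    rw [smul_comm t, smul_smul t, mul_inv_cancel₀ ht, one_smul]
  rw [e3, e1, smul_neg, ← integral_smul]
  simp_rw [smul_comm t]

theorem W1.exists_of_hasWeakGrad {p : ℝ} [Fact (1 < p)] {u : E3 → ℝ} {g : E3 → E3}
    (hu : MemLp u (ENNReal.ofReal p)) (hg : MemLp g (ENNReal.ofReal p)) (h : HasWeakGrad u g) :
    ∃ w : W1 p, w.fn =ᵐ[volume] u :=
  ⟨⟨WithLp.toLp _ (hu.toLp u, hg.toLp g), h.congr hu.coeFn_toLp hg.coeFn_toLp⟩, hu.coeFn_toLp⟩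

theorem W1.exists_comp_affineMap {p : ℝ} [Fact (1 < p)] {t : ℝ} (ht : t ≠ 0) (y : E3) (c : ℝ)
    (u : W1 p) : ∃ w : W1 p, w.fn =ᵐ[volume] fun x => c * u.fn (affineMap t y x) := by
  obtain ⟨w, hw⟩ := W1.exists_of_hasWeakGrad (u.memLp_fn.comp_affineMap ht y)
    ((u.memLp_grad.comp_affineMap ht y).const_smul t) (u.hasWeakGrad.comp_affineMap ht y)
  refine ⟨c • w, (W1.fn_smul c w).trans ?_⟩
  filter_upwards [hw] with x hx
  rw [hx]

variable {p q s : ℝ} [h1p : Fact (1 < p)] [h1q : Fact (1 < q)] [h3q : Fact (q < 3)]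

theorem IsSolution.eq_of_isSolution {u : W1 p} {φ ψ : D1 q} (hφ : IsSolution s u φ)
    (hψ : IsSolution s u ψ) : φ = ψ :=
  D1.eq_of_form_eq fun v => by rw [D1.form_eq, D1.form_eq, hφ v, hψ v]

theorem IsSolution.smul {u : W1 p} {φ : D1 q} (hφ : IsSolution s u φ) {t : ℝ} (ht : 0 < t) :
    IsSolution s (t • u) (t ^ (s / (q - 1)) • φ) := by
  have hq1 : 0 < q - 1 := by linarith [h1q.out]
  intro v
  have h1 : D1.form (t ^ (s / (q - 1)) • φ) v = t ^ s * D1.form φ v := by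
    rw [D1.form, D1.form, ← integral_const_mul]
    refine integral_congr_ae ?_
    filter_upwards [D1.grad_smul (t ^ (s / (q - 1))) φ] with x hx
    rw [hx, duality_smul (by positivity), real_inner_smul_left, ← Real.rpow_mul ht.le,
      div_mul_cancel₀ _ hq1.ne']
  rw [← D1.form_eq, h1, D1.form_eq, hφ v, ← integral_const_mul]
  refine integral_congr_ae ?_
  filter_upwards [W1.fn_smul t u] with x hx
  rw [hx, abs_mul, abs_of_pos ht, Real.mul_rpow ht.le (abs_nonneg _)]
  ring

/-- The transformed function solves the equation for `w`, so uniqueness identifies it with ψ. -/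
theorem IsSolution.comp_affineMap {u w : W1 p} {φ ψ : D1 q} (hφ : IsSolution s u φ)
    (hψ : IsSolution s w ψ) {t : ℝ} (ht : 0 < t) (k : ℝ) (y : E3)
    (hw : w.fn =ᵐ[volume] fun x => t ^ k * u.fn (affineMap t y x)) :
    ψ.fn =ᵐ[volume] fun x => t ^ ((k * s - q) / (q - 1)) * φ.fn (affineMap t y x) := by
  have hq1 : 0 < q - 1 := by linarith [h1q.out]
  obtain ⟨χ, hχ1, hχ2⟩ := φ.exists_comp_affineMap ht.ne' y
  set κ : ℝ := (k * s - q) / (q - 1) with hκ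
  -- This identity determines the exponent: q - 1 factors t^κ t from the gradient of the solution
  -- and one factor t from that of the test function must match t^{ks} from the source.
  have hexp : (t ^ κ * t) ^ (q - 1) * t = t ^ (k * s) := by
    rw [← Real.rpow_add_one ht.ne', ← Real.rpow_mul ht.le, ← Real.rpow_add_one ht.ne']
    congr 1
    rw [add_mul, hκ, div_mul_cancel₀ _ hq1.ne']
    ring
  have hsol : IsSolution s w (t ^ κ • χ) := by
    intro v
    -- The equation for φ is tested with `v` composed with the inverse map; the Jacobian |t³|⁻¹ then
    -- appears on both sides.
    obtain ⟨v', hv1, hv2⟩ := v.exists_comp_affineMap (inv_ne_zero ht.ne') (-(t⁻¹ • y))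
    have hv1' := (quasiMeasurePreserving_affineMap ht.ne' y).ae hv1
    have hv2' := (quasiMeasurePreserving_affineMap ht.ne' y).ae hv2
    simp only [affineMap_inv ht.ne'] at hv1' hv2'
    have e1 : D1.form (t ^ κ • χ) v = t ^ (k * s) * (|(t ^ 3)⁻¹| * D1.form φ v') := by
      rw [D1.form, D1.form, ← smul_eq_mul |(t ^ 3)⁻¹|, ← integral_comp_affineMap y,
        ← integral_const_mul]
      refine integral_congr_ae ?_
      filter_upwards [D1.grad_smul (t ^ κ) χ, hχ2, hv2'] with x h1 h2 h3
      have h4 : v.grad x = t • v'.grad (affineMap t y x) := by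
        rw [h3, smul_smul, mul_inv_cancel₀ ht.ne', one_smul]
      rw [h1, h2, h4, smul_smul, duality_smul (by positivity), real_inner_smul_left,
        real_inner_smul_right, ← hexp]
      ring
    have e2 : ∫ x, |w.fn x| ^ s * v.fn x =
        t ^ (k * s) * (|(t ^ 3)⁻¹| * ∫ x, |u.fn x| ^ s * v'.fn x) := by
      rw [← smul_eq_mul |(t ^ 3)⁻¹|, ← integral_comp_affineMap y, ← integral_const_mul]
      refine integral_congr_ae ?_
      filter_upwards [hw, hv1'] with x h1 h2
      rw [h1, h2, abs_mul, abs_of_pos (by positivity), Real.mul_rpow (by positivity)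
        (abs_nonneg _), ← Real.rpow_mul ht.le]
      ring
    rw [← D1.form_eq, e1, e2, D1.form_eq, hφ v']
  rw [hψ.eq_of_isSolution hsol]
  filter_upwards [D1.fn_smul (t ^ κ) χ, hχ1] with x h1 h2
  rw [h1, h2]

end Affine

/-! ### Cutoffs with small gradient in L³ -/

section Capacity

theorem gradient_unitBump_eq_zero {z : E3} (hz : ‖z‖ < 1 ∨ 2 < ‖z‖) : gradient unitBump z = 0 := by
  have h : fderiv ℝ unitBump z = 0 := by
    rcases hz with hz | hz
    · have : unitBump =ᶠ[𝓝 z] fun _ => (1 : ℝ) := by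
        filter_upwards [Metric.isOpen_ball.mem_nhds (mem_ball_zero_iff.2 hz)] with x hx
        exact unitBump.one_of_mem_closedBall (Metric.ball_subset_closedBall hx)
      rw [this.fderiv_eq]
      simp
    · have : unitBump =ᶠ[𝓝 z] fun _ => (0 : ℝ) := by
        filter_upwards [(isOpen_lt continuous_const continuous_norm).mem_nhds hz] with x hx
        exact unitBump.zero_of_le_dist (by simpa [unitBump] using (le_of_lt hx))
      rw [this.fderiv_eq]
      simp
  simp [gradient, h]

theorem gradient_cutoff_eq_zero {ρ : ℝ} (hρ : 0 < ρ) {x : E3} (hx : ‖x‖ < ρ ∨ 2 * ρ < ‖x‖) :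
    gradient (cutoff ρ) x = 0 := by
  rw [gradient_cutoff, gradient_unitBump_eq_zero, smul_zero]
  rw [norm_smul, norm_inv, Real.norm_of_nonneg hρ.le, inv_mul_lt_iff₀ hρ, lt_inv_mul_iff₀ hρ,
    mul_one, mul_comm ρ]
  exact hx

/-- The exponent equals the dimension, so the integral is invariant under dilations. A single
dilated cutoff therefore never becomes small, and many scales have to be averaged. -/
theorem integral_norm_gradient_cutoff {ρ : ℝ} (hρ : 0 < ρ) :
    ∫ x, ‖gradient (cutoff ρ) x‖ ^ (3 : ℝ) = ∫ x, ‖gradient unitBump x‖ ^ (3 : ℝ) := by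
  have h := integral_comp_affineMap (t := ρ⁻¹) 0 fun x => ‖gradient unitBump x‖ ^ (3 : ℝ)
  simp only [affineMap, add_zero, smul_eq_mul] at h
  have e (x : E3) : ‖gradient (cutoff ρ) x‖ ^ (3 : ℝ) =
      (ρ ^ 3)⁻¹ * ‖gradient unitBump (ρ⁻¹ • x)‖ ^ (3 : ℝ) := by
    rw [gradient_cutoff, norm_smul, norm_inv, Real.norm_of_nonneg hρ.le,
      Real.mul_rpow (by positivity) (norm_nonneg _)]
    congr 1
    norm_num
  simp_rw [e]
  rw [integral_const_mul, h, inv_pow, inv_inv, abs_of_pos (by positivity), ← mul_assoc,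
    inv_mul_cancel₀ (by positivity), one_mul]

/-- At most one summand is nonzero; this is applied to gradients supported in disjoint annuli. -/
theorem norm_sum_rpow_le {ι : Type*} (S : Finset ι) {F : Type*} [NormedAddCommGroup F]
    {f : ι → F} {r : ℝ} (hr : 0 < r)
    (h : ∀ i ∈ S, ∀ j ∈ S, f i ≠ 0 → f j ≠ 0 → i = j) :
    ‖∑ i ∈ S, f i‖ ^ r ≤ ∑ i ∈ S, ‖f i‖ ^ r := by
  by_cases hS : ∃ i ∈ S, f i ≠ 0
  · obtain ⟨i, hi, hne⟩ := hS
    rw [Finset.sum_eq_single_of_mem i hi fun j hj hji => by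
      by_contra hj0
      exact hji (h j hj i hi hj0 hne)]
    exact Finset.single_le_sum (f := fun i => ‖f i‖ ^ r) (fun j _ => by positivity) hi
  · push Not at hS
    rw [Finset.sum_eq_zero hS, norm_zero, Real.zero_rpow hr.ne']
    exact Finset.sum_nonneg fun j _ => by positivity

/-- Balls of `ℝ³` have zero conformal capacity: there are cutoff functions whose gradients are
small in `L^3`. -/
theorem exists_cutoff_small_gradient {R δ : ℝ} (hR : 0 < R) (hδ : 0 < δ) : ∃ η : E3 → ℝ,
    IsTest η ∧ (∀ x, 0 ≤ η x) ∧ (∀ x, η x ≤ 1) ∧ (∀ x, ‖x‖ ≤ R → η x = 1) ∧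
      eLpNorm (gradient η) (ENNReal.ofReal 3) ≤ ENNReal.ofReal δ := by
  set c : ℝ := ∫ x, ‖gradient unitBump x‖ ^ (3 : ℝ) with hc
  have hc0 : 0 ≤ c := integral_rpow_nonneg _ _
  -- The number of scales. Averaging N cutoffs whose gradients have disjoint supports leaves N c /
  -- N³ = c / N², and N ≥ c/δ³, N ≥ 1 make this at most δ³.
  obtain ⟨N, hN⟩ := exists_nat_ge (c / δ ^ (3 : ℝ) + 1)
  have hcN : c / δ ^ (3 : ℝ) ≤ N := by linarith
  have hN1 : (1 : ℝ) ≤ N := by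
    have : 0 ≤ c / δ ^ (3 : ℝ) := by positivity
    linarith
  have hN0 : (0 : ℝ) < N := by linarith
  have hρ (k : ℕ) : 0 < R * 4 ^ k := by positivity
  have hρR (k : ℕ) : R ≤ R * 4 ^ k := le_mul_of_one_le_right hR.le (one_le_pow₀ (by norm_num))
  set σ : E3 → ℝ := fun x => ∑ k ∈ Finset.range N, cutoff (R * 4 ^ k) x
  have hσd : ContDiff ℝ ∞ σ := ContDiff.sum fun k _ => (isTest_cutoff (hρ k)).1
  have hσg (x : E3) : gradient σ x =
      ∑ k ∈ Finset.range N, gradient (cutoff (R * 4 ^ k)) x := by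
    simp only [gradient, σ]
    rw [fderiv_fun_sum fun k _ => (isTest_cutoff (hρ k)).differentiable x, map_sum]
  have hσ0 (x : E3) : 0 ≤ σ x := Finset.sum_nonneg fun k _ => cutoff_nonneg _ _
  have hσN (x : E3) : σ x ≤ N := by
    refine (Finset.sum_le_sum fun k _ => cutoff_le_one _ _).trans ?_
    simp
  have hσ1 (x : E3) (hx : ‖x‖ ≤ R) : σ x = N := by
    simp only [σ]
    rw [Finset.sum_congr rfl fun k _ => cutoff_eq_one (hρ k) (hx.trans (hρR k))]
    simp
  have hσc : HasCompactSupport σ := by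
    refine HasCompactSupport.intro (isCompact_closedBall (0 : E3) (2 * (R * 4 ^ N))) fun x hx => ?_
    refine Finset.sum_eq_zero fun k hk => cutoff_eq_zero (hρ k) ?_
    rw [mem_closedBall_zero_iff, not_le] at hx
    refine le_trans ?_ hx.le
    gcongr
    · norm_num
    · exact (Finset.mem_range.1 hk).le
  have hσt : IsTest σ := ⟨hσd, hσc⟩
  have hdisj (x : E3) : ‖gradient σ x‖ ^ (3 : ℝ) ≤
      ∑ k ∈ Finset.range N, ‖gradient (cutoff (R * 4 ^ k)) x‖ ^ (3 : ℝ) := by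
    rw [hσg]
    refine norm_sum_rpow_le _ (by norm_num) fun i _ j _ hi hj => ?_
    -- The gradient at scale ρ = R 4^k lives in ρ ≤ ‖x‖ ≤ 2ρ; the ratio 4 > 2 separates these
    -- annuli.
    have key : ∀ i j : ℕ, i < j → gradient (cutoff (R * 4 ^ i)) x ≠ 0 →
        gradient (cutoff (R * 4 ^ j)) x ≠ 0 → False := by
      intro i j hij hi hj
      have h1 : ‖x‖ ≤ 2 * (R * 4 ^ i) := by
        by_contra h
        exact hi (gradient_cutoff_eq_zero (hρ i) (Or.inr (not_le.1 h)))
      have h2 : R * 4 ^ j ≤ ‖x‖ := by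
        by_contra h
        exact hj (gradient_cutoff_eq_zero (hρ j) (Or.inl (not_le.1 h)))
      have h3 : R * 4 ^ (i + 1) ≤ R * 4 ^ j := by
        gcongr
        · norm_num
        · exact hij
      have h4 := hρ i
      rw [pow_succ] at h3
      linarith
    rcases lt_trichotomy i j with h | h | h
    · exact (key i j h hi hj).elim
    · exact h
    · exact (key j i h hj hi).elim
  have hint (k : ℕ) : Integrable fun x => ‖gradient (cutoff (R * 4 ^ k)) x‖ ^ (3 : ℝ) :=
    ((isTest_cutoff (hρ k)).memLp_gradient _).integrable_rpow (by norm_num)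
  have hσI : ∫ x, ‖gradient σ x‖ ^ (3 : ℝ) ≤ N * c := by
    refine (integral_mono_of_nonneg (Eventually.of_forall fun x => by positivity)
      (integrable_finsetSum _ fun k _ => hint k) (Eventually.of_forall hdisj)).trans ?_
    rw [integral_finsetSum _ fun k _ => hint k,
      Finset.sum_congr rfl fun k _ => integral_norm_gradient_cutoff (hρ k)]
    simp [c]
  have hηt : IsTest fun x => (N : ℝ)⁻¹ * σ x := ⟨contDiff_const.mul hσd, hσc.mul_left⟩
  refine ⟨fun x => (N : ℝ)⁻¹ * σ x, hηt, fun x => mul_nonneg (by positivity) (hσ0 x),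
    fun x => ?_, fun x hx => ?_, ?_⟩
  · rw [inv_mul_le_iff₀ hN0, mul_one]
    exact hσN x
  · simp only [hσ1 x hx, inv_mul_cancel₀ hN0.ne']
  · refine eLpNorm_le_of_integral_rpow_le (by norm_num) hδ.le (hηt.memLp_gradient _) ?_
    have e (x : E3) : ‖gradient (fun x => (N : ℝ)⁻¹ * σ x) x‖ ^ (3 : ℝ) =
        ((N : ℝ) ^ 3)⁻¹ * ‖gradient σ x‖ ^ (3 : ℝ) := by
      have h1 : gradient (fun x => (N : ℝ)⁻¹ * σ x) x = (N : ℝ)⁻¹ • gradient σ x :=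
        congrFun (hσt.gradient_smul (N : ℝ)⁻¹) x
      rw [h1, norm_smul, norm_inv, Real.norm_of_nonneg hN0.le,
        Real.mul_rpow (by positivity) (norm_nonneg _)]
      congr 1
      norm_num
    simp_rw [e]
    rw [integral_const_mul, inv_mul_le_iff₀ (by positivity)]
    refine hσI.trans ?_
    rw [div_le_iff₀ (by positivity)] at hcN
    calc (N : ℝ) * c ≤ N * (N * δ ^ (3 : ℝ)) := by gcongr
      _ ≤ N * (N * δ ^ (3 : ℝ)) * N := le_mul_of_one_le_right (by positivity) hN1
      _ = (N : ℝ) ^ 3 * δ ^ (3 : ℝ) := by ring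

end Capacity

/-! ### Cutoffs in D^{1,q} -/

section Localization

variable {q : ℝ} [h1q : Fact (1 < q)] [h3q : Fact (q < 3)]

/-- 1/q* + 1/3 = 1/q: this is why the third power of ∇η is the relevant one. -/
theorem holderTriple_sobolevExp (q : ℝ) [h1q : Fact (1 < q)] [h3q : Fact (q < 3)] :
    (sobolevExp q).HolderTriple 3 q := by
  have h1 := h1q.out
  have h3 := h3q.out
  refine ⟨?_, sobolevExp_pos q, by norm_num⟩
  have : (3 : ℝ) - q ≠ 0 := by linarith
  have : q ≠ 0 := by linarith
  rw [sobolevExp]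
  field_simp
  ring

theorem eLpNorm_smul_le_of_holderTriple {a b c : ℝ} (h : a.HolderTriple b c) {f : E3 → ℝ}
    {g : E3 → E3} (hf : AEStronglyMeasurable f volume) (hg : AEStronglyMeasurable g volume) :
    eLpNorm (fun x => f x • g x) (ENNReal.ofReal c) ≤
      eLpNorm f (ENNReal.ofReal a) * eLpNorm g (ENNReal.ofReal b) := by
  have := h.ennrealOfReal
  have key := eLpNorm_le_eLpNorm_mul_eLpNorm_of_nnnorm (p := ENNReal.ofReal a)
    (q := ENNReal.ofReal b) (r := ENNReal.ofReal c) hf hg (fun (t : ℝ) (v : E3) => t • v) 1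
    (Eventually.of_forall fun x => by
      rw [one_mul]
      exact nnnorm_smul_le (f x) (g x))
  rwa [ENNReal.coe_one, one_mul] at key

theorem eLpNorm_smul_gradient_le {f : E3 → ℝ} (hf : AEStronglyMeasurable f volume) {η : E3 → ℝ}
    (hη : IsTest η) : eLpNorm (fun x => f x • gradient η x) (ENNReal.ofReal q) ≤
      eLpNorm f (ENNReal.ofReal (sobolevExp q)) * eLpNorm (gradient η) (ENNReal.ofReal 3) := by
  exact eLpNorm_smul_le_of_holderTriple (holderTriple_sobolevExp q) hf
    hη.continuous_gradient.aestronglyMeasurable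

namespace D1

theorem exists_eLpNorm_fn_le (q : ℝ) [Fact (1 < q)] [Fact (q < 3)] : ∃ C, 0 < C ∧ ∀ φ : D1 q,
    eLpNorm φ.fn (ENNReal.ofReal (sobolevExp q)) ≤ ENNReal.ofReal (C * ‖φ‖) := by
  obtain ⟨C, hC, h⟩ := exists_norm_fnLM_le q
  refine ⟨C, hC, fun φ => ?_⟩
  have h1 := h φ
  rw [Lp.norm_def] at h1
  exact (ENNReal.le_ofReal_iff_toReal_le φ.memLp_fn.2.ne (by positivity)).2 h1

theorem memLp_fn_smul_gradient (φ : D1 q) {η : E3 → ℝ} (hη : IsTest η) :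
    MemLp (fun x => φ.fn x • gradient η x) (ENNReal.ofReal q) :=
  ⟨φ.memLp_fn.1.smul hη.continuous_gradient.aestronglyMeasurable,
    (eLpNorm_smul_gradient_le φ.memLp_fn.1 hη).trans_lt
      (ENNReal.mul_lt_top φ.memLp_fn.2 (hη.memLp_gradient _).2)⟩

theorem memLp_smul_grad (φ : D1 q) {η : E3 → ℝ} (hη : IsTest η) (h0 : ∀ x, 0 ≤ η x)
    (h1 : ∀ x, η x ≤ 1) : MemLp (fun x => η x • φ.grad x) (ENNReal.ofReal q) :=
  φ.memLp_grad.of_le (hη.1.continuous.aestronglyMeasurable.smul φ.memLp_grad.1)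
    (Eventually.of_forall fun x => by
      rw [norm_smul, Real.norm_of_nonneg (h0 x)]
      exact mul_le_of_le_one_left (norm_nonneg _) (h1 x))

/-- Multiplication by a cutoff function. -/
theorem exists_mul_test (φ : D1 q) {η : E3 → ℝ} (hη : IsTest η) (h0 : ∀ x, 0 ≤ η x)
    (h1 : ∀ x, η x ≤ 1) : ∃ v : D1 q, (v.fn =ᵐ[volume] fun x => η x * φ.fn x) ∧
      v.grad =ᵐ[volume] fun x => η x • φ.grad x + φ.fn x • gradient η x := by
  obtain ⟨ψ, hψ, hlim⟩ := φ.exists_seq_test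
  obtain ⟨l1, l2⟩ := D1.tendsto_eLpNorm_of_test hlim
  have hmem : MemLp (fun x => η x * φ.fn x) (ENNReal.ofReal (sobolevExp q)) :=
    φ.memLp_fn.of_le (hη.1.continuous.aestronglyMeasurable.mul φ.memLp_fn.1)
      (Eventually.of_forall fun x => by
        rw [norm_mul, Real.norm_of_nonneg (h0 x)]
        exact mul_le_of_le_one_left (norm_nonneg _) (h1 x))
  refine exists_of_tendsto hmem ((φ.memLp_smul_grad hη h0 h1).add (φ.memLp_fn_smul_gradient hη))
    (ψ := fun n x => η x * ψ n x) (fun n => hη.mul_contDiff (hψ n).1) ?_ ?_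
  · refine tendsto_of_tendsto_of_tendsto_of_le_of_le tendsto_const_nhds l1 (fun _ => bot_le)
      fun n => eLpNorm_mono fun x => ?_
    simp only [Pi.sub_apply]
    rw [← mul_sub, norm_mul, Real.norm_of_nonneg (h0 x)]
    exact mul_le_of_le_one_left (norm_nonneg _) (h1 x)
  · have hlim2 : Tendsto (fun n => eLpNorm (gradient (ψ n) - φ.grad) (ENNReal.ofReal q) +
        eLpNorm (ψ n - φ.fn) (ENNReal.ofReal (sobolevExp q)) *
          eLpNorm (gradient η) (ENNReal.ofReal 3)) atTop (𝓝 0) := by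
      have h3 : eLpNorm (gradient η) (ENNReal.ofReal 3) ≠ ⊤ :=
        (hη.memLp_gradient (ENNReal.ofReal 3)).2.ne
      have := l2.add (ENNReal.Tendsto.mul_const l1 (Or.inr h3))
      rwa [zero_mul, add_zero] at this
    refine tendsto_of_tendsto_of_tendsto_of_le_of_le tendsto_const_nhds hlim2
      (fun _ => bot_le) fun n => ?_
    have m0 : AEStronglyMeasurable (fun x => ψ n x - φ.fn x) volume :=
      (hψ n).1.continuous.aestronglyMeasurable.sub φ.memLp_fn.1
    have m1 : AEStronglyMeasurable (fun x => η x • (gradient (ψ n) x - φ.grad x)) volume :=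
      hη.1.continuous.aestronglyMeasurable.smul
        ((hψ n).continuous_gradient.aestronglyMeasurable.sub φ.memLp_grad.1)
    have m2 : AEStronglyMeasurable (fun x => (ψ n x - φ.fn x) • gradient η x) volume :=
      m0.smul hη.continuous_gradient.aestronglyMeasurable
    -- The gradient error splits into a part controlled in L^q and a part controlled by the L^{q*}
    -- error times ‖∇η‖_3.
    have e (x : E3) : gradient (fun x => η x * ψ n x) x -
        (η x • φ.grad x + φ.fn x • gradient η x) =
        η x • (gradient (ψ n) x - φ.grad x) + (ψ n x - φ.fn x) • gradient η x := by
      rw [gradient_mul (hη.differentiable x) ((hψ n).differentiable x), smul_sub, sub_smul]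
      abel
    refine (le_of_eq (congrArg (fun f => eLpNorm f (ENNReal.ofReal q) volume) (funext e))).trans ?_
    refine (eLpNorm_add_le m1 m2 one_le_ofReal).trans ?_
    gcongr
    · refine eLpNorm_mono fun x => ?_
      rw [norm_smul, Real.norm_of_nonneg (h0 x)]
      exact mul_le_of_le_one_left (norm_nonneg _) (h1 x)
    · exact eLpNorm_smul_gradient_le m0 hη

theorem abs_integral_inner_duality_le (φ : D1 q) {X : E3 → E3}
    (hX : MemLp X (ENNReal.ofReal q)) {K : ℝ} (hK : 0 ≤ K) (hXK : ∫ x, ‖X x‖ ^ q ≤ K ^ q) :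
    |∫ x, inner ℝ (duality q (φ.grad x)) (X x)| ≤ ‖φ‖ ^ (q - 1) * K := by
  have hq := h1q.out
  have hq0 : 0 < q := by linarith
  refine (abs_integral_inner_le holderConjugate_conjExponent.symm φ.memLp_duality_grad hX).trans ?_
  have hq1 : q - 1 ≠ 0 := by linarith
  have e : ∫ x, ‖duality q (φ.grad x)‖ ^ (q / (q - 1)) = ‖φ‖ ^ q := by
    rw [norm_rpow]
    refine integral_congr_ae (Eventually.of_forall fun x => ?_)
    simp only [norm_duality hq]
    rw [← Real.rpow_mul (norm_nonneg _), mul_div_cancel₀ _ hq1]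
  rw [e, ← Real.rpow_mul (norm_nonneg _)]
  have e2 : q * (1 / (q / (q - 1))) = q - 1 := by field_simp
  rw [e2]
  gcongr
  refine (Real.rpow_le_rpow (integral_rpow_nonneg _ _) hXK (by positivity)).trans (le_of_eq ?_)
  rw [← Real.rpow_mul hK, mul_one_div_cancel hq0.ne', Real.rpow_one]

end D1

end Localization

/-! ### Local convergence of gradients and weak continuity -/

section WeakContinuity

/-- Companion of the inequalities containing a minimum: `b` is a difference that is small on the
ball `S`, `a` a fixed function with small tail outside it. -/
theorem integral_min_rpow_le {a b : E3 → ℝ} {r : ℝ} (hr : 0 ≤ r) (ha0 : ∀ x, 0 ≤ a x)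
    (hb0 : ∀ x, 0 ≤ b x) (ha : Integrable fun x => a x ^ r) (hb : Integrable fun x => b x ^ r)
    (ham : AEStronglyMeasurable a volume) (hbm : AEStronglyMeasurable b volume) {S : Set E3}
    (hS : MeasurableSet S) :
    Integrable (fun x => (min (a x) (b x)) ^ r) ∧
      ∫ x, (min (a x) (b x)) ^ r ≤ (∫ x in S, b x ^ r) + ∫ x in Sᶜ, a x ^ r := by
  have hi : Integrable fun x => (min (a x) (b x)) ^ r :=
    ha.mono' ((ham.aemeasurable.min hbm.aemeasurable).pow_const r).aestronglyMeasurable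
      (Eventually.of_forall fun x => by
        have h0 : 0 ≤ min (a x) (b x) := le_min (ha0 x) (hb0 x)
        rw [Real.norm_of_nonneg (by positivity)]
        exact Real.rpow_le_rpow h0 (min_le_left _ _) hr)
  refine ⟨hi, ?_⟩
  rw [← integral_add_compl hS hi]
  refine add_le_add ?_ ?_
  · exact integral_mono_ae hi.integrableOn hb.integrableOn (Eventually.of_forall fun x =>
      Real.rpow_le_rpow (le_min (ha0 x) (hb0 x)) (min_le_right _ _) hr)
  · exact integral_mono_ae hi.integrableOn ha.integrableOn (Eventually.of_forall fun x =>
      Real.rpow_le_rpow (le_min (ha0 x) (hb0 x)) (min_le_left _ _) hr)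

variable {q : ℝ} [h1q : Fact (1 < q)] [h3q : Fact (q < 3)]

namespace D1

/-- The integrand measuring the difference of two gradients. -/
def gap (φ ψ : D1 q) (x : E3) : ℝ :=
  inner ℝ (duality q (φ.grad x) - duality q (ψ.grad x)) (φ.grad x - ψ.grad x)

theorem gap_nonneg (φ ψ : D1 q) (x : E3) : 0 ≤ gap φ ψ x := inner_duality_sub_nonneg h1q.out _ _

theorem memLp_duality_sub (φ ψ : D1 q) :
    MemLp (fun x => duality q (φ.grad x) - duality q (ψ.grad x)) (ENNReal.ofReal (q / (q - 1))) :=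
  φ.memLp_duality_grad.sub ψ.memLp_duality_grad

theorem integrable_gap (φ ψ : D1 q) : Integrable (gap φ ψ) :=
  integrable_inner_of_memLp holderConjugate_conjExponent.symm (memLp_duality_sub φ ψ)
    (φ.memLp_grad.sub ψ.memLp_grad)

/-- A local energy estimate, with an error term that is small by the choice of the cutoff. -/
theorem exists_setIntegral_gap_le (q : ℝ) [h1q : Fact (1 < q)] [h3q : Fact (q < 3)] : ∃ K, 0 < K ∧
    ∀ (R δ : ℝ), 0 < R → 0 < δ → ∃ S : ℝ, ∀ (f g : E3 → ℝ)
      (hf : MemLp f (ENNReal.ofReal (dualExp q)) volume)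
      (hg : MemLp g (ENNReal.ofReal (dualExp q)) volume) (φ ψ : D1 q),
      (∀ v, form φ v = source hf v) → (∀ v, form ψ v = source hg v) →
      ∫ x in Metric.ball 0 R, gap φ ψ x ≤
        K * (∫ x in Metric.ball 0 S, |f x - g x| ^ dualExp q) ^ (1 / dualExp q) * ‖φ - ψ‖ +
          (‖φ‖ ^ (q - 1) + ‖ψ‖ ^ (q - 1)) * (K * ‖φ - ψ‖ * δ) := by
  have hq := h1q.out
  have hq0 : 0 < q := by linarith
  have hm := dualExp_pos q
  obtain ⟨K₁, hK₁, H₁⟩ := exists_abs_source_le q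
  obtain ⟨K₂, hK₂, H₂⟩ := exists_eLpNorm_fn_le q
  refine ⟨max K₁ K₂, by positivity, fun R δ hR hδ => ?_⟩
  obtain ⟨η, hη, h0, h1, hR1, hηδ⟩ := exists_cutoff_small_gradient hR hδ
  obtain ⟨S, hS⟩ : ∃ S, ∀ x, η x ≠ 0 → x ∈ Metric.ball 0 S := by
    obtain ⟨S, hS⟩ := hη.2.isCompact.isBounded.subset_ball (0 : E3)
    exact ⟨S, fun x hx => hS (subset_tsupport η hx)⟩
  refine ⟨S, fun f g hf hg φ ψ hφ hψ => ?_⟩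
  set d := φ - ψ with hd
  -- The two equations are subtracted and tested with η(φ - ψ).
  obtain ⟨v, hv1, hv2⟩ := d.exists_mul_test hη h0 h1
  have hX := d.memLp_fn_smul_gradient hη
  have hXK : ∫ x, ‖d.fn x • gradient η x‖ ^ q ≤ (K₂ * ‖d‖ * δ) ^ q := by
    refine (integral_rpow_le_of_eLpNorm_le hq0 (by positivity) hX.1
      ((eLpNorm_smul_gradient_le d.memLp_fn.1 hη).trans ?_)).2
    rw [ENNReal.ofReal_mul (by positivity)]
    gcongr
    exact H₂ d
  have b1 := abs_integral_inner_duality_le φ hX (by positivity) hXK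
  have b2 := abs_integral_inner_duality_le ψ hX (by positivity) hXK
  have iX1 : Integrable fun x => inner ℝ (duality q (φ.grad x)) (d.fn x • gradient η x) :=
    integrable_inner_of_memLp holderConjugate_conjExponent.symm φ.memLp_duality_grad hX
  have iX2 : Integrable fun x => inner ℝ (duality q (ψ.grad x)) (d.fn x • gradient η x) :=
    integrable_inner_of_memLp holderConjugate_conjExponent.symm ψ.memLp_duality_grad hX
  have iG : Integrable fun x => η x * gap φ ψ x :=
    (integrable_gap φ ψ).mono' (hη.1.continuous.aestronglyMeasurable.mul (integrable_gap φ ψ).1)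
      (Eventually.of_forall fun x => by
        rw [norm_mul, Real.norm_of_nonneg (h0 x), Real.norm_of_nonneg (gap_nonneg _ _ _)]
        exact mul_le_of_le_one_left (gap_nonneg _ _ _) (h1 x))
  have iX : Integrable fun x => inner ℝ (duality q (φ.grad x)) (d.fn x • gradient η x) -
      inner ℝ (duality q (ψ.grad x)) (d.fn x • gradient η x) := iX1.sub iX2
  -- Product rule: the localized monotonicity expression plus the terms containing (φ - ψ)∇η, which
  -- are bounded through ‖∇η‖_3 ≤ δ.
  have e1 : form φ v - form ψ v = (∫ x, η x * gap φ ψ x) +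
      ((∫ x, inner ℝ (duality q (φ.grad x)) (d.fn x • gradient η x)) -
        ∫ x, inner ℝ (duality q (ψ.grad x)) (d.fn x • gradient η x)) := by
    rw [form, form, ← integral_sub (integrable_form φ v) (integrable_form ψ v),
      ← integral_sub iX1 iX2, ← integral_add iG iX]
    refine integral_congr_ae ?_
    filter_upwards [hv2, grad_sub φ ψ] with x h2 h3
    rw [h2, hd, h3, gap]
    simp only [inner_add_right, inner_sub_left, real_inner_smul_right]
    ring
  have hfg : MemLp (fun x => (f x - g x) * η x) (ENNReal.ofReal (dualExp q)) :=
    (hf.sub hg).of_le ((hf.sub hg).1.mul hη.1.continuous.aestronglyMeasurable)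
      (Eventually.of_forall fun x => by
        rw [norm_mul, Real.norm_of_nonneg (h0 x)]
        exact mul_le_of_le_one_right (norm_nonneg _) (h1 x))
  have e2 : form φ v - form ψ v = ∫ x, (f x - g x) * η x * d.fn x := by
    rw [hφ, hψ, source_apply, source_apply,
      ← integral_sub (integrable_source hf v) (integrable_source hg v)]
    refine integral_congr_ae ?_
    filter_upwards [hv1] with x hx
    rw [hx]
    ring
  have b3 := H₁ _ hfg d
  have b4 : ∫ x, |(f x - g x) * η x| ^ dualExp q ≤
      ∫ x in Metric.ball 0 S, |f x - g x| ^ dualExp q := by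
    have i1 : Integrable fun x => |f x - g x| ^ dualExp q := (hf.sub hg).integrable_rpow hm
    rw [← integral_indicator Metric.isOpen_ball.measurableSet]
    refine integral_mono_of_nonneg (Eventually.of_forall fun x => by positivity)
      (i1.indicator Metric.isOpen_ball.measurableSet) (Eventually.of_forall fun x => ?_)
    by_cases hx : η x = 0
    · simp only [hx, mul_zero, abs_zero, Real.zero_rpow hm.ne']
      exact Set.indicator_nonneg (fun x _ => by positivity) x
    · rw [Set.indicator_of_mem (hS x hx)]
      refine Real.rpow_le_rpow (abs_nonneg _) ?_ hm.le
      rw [abs_mul, abs_of_nonneg (h0 x)]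
      exact mul_le_of_le_one_right (abs_nonneg _) (h1 x)
  have b5 : ∫ x in Metric.ball 0 R, gap φ ψ x ≤ ∫ x, η x * gap φ ψ x := by
    rw [← integral_indicator Metric.isOpen_ball.measurableSet]
    refine integral_mono ((integrable_gap φ ψ).indicator Metric.isOpen_ball.measurableSet) iG
      fun x => ?_
    by_cases hx : x ∈ Metric.ball (0 : E3) R
    · rw [Set.indicator_of_mem hx, hR1 x (mem_ball_zero_iff.1 hx).le, one_mul]
    · rw [Set.indicator_of_notMem hx]
      exact mul_nonneg (h0 x) (gap_nonneg _ _ _)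
  have b6 : K₁ * (∫ x, |(f x - g x) * η x| ^ dualExp q) ^ (1 / dualExp q) * ‖d‖ ≤
      max K₁ K₂ * (∫ x in Metric.ball 0 S, |f x - g x| ^ dualExp q) ^ (1 / dualExp q) * ‖d‖ := by
    have : 0 ≤ ∫ x, |(f x - g x) * η x| ^ dualExp q := integral_nonneg fun x => by positivity
    gcongr
    exact le_max_left _ _
  have b7 : (‖φ‖ ^ (q - 1) + ‖ψ‖ ^ (q - 1)) * (K₂ * ‖d‖ * δ) ≤
      (‖φ‖ ^ (q - 1) + ‖ψ‖ ^ (q - 1)) * (max K₁ K₂ * ‖d‖ * δ) := by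
    gcongr
    exact le_max_right _ _
  have c1 := le_abs_self (∫ x, (f x - g x) * η x * d.fn x)
  have c2 := neg_abs_le (∫ x, inner ℝ (duality q (φ.grad x)) (d.fn x • gradient η x))
  have c3 := le_abs_self (∫ x, inner ℝ (duality q (ψ.grad x)) (d.fn x • gradient η x))
  rw [e1] at e2
  rw [add_mul] at b7 ⊢
  linarith

variable {φ : ℕ → D1 q} {ψ : D1 q} {B : ℝ}

theorem tendsto_setIntegral_gap {f : ℕ → E3 → ℝ} {g : E3 → ℝ}
    (hf : ∀ n, MemLp (f n) (ENNReal.ofReal (dualExp q)) volume)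
    (hg : MemLp g (ENNReal.ofReal (dualExp q))) (hB : ∀ n, ‖φ n‖ ≤ B)
    (hφ : ∀ n v, form (φ n) v = source (hf n) v) (hψ : ∀ v, form ψ v = source hg v)
    (hfg : ∀ S, Tendsto (fun n => ∫ x in Metric.ball 0 S, |f n x - g x| ^ dualExp q) atTop (𝓝 0))
    {R : ℝ} (hR : 0 < R) :
    Tendsto (fun n => ∫ x in Metric.ball 0 R, gap (φ n) ψ x) atTop (𝓝 0) := by
  have hm := dualExp_pos q
  have hq1 : 0 ≤ q - 1 := by linarith [h1q.out]
  have hB0 : 0 ≤ B := (norm_nonneg _).trans (hB 0)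
  obtain ⟨K, hK, H⟩ := exists_setIntegral_gap_le q
  refine tendsto_zero_of_le_add (fun n => integral_nonneg fun x => gap_nonneg _ _ x) fun ε hε => ?_
  -- L bounds the coefficient of δ in the local estimate, so δ = ε/L costs at most ε. It fixes the
  -- cutoff, hence the ball of radius `S`, before n grows.
  set L : ℝ := (B ^ (q - 1) + ‖ψ‖ ^ (q - 1)) * (K * (B + ‖ψ‖)) + 1
  have hL : 0 < L := by positivity
  obtain ⟨S, hS⟩ := H R (ε / L) hR (by positivity)
  refine ⟨fun n => K * (∫ x in Metric.ball 0 S, |f n x - g x| ^ dualExp q) ^ (1 / dualExp q) *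
    (B + ‖ψ‖), ?_, fun n => ?_⟩
  · have := (((hfg S).rpow_const (p := 1 / dualExp q) (Or.inr (by positivity))).const_mul
      K).mul_const (B + ‖ψ‖)
    rwa [Real.zero_rpow (by positivity), mul_zero, zero_mul] at this
  · refine (hS _ _ (hf n) hg (φ n) ψ (hφ n) hψ).trans ?_
    have hd : ‖φ n - ψ‖ ≤ B + ‖ψ‖ := (norm_sub_le _ _).trans (add_le_add_left (hB n) _)
    have h0 : 0 ≤ ∫ x in Metric.ball 0 S, |f n x - g x| ^ dualExp q :=
      integral_nonneg fun x => by positivity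
    have h1 : (‖φ n‖ ^ (q - 1) + ‖ψ‖ ^ (q - 1)) * (K * ‖φ n - ψ‖ * (ε / L)) ≤ ε := by
      calc _ ≤ (B ^ (q - 1) + ‖ψ‖ ^ (q - 1)) * (K * (B + ‖ψ‖) * (ε / L)) := by
            gcongr
            exact hB n
        _ = (B ^ (q - 1) + ‖ψ‖ ^ (q - 1)) * (K * (B + ‖ψ‖)) * ε / L := by ring
        _ ≤ ε := by
            rw [div_le_iff₀ hL]
            simp only [L]
            nlinarith
    have h2 : K * (∫ x in Metric.ball 0 S, |f n x - g x| ^ dualExp q) ^ (1 / dualExp q) *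
        ‖φ n - ψ‖ ≤ K * (∫ x in Metric.ball 0 S, |f n x - g x| ^ dualExp q) ^ (1 / dualExp q) *
        (B + ‖ψ‖) := by gcongr
    linarith

theorem tendsto_setIntegral_grad_sub (hB : ∀ n, ‖φ n‖ ≤ B) {S : Set E3}
    (h : Tendsto (fun n => ∫ x in S, gap (φ n) ψ x) atTop (𝓝 0)) :
    Tendsto (fun n => ∫ x in S, ‖(φ n - ψ).grad x‖ ^ q) atTop (𝓝 0) := by
  have hq0 : 0 < q := zero_lt_one.trans h1q.out
  have hB0 : 0 ≤ B := (norm_nonneg _).trans (hB 0)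
  refine tendsto_zero_of_le_add (fun n => integral_nonneg fun x => by positivity) fun ε hε => ?_
  have hL : 0 < B ^ q + ‖ψ‖ ^ q + 1 := by positivity
  obtain ⟨C, hC, H⟩ := exists_norm_sub_rpow_le_inner (E := E3) h1q.out (div_pos hε hL)
  refine ⟨_, by simpa using h.const_mul C, fun n => ?_⟩
  have i1 := (φ n).integrable_grad_rpow
  have i2 := ψ.integrable_grad_rpow
  have j1 : Integrable fun x => ε / (B ^ q + ‖ψ‖ ^ q + 1) *
    (‖(φ n).grad x‖ ^ q + ‖ψ.grad x‖ ^ q) := (i1.add i2).const_mul _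
  have j2 : Integrable fun x => C * gap (φ n) ψ x := (integrable_gap (φ n) ψ).const_mul C
  have h1 : ∫ x in S, ‖(φ n - ψ).grad x‖ ^ q ≤
      ∫ x in S, (ε / (B ^ q + ‖ψ‖ ^ q + 1) * (‖(φ n).grad x‖ ^ q + ‖ψ.grad x‖ ^ q) +
        C * gap (φ n) ψ x) := by
    refine integral_mono_ae (φ n - ψ).integrable_grad_rpow.integrableOn
      (j1.add j2).integrableOn ?_
    filter_upwards [ae_restrict_of_ae (grad_sub (φ n) ψ)] with x hx
    rw [hx]
    exact H _ _
  rw [integral_add j1.integrableOn j2.integrableOn, integral_const_mul] at h1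
  refine h1.trans ?_
  gcongr
  · rw [div_mul_eq_mul_div, div_le_iff₀ hL]
    refine mul_le_mul_of_nonneg_left ?_ hε.le
    refine (setIntegral_le_integral (i1.add i2)
      (Eventually.of_forall fun x => by simp only [Pi.add_apply, Pi.zero_apply]; positivity)).trans
        ?_
    simp only [Pi.add_apply]
    rw [integral_add i1 i2, ← norm_rpow, ← norm_rpow]
    have := Real.rpow_le_rpow (norm_nonneg _) (hB n) hq0.le
    linarith
  · exact (integral_const_mul _ _).le

/-- Bounded sequences whose gradients converge locally in `L^q` converge weakly. -/
theorem weakConv_of_tendsto_setIntegral (hB : ∀ n, ‖φ n‖ ≤ B)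
    (h : ∀ R : ℝ, 0 < R →
      Tendsto (fun n => ∫ x in Metric.ball 0 R, ‖(φ n - ψ).grad x‖ ^ q) atTop (𝓝 0)) :
    WeakConv φ ψ := by
  intro ℓ
  have hq := h1q.out
  have hq0 : 0 < q := by linarith
  have hB0 : 0 ≤ B := (norm_nonneg _).trans (hB 0)
  -- Solvability for arbitrary functionals represents ℓ through the gradient of `w`; no description
  -- of the dual of L^q is needed.
  obtain ⟨w, hw⟩ := exists_form_eq ℓ
  suffices h0 : Tendsto (fun n => |ℓ (φ n) - ℓ ψ|) atTop (𝓝 0) by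
    rw [← tendsto_sub_nhds_zero_iff]
    exact (tendsto_zero_iff_abs_tendsto_zero _).2 h0
  refine tendsto_zero_of_le_add (fun n => abs_nonneg _) fun ε hε => ?_
  set L : ℝ := ‖w‖ ^ q + (B + ‖ψ‖) ^ q + 1
  have hL : 0 < L := by positivity
  obtain ⟨C, hC, H⟩ := exists_rpow_mul_le_min hq (ε := ε / 2 / L) (by positivity)
  -- Outside the ball ∇w is small in L^q; inside it the gradient differences tend to zero.
  obtain ⟨R, hR, hRw⟩ := exists_setIntegral_compl_ball_le w.integrable_grad_rpow
    (ε := ε / 2 / (C + 1)) (by positivity)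
  refine ⟨_, by simpa using (h R (by linarith)).const_mul C, fun n => ?_⟩
  set d := φ n - ψ with hd
  have i1 := w.integrable_grad_rpow
  have i2 := d.integrable_grad_rpow
  obtain ⟨i3, hmin⟩ := integral_min_rpow_le hq0.le (fun x => norm_nonneg (w.grad x))
    (fun x => norm_nonneg (d.grad x)) i1 i2 w.memLp_grad.1.norm d.memLp_grad.1.norm
    (Metric.isOpen_ball (x := (0 : E3)) (ε := R)).measurableSet
  have j1 : Integrable fun x => ε / 2 / L * (‖w.grad x‖ ^ q + ‖d.grad x‖ ^ q) :=
    (i1.add i2).const_mul _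
  have h1 : |ℓ (φ n) - ℓ ψ| ≤ ∫ x, (ε / 2 / L * (‖w.grad x‖ ^ q + ‖d.grad x‖ ^ q) +
      C * (min ‖w.grad x‖ ‖d.grad x‖) ^ q) := by
    rw [← map_sub, ← hw, form]
    refine abs_integral_le_integral_abs.trans (integral_mono (integrable_form w d).abs
      (j1.add (i3.const_mul C)) fun x => ?_)
    refine (abs_real_inner_le_norm _ _).trans ?_
    rw [norm_duality hq]
    exact H _ _ (norm_nonneg _) (norm_nonneg _)
  rw [integral_add j1 (i3.const_mul C), integral_const_mul, integral_const_mul,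
    integral_add i1 i2, ← norm_rpow, ← norm_rpow] at h1
  have h2 : ε / 2 / L * (‖w‖ ^ q + ‖d‖ ^ q) ≤ ε / 2 := by
    rw [div_mul_eq_mul_div, div_le_iff₀ hL]
    refine mul_le_mul_of_nonneg_left ?_ (by positivity)
    have hdn : ‖d‖ ≤ B + ‖ψ‖ := (norm_sub_le _ _).trans (add_le_add_left (hB n) _)
    have := Real.rpow_le_rpow (norm_nonneg _) hdn hq0.le
    simp only [L]
    linarith
  have h3 : C * ∫ x in (Metric.ball (0 : E3) R)ᶜ, ‖w.grad x‖ ^ q ≤ ε / 2 := by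
    refine (mul_le_mul_of_nonneg_left hRw hC).trans ?_
    rw [mul_div_assoc', div_le_iff₀ (by positivity)]
    nlinarith
  have h4 := mul_le_mul_of_nonneg_left hmin hC
  rw [mul_add] at h4
  linarith

end D1

variable {p s : ℝ} [h1p : Fact (1 < p)]

theorem WeakConv.exists_norm_le {X : Type*} [NormedAddCommGroup X] [NormedSpace ℝ X] {a : ℕ → X}
    {b : X} (h : WeakConv a b) : ∃ M, 0 ≤ M ∧ ∀ n, ‖a n‖ ≤ M := by
  obtain ⟨M, hM0, hM⟩ := h.exists_bound
  refine ⟨M + ‖b‖, by positivity, fun n => ?_⟩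
  have := norm_add_le (a n - b) b
  rw [sub_add_cancel] at this
  linarith [hM n]

theorem Admissible.exists_solution_bound (h : Admissible p q s) {a : ℕ → W1 p} {M : ℝ}
    (hM : ∀ n, ‖a n‖ ≤ M) {φ : ℕ → D1 q} (hφ : ∀ n, IsSolution s (a n) (φ n)) :
    ∃ B, ∀ n, ‖φ n‖ ≤ B := by
  obtain ⟨C, hC, hb⟩ := h.exists_norm_solution_le
  refine ⟨C * M ^ (s / (q - 1)), fun n => (hb _ _ (hφ n)).trans
    (mul_le_mul_of_nonneg_left ?_ hC.le)⟩
  exact Real.rpow_le_rpow (norm_nonneg _) (hM n)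
    (div_nonneg (by linarith [h.one_lt]) (by linarith [h1q.out]))

/-- The solution operator is sequentially weakly continuous. -/
theorem Admissible.weakConv_solution (h : Admissible p q s) {a : ℕ → W1 p} {u : W1 p}
    {φ : ℕ → D1 q} {ψ : D1 q} (hφ : ∀ n, IsSolution s (a n) (φ n)) (hψ : IsSolution s u ψ)
    (ha : WeakConv a u) : WeakConv φ ψ := by
  obtain ⟨M, -, hM⟩ := ha.exists_norm_le
  obtain ⟨B, hB⟩ := h.exists_solution_bound hM hφ
  refine D1.weakConv_of_tendsto_setIntegral hB fun R hR => D1.tendsto_setIntegral_grad_sub hB ?_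
  exact D1.tendsto_setIntegral_gap (fun n => h.memLp (a n)) (h.memLp u) hB
    (fun n => h.isSolution_iff.1 (hφ n)) (h.isSolution_iff.1 hψ)
    (fun S => h.tendsto_setIntegral_sub hM
      (ha.tendsto_setIntegral_ball_rpow h.lt_three h.lt_exp h.exp_lt S)) hR

theorem W1.aestronglyMeasurable_duality (hs : 1 < s) (u : W1 p) :
    AEStronglyMeasurable (fun x => duality s (u.fn x)) volume :=
  (continuous_duality hs).comp_aestronglyMeasurable u.memLp_fn.1

/-- The pointwise inequality for differences with second argument 0 bounds |u|^{s-1}|v| to the power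
m by r-th powers of u and v. -/
theorem Admissible.memLp_duality_mul (h : Admissible p q s) (u v : W1 p) :
    MemLp (fun x => duality s (u.fn x) * v.fn x) (ENNReal.ofReal (dualExp q)) := by
  have hm := dualExp_pos q
  have hr := h.exp_pos
  have hmeas : AEStronglyMeasurable (fun x => duality s (u.fn x) * v.fn x) volume :=
    (u.aestronglyMeasurable_duality h.one_lt).mul v.memLp_fn.1
  obtain ⟨C, hC, H⟩ := exists_abs_duality_sub_mul_le h.one_lt hm one_pos
  rw [memLp_ofReal_iff hm hmeas]
  have i1 := h.integrable_rpow u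
  have i2 := h.integrable_rpow v
  refine ((i1.add i2).add (i2.const_mul C)).mono'
    (hmeas.norm.aemeasurable.pow_const _).aestronglyMeasurable (Eventually.of_forall fun x => ?_)
  have h1 := H (u.fn x) 0 (v.fn x)
  have h2 : duality s (0 : ℝ) = 0 := by simp [duality]
  rw [h2, sub_zero, sub_zero, abs_zero, Real.zero_rpow hr.ne', add_zero, one_mul] at h1
  have h3 : (min |u.fn x| |v.fn x|) ^ (s * dualExp q) ≤ |v.fn x| ^ (s * dualExp q) :=
    Real.rpow_le_rpow (by positivity) (min_le_right _ _) hr.le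
  have h4 := mul_le_mul_of_nonneg_left h3 hC
  rw [Real.norm_of_nonneg (by positivity), Real.norm_eq_abs]
  simp only [Pi.add_apply]
  linarith

/-- Although `a n` converges only locally, the fixed factor `v` makes the convergence global: its
tail is small in L^r and handles the exterior of a large ball. -/
theorem Admissible.tendsto_integral_duality_mul_sub (h : Admissible p q s) {a : ℕ → W1 p}
    {u : W1 p} (ha : WeakConv a u) (v : W1 p) :
    Tendsto (fun n => ∫ x, |duality s ((a n).fn x) * v.fn x - duality s (u.fn x) * v.fn x| ^
      dualExp q) atTop (𝓝 0) := by
  have hm := dualExp_pos q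
  have hr := h.exp_pos
  obtain ⟨M, hM0, hM⟩ := ha.exists_norm_le
  obtain ⟨D, hD, hI⟩ := h.exists_integral_rpow_le
  refine tendsto_zero_of_le_add (fun n => integral_nonneg fun x => by positivity) fun ε hε => ?_
  set r := s * dualExp q with hrdef
  set L : ℝ := D * M ^ r + D * ‖u‖ ^ r + D * ‖v‖ ^ r + 1 with hLdef
  have hL : 0 < L := by positivity
  obtain ⟨C, hC, H⟩ := exists_abs_duality_sub_mul_le h.one_lt hm (ε := ε / 2 / L) (by positivity)
  obtain ⟨R, hR, hRv⟩ := exists_setIntegral_compl_ball_le (h.integrable_rpow v)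
    (ε := ε / 2 / (C + 1)) (by positivity)
  have hloc := ha.tendsto_setIntegral_ball_rpow h.lt_three h.lt_exp h.exp_lt R
  refine ⟨_, by simpa using hloc.const_mul C, fun n => ?_⟩
  have i1 := h.integrable_rpow (a n)
  have i2 := h.integrable_rpow u
  have i3 := h.integrable_rpow v
  have i4 := h.integrable_rpow (a n - u)
  obtain ⟨i5, hmin⟩ := integral_min_rpow_le hr.le (fun x => abs_nonneg (v.fn x))
    (fun x => abs_nonneg ((a n - u).fn x)) i3 i4 v.memLp_fn.1.norm (a n - u).memLp_fn.1.norm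
    (Metric.isOpen_ball (x := (0 : E3)) (ε := R)).measurableSet
  have j0 : Integrable fun x => |(a n).fn x| ^ r + |u.fn x| ^ r := i1.add i2
  have j1 : Integrable fun x => ε / 2 / L * (|(a n).fn x| ^ r + |u.fn x| ^ r + |v.fn x| ^ r) :=
    (j0.add i3).const_mul _
  have h1 : ∫ x, |duality s ((a n).fn x) * v.fn x - duality s (u.fn x) * v.fn x| ^ dualExp q ≤
      ∫ x, (ε / 2 / L * (|(a n).fn x| ^ r + |u.fn x| ^ r + |v.fn x| ^ r) +
        C * (min |v.fn x| |(a n - u).fn x|) ^ r) := by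
    refine integral_mono_of_nonneg (Eventually.of_forall fun x => by positivity)
      (j1.add (i5.const_mul C)) ?_
    filter_upwards [W1.fn_sub (a n) u] with x hx
    rw [hx, ← sub_mul, min_comm]
    exact H _ _ _
  rw [integral_add j1 (i5.const_mul C), integral_const_mul, integral_const_mul,
    integral_add j0 i3, integral_add i1 i2] at h1
  have h2 : ε / 2 / L * ((∫ x, |(a n).fn x| ^ r) + (∫ x, |u.fn x| ^ r) + ∫ x, |v.fn x| ^ r) ≤
      ε / 2 := by
    rw [div_mul_eq_mul_div, div_le_iff₀ hL]
    refine mul_le_mul_of_nonneg_left ?_ (by positivity)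
    have k1 := (hI (a n)).2
    have k2 := (hI u).2
    have k3 := (hI v).2
    have k4 := mul_le_mul_of_nonneg_left (Real.rpow_le_rpow (norm_nonneg _) (hM n) hr.le) hD.le
    rw [hLdef]
    linarith
  have h3 : C * ∫ x in (Metric.ball (0 : E3) R)ᶜ, |v.fn x| ^ r ≤ ε / 2 := by
    refine (mul_le_mul_of_nonneg_left hRv hC).trans ?_
    rw [mul_div_assoc', div_le_iff₀ (by positivity)]
    nlinarith
  have h4 := mul_le_mul_of_nonneg_left hmin hC
  rw [mul_add] at h4
  linarith

theorem Admissible.integrable_mul_duality_mul (h : Admissible p q s) (ψ : D1 q) (u v : W1 p) :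
    Integrable fun x => ψ.fn x * (|u.fn x| ^ (s - 2) * u.fn x) * v.fn x := by
  refine (D1.integrable_source (h.memLp_duality_mul u v) ψ).congr
    (Eventually.of_forall fun x => ?_)
  simp only [duality, smul_eq_mul, Real.norm_eq_abs]
  ring

theorem Admissible.tendsto_integral_mul_duality_mul (h : Admissible p q s) {a : ℕ → W1 p}
    {u : W1 p} {φ : ℕ → D1 q} {ψ : D1 q} (hφ : ∀ n, IsSolution s (a n) (φ n))
    (hψ : IsSolution s u ψ) (ha : WeakConv a u) (v : W1 p) :
    Tendsto (fun n => ∫ x, (φ n).fn x * (|(a n).fn x| ^ (s - 2) * (a n).fn x) * v.fn x) atTop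
      (𝓝 (∫ x, ψ.fn x * (|u.fn x| ^ (s - 2) * u.fn x) * v.fn x)) := by
  have hm := dualExp_pos q
  obtain ⟨M, -, hM⟩ := ha.exists_norm_le
  obtain ⟨B, hB⟩ := h.exists_solution_bound hM hφ
  have hB0 : 0 ≤ B := (norm_nonneg _).trans (hB 0)
  obtain ⟨K, hK, hS⟩ := D1.exists_abs_source_le q
  -- For the fixed limiting weight, the integral is a bounded functional on D^{1,q}, so weak
  -- convergence of the solutions suffices.
  have hweak := h.weakConv_solution hφ hψ ha (D1.source (h.memLp_duality_mul u v))
  have e (ψ : D1 q) (u : W1 p) :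
      ∫ x, ψ.fn x * (|u.fn x| ^ (s - 2) * u.fn x) * v.fn x =
        D1.source (h.memLp_duality_mul u v) ψ := by
    rw [D1.source_apply]
    refine integral_congr_ae (Eventually.of_forall fun x => ?_)
    simp only [duality, smul_eq_mul, Real.norm_eq_abs]
    ring
  simp_rw [e]
  have hlim := (((h.tendsto_integral_duality_mul_sub ha v).rpow_const (p := 1 / dualExp q)
    (Or.inr (by positivity))).const_mul K).mul_const B
  rw [Real.zero_rpow (by positivity), mul_zero, zero_mul] at hlim
  -- Replacing the weight by its limit costs its L^m distance, which tends to zero, times the bound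
  -- for φ_n.
  have hdiff : Tendsto (fun n => D1.source (h.memLp_duality_mul (a n) v) (φ n) -
      D1.source (h.memLp_duality_mul u v) (φ n)) atTop (𝓝 0) := by
    refine squeeze_zero_norm (fun n => ?_) hlim
    rw [D1.source_apply, D1.source_apply,
      ← integral_sub (D1.integrable_source (h.memLp_duality_mul (a n) v) _)
        (D1.integrable_source (h.memLp_duality_mul u v) _), Real.norm_eq_abs]
    simp_rw [← sub_mul (_ * _) (_ * _)]
    refine (hS (fun x => duality s ((a n).fn x) * v.fn x - duality s (u.fn x) * v.fn x)
      ((h.memLp_duality_mul (a n) v).sub (h.memLp_duality_mul u v)) (φ n)).trans ?_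
    have h0 : 0 ≤ ∫ x, |duality s ((a n).fn x) * v.fn x - duality s (u.fn x) * v.fn x| ^
      dualExp q := integral_nonneg fun x => by positivity
    gcongr
    exact hB n
  simpa using hdiff.add hweak

end WeakContinuity

end QSP

end

/-! ### The main theorem -/

theorem proposition2p2 (p q s : ℝ) [Fact (1 < p)] [Fact (1 < q)] [Fact (q < 3)]
    (hp : p < 3)
    (hq : max 1 (3 * p / (5 * p - 3)) < q)
    (hs₁ : max 1 ((QSP.sobolevExp q - 1) * p / QSP.sobolevExp q) < s)
    (hs₂ : s < (QSP.sobolevExp q - 1) * QSP.sobolevExp p / QSP.sobolevExp q) :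
    -- for every `u` the equation has exactly one solution, and
    (∀ u : QSP.W1 p, ∃! φ : QSP.D1 q, QSP.IsSolution s u φ) ∧
    -- the solution map `u ↦ Φ u` has the following properties
    ∀ Φ : QSP.W1 p → QSP.D1 q, (∀ u, QSP.IsSolution s u (Φ u)) →
      -- (i) the energy is well defined and minimized by `Φ u`, and `Φ u ≥ 0`
      (∀ u : QSP.W1 p,
        (∀ φ : QSP.D1 q, Integrable (QSP.energyDensity s u φ)) ∧
        IsLeast (Set.range fun φ : QSP.D1 q => ∫ x, QSP.energyDensity s u φ x)
          (∫ x, QSP.energyDensity s u (Φ u) x) ∧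
        ∀ᵐ x, 0 ≤ (Φ u).fn x) ∧
      -- (ii) homogeneity, scaling, translation
      (∀ (u : QSP.W1 p) (t : ℝ), 0 < t → Φ (t • u) = t ^ (s / (q - 1)) • Φ u) ∧
      (∀ (u : QSP.W1 p) (t k : ℝ), 0 < t →
        (∃ w : QSP.W1 p, w.fn =ᵐ[volume] fun x => t ^ k * u.fn (t • x)) ∧
        ∀ w : QSP.W1 p, (w.fn =ᵐ[volume] fun x => t ^ k * u.fn (t • x)) →
          (Φ w).fn =ᵐ[volume] fun x => t ^ ((k * s - q) / (q - 1)) * (Φ u).fn (t • x)) ∧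
      (∀ (u : QSP.W1 p) (y : QSP.E3),
        (∃ w : QSP.W1 p, w.fn =ᵐ[volume] fun x => u.fn (x + y)) ∧
        ∀ w : QSP.W1 p, (w.fn =ᵐ[volume] fun x => u.fn (x + y)) →
          (Φ w).fn =ᵐ[volume] fun x => (Φ u).fn (x + y)) ∧
      -- (iii) the bound
      (∃ C : ℝ, 0 < C ∧ ∀ u : QSP.W1 p, ‖Φ u‖ ≤ C * ‖u‖ ^ (s / (q - 1))) ∧
      -- (iv) weak continuity (the integrals being well defined)
      (∀ u φ : QSP.W1 p, Integrable
        fun x => (Φ u).fn x * (|u.fn x| ^ (s - 2) * u.fn x) * φ.fn x) ∧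
      (∀ (a : ℕ → QSP.W1 p) (u : QSP.W1 p), QSP.WeakConv a u →
        QSP.WeakConv (fun n => Φ (a n)) (Φ u) ∧
        ∀ φ : QSP.W1 p,
          Tendsto
            (fun n => ∫ x, (Φ (a n)).fn x * (|(a n).fn x| ^ (s - 2) * (a n).fn x) * φ.fn x)
            atTop (𝓝 (∫ x, (Φ u).fn x * (|u.fn x| ^ (s - 2) * u.fn x) * φ.fn x))) ∧
      -- (v) strong continuity
      (∀ (a : ℕ → QSP.W1 p) (u : QSP.W1 p), Tendsto a atTop (𝓝 u) →
        Tendsto (fun n => Φ (a n)) atTop (𝓝 (Φ u))) := by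
  have h : QSP.Admissible p q s := QSP.admissible_of_lt hp hs₁ hs₂
  refine ⟨fun u => h.existsUnique_solution u, fun Φ hΦ => ⟨fun u =>
    ⟨fun φ => h.integrable_energyDensity u φ, h.isLeast_energy (hΦ u), h.solution_nonneg (hΦ u)⟩,
    fun u t ht => (hΦ _).eq_of_isSolution ((hΦ u).smul ht), fun u t k ht => ⟨?_, fun w hw => ?_⟩,
    fun u y => ⟨?_, fun w hw => ?_⟩, ?_, fun u φ => h.integrable_mul_duality_mul (Φ u) u φ,
    fun a u ha => ⟨h.weakConv_solution (fun n => hΦ _) (hΦ u) ha,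
      fun φ => h.tendsto_integral_mul_duality_mul (fun n => hΦ _) (hΦ u) ha φ⟩,
    fun a u ha => h.tendsto_solution (fun n => hΦ _) (hΦ u) ha⟩⟩
  · simpa [QSP.affineMap] using QSP.W1.exists_comp_affineMap ht.ne' 0 (t ^ k) u
  · simpa [QSP.affineMap] using
      (hΦ u).comp_affineMap (hΦ w) ht k 0 (by simpa [QSP.affineMap] using hw)
  · simpa [QSP.affineMap] using QSP.W1.exists_comp_affineMap one_ne_zero y 1 u
  -- Translation is the case t = 1, k = 0, in which every power of t equals 1.
  · simpa [QSP.affineMap] using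
      (hΦ u).comp_affineMap (hΦ w) one_pos 0 y (by simpa [QSP.affineMap] using hw)
  · obtain ⟨C, hC, H⟩ := h.exists_norm_solution_le
    exact ⟨C, hC, fun u => H u _ (hΦ u)⟩
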